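/- Let $I=(0,1)$, let $\lambda_n>0$, $\delta_n>0$ be sequences with $\lambda_n\to0$, $\delta_n\to0$, and put $N_n=\lfloor 1/\lambda_n\rfloor$. Consider chains of spins $u=(u^0,\dots,u^{N_n})$ with $u^i\in S^1\subset\mathbb R^2$ satisfying the boundary condition $(u^1,u^0)=(u^{N_n},u^{N_n-1})$, with energy (for ferromagnetic parameter $J_1=4(1-\delta_n)$) $$H_n^{hf}(u)=\frac12\sum_{i=0}^{N_n-2}\lambda_n\left|u^{i+2}-2(1-\delta_n)u^{i+1}+u^i\right|^2 .$$ For $i=0,\dots,N_n-1$ let $\theta_n^i=\chi[u^i,u^{i+1}]\arccos\big((u^i,u^{i+1})\big)\in[-\pi,\pi)$, where $\chi[v,w]=\operatorname{sign}(v_1w_2-v_2w_1)$ with $\operatorname{sign}(0)=-1$, and let $z_n^i=\sqrt{2/\delta_n}\,\sin(\theta_n^i/2)$. A function $z\in L^1(I)$ is said to be associated with $u$ if $z=z_n^i$ a.e. on $\lambda_n(i+[0,1))$ for $i=0,\dots,N_n-1$. Since $z$ determines $u$ up to a rotation, which does not change the energy, we may set $H_n^{hf}(z)=H_n^{hf}(u)$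 if $z$ is associated with some such chain $u$, and $H_n^{hf}(z)=+\infty$ for all other $z\in L^1(I)$. Assume that $l:=\lim_n \lambda_n/(2\delta_n)^{1/2}\in[0,+\infty]$ exists. Then the functionals $H_n^{hf}/(\sqrt2\,\lambda_n\delta_n^{3/2})$ on $L^1(I)$ $\Gamma$-converge, with respect to $L^1(I)$ convergence, to the following functional $H^{hf}$. (i) If $l=0$: $H^{hf}(z)=\frac83\,\#S(z)$ if $z\in BV(I,\{\pm1\})$, and $+\infty$ otherwise, where $S(z)\subset I$ is the jump set of $z$. (ii) If $l\in(0,+\infty)$: $H^{hf}(z)=\frac1l\int_I(z^2-1)^2\,dx+l\int_I(z')^2\,dx$ if $z\in W^{1,2}(I)$ and $|z(0)|=|z(1)|$, and $+\infty$ otherwise. (iii) If $l=+\infty$: $H^{hf}(z)=0$ if $z$ is (a.e. equal to) a constant, and $+\infty$ otherwise. -/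

import Mathlib

open MeasureTheory Filter Topology
open scoped ENNReal NNReal ContDiff

namespace SpinChain

/-! ### Gamma-convergence -/

/-- Sequential `Γ`-convergence: the liminf inequality along every converging sequence and the
existence of a recovery sequence. (On a metrizable space, such as `L¹`, this is `Γ`-convergence.) -/
def GammaConverges {X : Type*} [TopologicalSpace X] (F : ℕ → X → ℝ≥0∞) (F₀ : X → ℝ≥0∞) : Prop :=
  ∀ z : X,
    (∀ y : ℕ → X, Tendsto y atTop (𝓝 z) → F₀ z ≤ liminf (fun n => F n (y n)) atTop) ∧
    (∃ y : ℕ → X, Tendsto y atTop (𝓝 z) ∧ limsup (fun n => F n (y n)) atTop ≤ F₀ z)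

/-! ### The discrete energy -/

/-- The unit circle `S¹` in `ℝ²`. -/
abbrev Circle1 : Type := Metric.sphere (0 : EuclideanSpace ℝ (Fin 2)) 1

/-- Scalar product of two spins. -/
noncomputable def dot (v w : Circle1) : ℝ :=
  inner ℝ (v : EuclideanSpace ℝ (Fin 2)) (w : EuclideanSpace ℝ (Fin 2))

/-- `χ[v,w] = sign (v₁ w₂ - v₂ w₁)` with the convention `sign 0 = -1`. -/
noncomputable def chi (v w : Circle1) : ℝ :=
  if 0 < v.1 0 * w.1 1 - v.1 1 * w.1 0 then 1 else -1

/-- The oriented central angle in `[-π, π)` from `v` to `w`. -/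
noncomputable def angle (v w : Circle1) : ℝ := chi v w * Real.arccos (dot v w)

/-- `[1/lam]`: the sites of the chain in `[0,1]` are `lam * i`, `i = 0, …, numCells lam`. -/
noncomputable def numCells (lam : ℝ) : ℕ := ⌊1 / lam⌋₊

/-- The boundary condition `(u¹,u⁰) = (u^N, u^{N-1})`. Configurations are functions on `ℕ`, of which
only the values at `0, …, N` are ever used. -/
def IsPeriodic (N : ℕ) (u : ℕ → Circle1) : Prop :=
  dot (u 1) (u 0) = dot (u N) (u (N - 1))

/-- The renormalized energy of a configuration,
`½ ∑_{i=0}^{[1/lam]-2} lam |u^{i+2} - 2 (1 - del) u^{i+1} + u^i|²`. -/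
noncomputable def spinEnergy (lam del : ℝ) (u : ℕ → Circle1) : ℝ :=
  (1 / 2) * ∑ i ∈ Finset.range (numCells lam - 1),
    lam * ‖(u (i + 2) : EuclideanSpace ℝ (Fin 2))
      - (2 * (1 - del)) • (u (i + 1) : EuclideanSpace ℝ (Fin 2))
      + (u i : EuclideanSpace ℝ (Fin 2))‖ ^ 2

/-- The chirality order parameter `zⁱ = √(2/del) sin (θⁱ / 2)`. -/
noncomputable def chirality (del : ℝ) (u : ℕ → Circle1) (i : ℕ) : ℝ :=
  Real.sqrt (2 / del) * Real.sin (angle (u i) (u (i + 1)) / 2)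

/-- Lebesgue measure on `I = (0,1)`. -/
noncomputable abbrev muI : Measure ℝ := volume.restrict (Set.Ioo 0 1)

/-- The space `L¹(I)`. -/
abbrev L1I : Type := Lp ℝ 1 muI

/-- `z` is the piecewise constant function associated with the order parameter of `u`: it is equal
to `zⁱ` on `lam (i + [0,1))` for `i = 0, …, [1/lam] - 1`. -/
def IsChiralityOf (lam del : ℝ) (u : ℕ → Circle1) (z : ℝ → ℝ) : Prop :=
  ∀ i < numCells lam, ∀ᵐ x ∂muI,
    x ∈ Set.Ico (lam * i) (lam * (i + 1)) → z x = chirality del u i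

/-- The energy as a functional on `L¹(I)`: the energy of any configuration `u` (with the boundary
condition) whose order parameter is `z`, and `+∞` if there is none. All such `u` differ by a
rotation and have the same energy, so the infimum is over at most one value. -/
noncomputable def Hhf (lam del : ℝ) (z : L1I) : ℝ≥0∞ :=
  ⨅ (u : ℕ → Circle1) (_ : IsPeriodic (numCells lam) u) (_ : IsChiralityOf lam del u z),
    ENNReal.ofReal (spinEnergy lam del u)

/-- The scaled energy `H(z) / (√2 lam del^{3/2})`. -/
noncomputable def scaledHhf (lam del : ℝ) (z : L1I) : ℝ≥0∞ :=
  Hhf lam del z / ENNReal.ofReal (Real.sqrt 2 * lam * del ^ (3 / 2 : ℝ))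

/-! ### Function spaces on `I = (0,1)` -/

/-- `φ ∈ C_c^∞(I)`. -/
def IsTestFun (φ : ℝ → ℝ) : Prop :=
  ContDiff ℝ ∞ φ ∧ HasCompactSupport φ ∧ tsupport φ ⊆ Set.Ioo 0 1

/-- `z ∈ BV(I, {±1})`, for a `z` that is integrable on `I`: the values are `±1` a.e. and the
variation `sup {∫ z φ' : φ ∈ C_c^∞(I), |φ| ≤ 1}` is finite. -/
def IsBVpm (z : ℝ → ℝ) : Prop :=
  (∀ᵐ x ∂muI, z x = 1 ∨ z x = -1) ∧
  ∃ C : ℝ, ∀ φ : ℝ → ℝ, IsTestFun φ → (∀ x, |φ x| ≤ 1) → ∫ x, z x * deriv φ x ∂muI ≤ C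

/-- The jump set `S(z)`: the points of `I` at which `z` has no approximate limit. -/
def jumpSet (z : ℝ → ℝ) : Set ℝ :=
  {x | x ∈ Set.Ioo (0 : ℝ) 1 ∧
    ¬ ∃ a : ℝ, Tendsto (fun r => ⨍ y in Metric.ball x r, |z y - a| ∂muI) (𝓝[>] 0) (𝓝 0)}

/-- `g ∈ L¹_loc(I)` is the weak derivative of `z` on `I`. -/
def IsWeakDeriv (z g : ℝ → ℝ) : Prop :=
  LocallyIntegrableOn g (Set.Ioo 0 1) ∧
  ∀ φ : ℝ → ℝ, IsTestFun φ → ∫ x, z x * deriv φ x ∂muI = - ∫ x, g x * φ x ∂muI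

/-- `z ∈ W^{1,2}(I)`. -/
def IsW12 (z : ℝ → ℝ) : Prop :=
  MemLp z 2 muI ∧ ∃ g : ℝ → ℝ, MemLp g 2 muI ∧ IsWeakDeriv z g

/-- `z ∈ W^{1,2}(I)` and `|z(0)| = |z(1)|`, the end values being those of the representative of `z`
that is continuous on `[0,1]`. -/
def IsW12per (z : ℝ → ℝ) : Prop :=
  IsW12 z ∧ ∃ w : ℝ → ℝ, ContinuousOn w (Set.Icc 0 1) ∧ z =ᵐ[muI] w ∧ |w 0| = |w 1|

open Classical in
/-- The weak derivative `z'` on `I` (unique up to null sets; `0` if there is none). -/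
noncomputable def weakDeriv (z : ℝ → ℝ) : ℝ → ℝ :=
  if h : ∃ g, IsWeakDeriv z g then h.choose else 0

/-! ### The limit functionals -/

open Classical in
/-- `(8/3) #S(z)` on `BV(I, {±1})`, `+∞` otherwise. -/
noncomputable def limitZero (z : L1I) : ℝ≥0∞ :=
  if IsBVpm z then (8 / 3 : ℝ≥0∞) * ((jumpSet z).encard : ℝ≥0∞) else ⊤

open Classical in
/-- `(1/l) ∫ (z² - 1)² + l ∫ (z')²` on the functions in `W^{1,2}(I)` with `|z(0)| = |z(1)|`,
`+∞` otherwise. -/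
noncomputable def limitFinite (l : ℝ) (z : L1I) : ℝ≥0∞ :=
  if IsW12per z then
    ENNReal.ofReal (1 / l) * (∫⁻ x, ENNReal.ofReal ((z x ^ 2 - 1) ^ 2) ∂muI)
      + ENNReal.ofReal l * (∫⁻ x, ENNReal.ofReal (weakDeriv z x ^ 2) ∂muI)
  else ⊤

open Classical in
/-- `0` on the constants, `+∞` otherwise. -/
noncomputable def limitTop (z : L1I) : ℝ≥0∞ :=
  if ∃ c : ℝ, z =ᵐ[muI] fun _ => c then 0 else ⊤

end SpinChain

/-! Each bond of the chain is encoded by its chirality. Resolving `u (i+2) - 2(1-δ) u (i+1) + u i`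
in the orthonormal frame of the middle spin `u (i+1)` turns the scaled energy, with `h = √(2δ)`,
into a discrete Modica–Mortola sum of terms `h A² + D²/h`, where `A = (aᵢ² + aᵢ₊₁²)/2 - 1` and `D`
is the increment of `shrink δ a`. An energy bound forces `δ a²` to be small uniformly in `i`, so
`shrink` is asymptotically the identity and `D` may be replaced by `aᵢ₊₁ - aᵢ` at the price of a
factor `κ → 1` (`quadEnergy_le`). As a Riemann sum the energy is `(h/λ) Σ λ A² + (λ/h) Σ λ (D/λ)²`,
and `λ/h → l` decides the limit.

Lower bounds. A liminf below `c` yields a subsequence of chains of energy at most `c` that converges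
a.e. (`exists_chainLimit`), and it remains to bound the limit functional by `c`. For `l = ∞`,
Cauchy–Schwarz shows that the oscillation of the chain tends to zero. For `l = 0`, the inequality `h
A² + D²/h ≥ 2 |A| |D|` bounds the total variation of `wellPrimitive ∘ a` by about `c/2`; every jump
of the limit uses up `4/3` of it, hence costs `8/3`. For `0 < l < ∞`, Fatou's lemma handles the
potential, weak `L²` compactness of the difference quotients the gradient, and a discrete Hölder-1/2
estimate carries the boundary condition to the limit.

Upper bounds. Constants serve for `l = ∞`. For `l = 0`, a function with values `±1` and finitely
many jumps is a product of signs, because its primitive is differentiable off the jumps and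
derivatives have the Darboux property; each sign is then replaced by a truncated `tanh`, the profile
for which the inequality above is asymptotically an equality. For `0 < l < ∞`, the continuous
representative is sampled at equidistant nodes that include both end points. -/

namespace SpinChain

/-! ### From spins to chiralities -/

/-- The determinant `v₁ w₂ - v₂ w₁` of two spins. -/
noncomputable def cross (v w : Circle1) : ℝ := v.1 0 * w.1 1 - v.1 1 * w.1 0

/-- `z √(1 - δ z² / 2)`: up to the factor `√(2 δ)`, the sine of the angle whose chirality is `z`. -/
noncomputable def shrink (δ z : ℝ) : ℝ := z * Real.sqrt (1 - δ * z ^ 2 / 2)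

/-- The scaled energy as a function of the chiralities of the `N` bonds. -/
noncomputable def chainEnergy (δ : ℝ) (N : ℕ) (a : ℕ → ℝ) : ℝ :=
  ∑ i ∈ Finset.range (N - 1),
    (Real.sqrt (2 * δ) / 4 * (a i ^ 2 + a (i + 1) ^ 2 - 2) ^ 2 +
      1 / Real.sqrt (2 * δ) * (shrink δ (a (i + 1)) - shrink δ (a i)) ^ 2)

theorem Circle1.sq_add_sq (v : Circle1) : v.1 0 ^ 2 + v.1 1 ^ 2 = 1 := by
  have h : ‖v.1‖ ^ 2 = 1 := by simp
  rw [EuclideanSpace.norm_sq_eq, Fin.sum_univ_two] at h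
  simpa only [Real.norm_eq_abs, sq_abs] using h

theorem dot_eq (v w : Circle1) : dot v w = v.1 0 * w.1 0 + v.1 1 * w.1 1 := by
  simp [dot, PiLp.inner_apply, Fin.sum_univ_two]
  ring

theorem dot_comm (v w : Circle1) : dot v w = dot w v := by
  rw [dot_eq, dot_eq]; ring

theorem dot_sq_add_cross_sq (v w : Circle1) : dot v w ^ 2 + cross v w ^ 2 = 1 := by
  rw [dot_eq, cross]
  linear_combination (w.1 0 ^ 2 + w.1 1 ^ 2) * v.sq_add_sq + w.sq_add_sq

theorem cos_angle (v w : Circle1) : Real.cos (angle v w) = dot v w := by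
  have h := dot_sq_add_cross_sq v w
  have h1 : -1 ≤ dot v w := by nlinarith [sq_nonneg (cross v w)]
  have h2 : dot v w ≤ 1 := by nlinarith [sq_nonneg (cross v w)]
  unfold angle chi
  split_ifs
  · rw [one_mul, Real.cos_arccos h1 h2]
  · rw [neg_one_mul, Real.cos_neg, Real.cos_arccos h1 h2]

theorem sin_angle (v w : Circle1) : Real.sin (angle v w) = cross v w := by
  have h := dot_sq_add_cross_sq v w
  have h1 : Real.sin (Real.arccos (dot v w)) = |cross v w| := by
    rw [Real.sin_arccos, ← Real.sqrt_sq_eq_abs]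
    congr 1
    linarith
  unfold angle chi
  split_ifs with hc
  · rw [one_mul, h1]; exact abs_of_pos hc
  · rw [neg_one_mul, Real.sin_neg, h1, abs_of_nonpos (show cross v w ≤ 0 from not_lt.1 hc), neg_neg]

theorem abs_angle_le (v w : Circle1) : |angle v w| ≤ Real.pi := by
  have h0 := Real.arccos_nonneg (dot v w)
  have h1 := Real.arccos_le_pi (dot v w)
  unfold angle chi
  split_ifs
  · rwa [one_mul, abs_of_nonneg h0]
  · rwa [neg_one_mul, abs_neg, abs_of_nonneg h0]

theorem del_mul_chirality_sq {δ : ℝ} (hδ : 0 < δ) (u : ℕ → Circle1) (i : ℕ) :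
    δ * chirality δ u i ^ 2 = 2 * Real.sin (angle (u i) (u (i + 1)) / 2) ^ 2 := by
  unfold chirality
  rw [mul_pow, Real.sq_sqrt (by positivity)]
  field_simp

theorem del_mul_chirality_sq_le {δ : ℝ} (hδ : 0 < δ) (u : ℕ → Circle1) (i : ℕ) :
    δ * chirality δ u i ^ 2 ≤ 2 := by
  rw [del_mul_chirality_sq hδ]
  nlinarith [Real.sin_sq_le_one (angle (u i) (u (i + 1)) / 2)]

theorem dot_eq_chirality {δ : ℝ} (hδ : 0 < δ) (u : ℕ → Circle1) (i : ℕ) :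
    dot (u i) (u (i + 1)) = 1 - δ * chirality δ u i ^ 2 := by
  rw [del_mul_chirality_sq hδ, ← cos_angle]
  conv_lhs => rw [show angle (u i) (u (i + 1)) = 2 * (angle (u i) (u (i + 1)) / 2) by ring]
  rw [Real.cos_two_mul, Real.cos_sq']
  ring

/-- `sin θ = 2 sin (θ/2) cos (θ/2)`; since `|θ| ≤ π`, the cosine is the nonnegative root of `1 -
sin² (θ/2)`. -/
theorem cross_eq_chirality {δ : ℝ} (hδ : 0 < δ) (u : ℕ → Circle1) (i : ℕ) :
    cross (u i) (u (i + 1)) = Real.sqrt (2 * δ) * shrink δ (chirality δ u i) := by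
  set θ := angle (u i) (u (i + 1)) with hθ
  have hb := abs_le.1 (abs_angle_le (u i) (u (i + 1)))
  have hc : Real.cos (θ / 2) = Real.sqrt (1 - δ * chirality δ u i ^ 2 / 2) := by
    rw [del_mul_chirality_sq hδ, Real.cos_eq_sqrt_one_sub_sin_sq (by linarith [hb.1])
      (by linarith [hb.2])]
    congr 1
    ring
  have hs : Real.sqrt (2 * δ) * Real.sqrt (2 / δ) = 2 := by
    rw [← Real.sqrt_mul (by positivity), show 2 * δ * (2 / δ) = 2 ^ 2 by field_simp]
    simp
  rw [shrink, ← hc, ← sin_angle, ← hθ, show θ = 2 * (θ / 2) by ring, Real.sin_two_mul,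
    show 2 * (θ / 2) / 2 = θ / 2 by ring]
  unfold chirality
  rw [← hθ]
  linear_combination (-Real.sin (θ / 2) * Real.cos (θ / 2)) * hs

/-- Pythagoras in the orthonormal frame formed by `w` and its rotation by a right angle: the two
squares are the radial and the tangential component. -/
theorem norm_sq_eq_dot_cross (v w x : Circle1) (c : ℝ) :
    ‖(x : EuclideanSpace ℝ (Fin 2)) - c • (w : EuclideanSpace ℝ (Fin 2))
      + (v : EuclideanSpace ℝ (Fin 2))‖ ^ 2 =
      (dot v w + dot w x - c) ^ 2 + (cross w x - cross v w) ^ 2 := by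
  rw [EuclideanSpace.norm_sq_eq, Fin.sum_univ_two, dot_eq, dot_eq, cross, cross]
  have h := w.sq_add_sq
  simp only [PiLp.add_apply, PiLp.sub_apply, PiLp.smul_apply, smul_eq_mul, Real.norm_eq_abs, sq_abs]
  generalize w.1 0 = w0 at *
  generalize w.1 1 = w1 at *
  generalize v.1 0 = v0 at *
  generalize v.1 1 = v1 at *
  generalize x.1 0 = x0 at *
  generalize x.1 1 = x1 at *
  linear_combination (c ^ 2 - (x0 + v0) ^ 2 - (x1 + v1) ^ 2) * h

/-- With `c = 2 (1 - δ)` the radial component is `-δ (aᵢ² + aᵢ₊₁² - 2)`, which is the double-well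
term, and the tangential one is the increment of `√(2δ) shrink δ a`. -/
theorem spinEnergy_eq {lam δ : ℝ} (hlam : 0 < lam) (hδ : 0 < δ) (u : ℕ → Circle1) :
    spinEnergy lam δ u = Real.sqrt 2 * lam * δ ^ (3 / 2 : ℝ) *
      chainEnergy δ (numCells lam) (chirality δ u) := by
  have hp : δ ^ (3 / 2 : ℝ) = δ * Real.sqrt δ := by
    rw [show (3 / 2 : ℝ) = 1 + 1 / 2 by norm_num, Real.rpow_add hδ, Real.rpow_one,
      Real.sqrt_eq_rpow]
  unfold spinEnergy chainEnergy
  rw [Finset.mul_sum, Finset.mul_sum]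
  refine Finset.sum_congr rfl fun i _ => ?_
  rw [norm_sq_eq_dot_cross, dot_eq_chirality hδ, dot_eq_chirality hδ u (i + 1),
    cross_eq_chirality hδ u (i + 1), cross_eq_chirality hδ u i, hp, Real.sqrt_mul (by norm_num) δ]
  have h2 : Real.sqrt 2 ^ 2 = 2 := Real.sq_sqrt (by norm_num)
  have h3 : Real.sqrt δ ^ 2 = δ := Real.sq_sqrt hδ.le
  have h2' : Real.sqrt 2 ≠ 0 := by positivity
  have h3' : Real.sqrt δ ≠ 0 := by positivity
  field_simp
  rw [h2]
  generalize chirality δ u i = z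
  generalize chirality δ u (i + 1) = w
  ring_nf
  rw [h3]
  ring_nf

/-- A scalar product of neighbours sees only the square of the chirality, so the boundary condition
fixes moduli but not signs. -/
theorem isPeriodic_iff {δ : ℝ} (hδ : 0 < δ) {N : ℕ} (hN : 1 ≤ N) (u : ℕ → Circle1) :
    IsPeriodic N u ↔ |chirality δ u 0| = |chirality δ u (N - 1)| := by
  unfold IsPeriodic
  rw [dot_comm, dot_eq_chirality hδ u 0, dot_comm]
  have := dot_eq_chirality hδ u (N - 1)
  rw [Nat.sub_add_cancel hN] at this
  rw [this, ← sq_eq_sq_iff_abs_eq_abs]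
  constructor
  · intro h
    have : δ * chirality δ u 0 ^ 2 = δ * chirality δ u (N - 1) ^ 2 := by linarith
    exact mul_left_cancel₀ hδ.ne' this
  · intro h
    rw [h]

/-- The spin at angle `θ`. -/
noncomputable def spinAt (θ : ℝ) : Circle1 :=
  ⟨!₂[Real.cos θ, Real.sin θ], by simp [EuclideanSpace.norm_eq, Fin.sum_univ_two]⟩

/-- The value `θ = π` has to be excluded: there the sine vanishes, `chi` is `-1`, and the angle is
`-π`. -/
theorem angle_spinAt {α θ : ℝ} (h1 : -Real.pi < θ) (h2 : θ < Real.pi) :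
    angle (spinAt α) (spinAt (α + θ)) = θ := by
  have hd : dot (spinAt α) (spinAt (α + θ)) = Real.cos θ := by
    rw [dot_eq, show Real.cos θ = Real.cos ((α + θ) - α) by ring_nf, Real.cos_sub]
    simp [spinAt]
    ring
  have hc : (spinAt α).1 0 * (spinAt (α + θ)).1 1 - (spinAt α).1 1 * (spinAt (α + θ)).1 0 =
      Real.sin θ := by
    rw [show Real.sin θ = Real.sin ((α + θ) - α) by ring_nf, Real.sin_sub]
    simp [spinAt]
    ring
  unfold angle chi
  rw [hd, hc]
  split_ifs with h
  · have h0 : 0 ≤ θ := by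
      by_contra! h0
      linarith [Real.sin_neg_of_neg_of_neg_pi_lt h0 h1]
    rw [one_mul, Real.arccos_cos h0 h2.le]
  · have h0 : θ ≤ 0 := by
      by_contra! h0
      exact h (Real.sin_pos_of_pos_of_lt_pi h0 h2)
    rw [← Real.cos_neg, Real.arccos_cos (by linarith) (by linarith)]
    ring

/-- The spins are obtained by adding up the prescribed turning angles. Strictness of `ha` keeps
every angle inside `(-π, π)`. -/
theorem exists_chirality_eq {δ : ℝ} (hδ : 0 < δ) {a : ℕ → ℝ} (ha : ∀ i, δ * a i ^ 2 < 2) :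
    ∃ u : ℕ → Circle1, chirality δ u = a := by
  have hr : Real.sqrt (δ / 2) ^ 2 = δ / 2 := Real.sq_sqrt (by positivity)
  have hs : ∀ i, |Real.sqrt (δ / 2) * a i| < 1 := fun i => by
    rw [← sq_lt_one_iff_abs_lt_one, mul_pow, hr]
    linarith [ha i]
  refine ⟨fun i => spinAt (∑ j ∈ Finset.range i, 2 * Real.arcsin (Real.sqrt (δ / 2) * a j)), ?_⟩
  funext i
  have h := abs_lt.1 (hs i)
  have h1 := Real.neg_pi_div_two_lt_arcsin.2 h.1
  have h2 := Real.arcsin_lt_pi_div_two.2 h.2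
  simp only [chirality]
  rw [Finset.sum_range_succ, angle_spinAt (by linarith) (by linarith),
    mul_div_cancel_left₀ _ two_ne_zero, Real.sin_arcsin h.1.le h.2.le, ← mul_assoc,
    ← Real.sqrt_mul (by positivity), show 2 / δ * (δ / 2) = 1 by field_simp, Real.sqrt_one, one_mul]

theorem scale_pos {lam δ : ℝ} (hlam : 0 < lam) (hδ : 0 < δ) :
    0 < Real.sqrt 2 * lam * δ ^ (3 / 2 : ℝ) := by positivity

theorem scaledHhf_le {lam δ : ℝ} (hlam : 0 < lam) (hδ : 0 < δ) (hN : 1 ≤ numCells lam)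
    {a : ℕ → ℝ} (ha : ∀ i, δ * a i ^ 2 < 2) (hper : |a 0| = |a (numCells lam - 1)|) {z : L1I}
    (hz : ∀ i < numCells lam, ∀ᵐ x ∂muI, x ∈ Set.Ico (lam * i) (lam * (i + 1)) → z x = a i) :
    scaledHhf lam δ z ≤ ENNReal.ofReal (chainEnergy δ (numCells lam) a) := by
  obtain ⟨u, rfl⟩ := exists_chirality_eq hδ ha
  refine ENNReal.div_le_of_le_mul ?_
  rw [← ENNReal.ofReal_mul' (scale_pos hlam hδ).le, mul_comm, ← spinEnergy_eq hlam hδ]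
  exact iInf_le_of_le u (iInf₂_le_of_le ((isPeriodic_iff hδ hN u).2 hper) hz le_rfl)

theorem exists_of_scaledHhf_lt {lam δ : ℝ} (hlam : 0 < lam) (hδ : 0 < δ) (hN : 1 ≤ numCells lam)
    {z : L1I} {c : ℝ≥0∞} (h : scaledHhf lam δ z < c) :
    ∃ a : ℕ → ℝ, (∀ i, δ * a i ^ 2 ≤ 2) ∧ |a 0| = |a (numCells lam - 1)| ∧
      (∀ i < numCells lam, ∀ᵐ x ∂muI, x ∈ Set.Ico (lam * i) (lam * (i + 1)) → z x = a i) ∧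
      ENNReal.ofReal (chainEnergy δ (numCells lam) a) < c := by
  have hs := scale_pos hlam hδ
  have hs' : ENNReal.ofReal (Real.sqrt 2 * lam * δ ^ (3 / 2 : ℝ)) ≠ 0 := by simpa using hs
  unfold scaledHhf at h
  rw [ENNReal.div_lt_iff (Or.inl hs') (Or.inl ENNReal.ofReal_ne_top)] at h
  unfold Hhf at h
  simp only [iInf_lt_iff] at h
  obtain ⟨u, hu, hz, h⟩ := h
  refine ⟨chirality δ u, del_mul_chirality_sq_le hδ u, (isPeriodic_iff hδ hN u).1 hu, hz, ?_⟩
  rw [spinEnergy_eq hlam hδ, mul_comm, ENNReal.ofReal_mul' hs.le] at h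
  exact lt_of_mul_lt_mul_right' h

/-! ### Replacing `shrink` by the identity -/

/-- With `p`, `q` the two square roots, `b q - a p = (b - a)(p + q)/2 + (a + b)(q - p)/2`, and
rationalising `q - p = δ (a² - b²) / (2 (p + q))` brings out the factor `b - a`. Both corrections to
`r = 1` are of order `ε`. -/
theorem exists_shrink_sub_eq {δ ε a b : ℝ} (hδ : 0 < δ) (hε : ε ≤ 1) (ha : δ * a ^ 2 ≤ ε)
    (hb : δ * b ^ 2 ≤ ε) :
    ∃ r : ℝ, shrink δ b - shrink δ a = (b - a) * r ∧ 0 ≤ r ∧ r ≤ 1 ∧ 1 - 2 * ε ≤ r := by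
  have ha0 : 0 ≤ δ * a ^ 2 := by positivity
  have hb0 : 0 ≤ δ * b ^ 2 := by positivity
  unfold shrink
  have hp2 := Real.sq_sqrt (show 0 ≤ 1 - δ * a ^ 2 / 2 by linarith)
  have hq2 := Real.sq_sqrt (show 0 ≤ 1 - δ * b ^ 2 / 2 by linarith)
  have hp0 := Real.sqrt_nonneg (1 - δ * a ^ 2 / 2)
  have hq0 := Real.sqrt_nonneg (1 - δ * b ^ 2 / 2)
  set p := Real.sqrt (1 - δ * a ^ 2 / 2)
  set q := Real.sqrt (1 - δ * b ^ 2 / 2)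
  have hp1 : p ≤ 1 := by nlinarith
  have hq1 : q ≤ 1 := by nlinarith
  have hpl : 1 - ε / 2 ≤ p := by nlinarith
  have hql : 1 - ε / 2 ≤ q := by nlinarith
  have hpq : 1 ≤ p + q := by linarith
  have hab : δ * (a + b) ^ 2 ≤ 4 * ε := by nlinarith [mul_nonneg hδ.le (sq_nonneg (a - b))]
  -- This is the nonnegativity of `r`. From `p², q² ≥ 1/2` follows `p q ≥ 1/2`, which is just
  -- enough.
  have hab' : δ * (a + b) ^ 2 ≤ 2 * (p + q) ^ 2 := by
    have : δ * (a + b) ^ 2 ≤ 2 * (δ * a ^ 2 + δ * b ^ 2) := by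
      nlinarith [mul_nonneg hδ.le (sq_nonneg (a - b))]
    have h1 : 1 / 4 ≤ (p * q) ^ 2 := by
      rw [mul_pow]
      have e1 : 1 / 2 ≤ p ^ 2 := by linarith
      have e2 : 1 / 2 ≤ q ^ 2 := by linarith
      nlinarith
    have h2 : 1 / 2 ≤ p * q := by
      by_contra! hlt
      have : 0 ≤ p * q := by positivity
      nlinarith
    nlinarith
  have hab0 : 0 ≤ δ * (a + b) ^ 2 := by positivity
  refine ⟨(p + q) / 2 - δ / 4 * (a + b) ^ 2 / (p + q), ?_, ?_, ?_, ?_⟩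
  · field_simp
    ring_nf
    have e : δ * b ^ 2 = 2 - 2 * q ^ 2 := by linarith
    have e' : δ * a ^ 2 = 2 - 2 * p ^ 2 := by linarith
    linear_combination 2 * (a + b) * (e - e')
  · rw [sub_nonneg, div_le_iff₀ (by linarith)]
    linarith
  · have : 0 ≤ δ / 4 * (a + b) ^ 2 / (p + q) := by positivity
    linarith
  · have : δ / 4 * (a + b) ^ 2 / (p + q) ≤ ε := by
      rw [div_le_iff₀ (by linarith)]
      have : 0 ≤ ε := ha0.trans ha
      nlinarith
    linarith

theorem shrink_sub_sq_le {δ a b : ℝ} (hδ : 0 < δ) (ha : δ * a ^ 2 ≤ 1) (hb : δ * b ^ 2 ≤ 1) :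
    (shrink δ b - shrink δ a) ^ 2 ≤ (b - a) ^ 2 := by
  obtain ⟨r, h, h0, h1, -⟩ := exists_shrink_sub_eq hδ le_rfl ha hb
  rw [h, mul_pow]
  exact mul_le_of_le_one_right (sq_nonneg _) (pow_le_one₀ h0 h1)

theorem le_shrink_sub_sq {δ ε a b : ℝ} (hδ : 0 < δ) (hε : ε ≤ 1 / 2) (ha : δ * a ^ 2 ≤ ε)
    (hb : δ * b ^ 2 ≤ ε) :
    (1 - 2 * ε) ^ 2 * (b - a) ^ 2 ≤ (shrink δ b - shrink δ a) ^ 2 := by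
  obtain ⟨r, h, h0, -, h1⟩ := exists_shrink_sub_eq hδ (by linarith) ha hb
  rw [h, mul_pow, mul_comm]
  exact mul_le_mul_of_nonneg_left (pow_le_pow_left₀ (by linarith) h1 2) (sq_nonneg _)

/-- The energy with a prefactor `κ` in front of the gradient term and without `shrink`. -/
noncomputable def quadEnergy (h κ : ℝ) (N : ℕ) (a : ℕ → ℝ) : ℝ :=
  ∑ i ∈ Finset.range (N - 1),
    (h / 4 * (a i ^ 2 + a (i + 1) ^ 2 - 2) ^ 2 + κ / h * (a (i + 1) - a i) ^ 2)

theorem chainEnergy_le_quadEnergy {δ : ℝ} (hδ : 0 < δ) {a : ℕ → ℝ} (ha : ∀ i, δ * a i ^ 2 ≤ 1)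
    (N : ℕ) : chainEnergy δ N a ≤ quadEnergy (Real.sqrt (2 * δ)) 1 N a := by
  refine Finset.sum_le_sum fun i _ => ?_
  have := shrink_sub_sq_le hδ (ha i) (ha (i + 1))
  exact add_le_add le_rfl (mul_le_mul_of_nonneg_left this (by positivity))

/-- A single potential term is at most `c`, and as `δ = h²/2` this already gives `δ (aᵢ² + aᵢ₊₁²) ≤
h² + √(c h³)`. That quantity is the `ε` in the comparison of `shrink` with the identity. -/
theorem quadEnergy_le {δ c : ℝ} (hδ : 0 < δ) {N : ℕ} {a : ℕ → ℝ} (hc : chainEnergy δ N a ≤ c)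
    (hε : Real.sqrt (2 * δ) ^ 2 + Real.sqrt (c * Real.sqrt (2 * δ) ^ 3) ≤ 1 / 2) :
    quadEnergy (Real.sqrt (2 * δ))
      ((1 - 2 * (Real.sqrt (2 * δ) ^ 2 + Real.sqrt (c * Real.sqrt (2 * δ) ^ 3))) ^ 2) N a ≤ c := by
  refine le_trans (Finset.sum_le_sum fun i hi => ?_) hc
  have hterm : Real.sqrt (2 * δ) / 4 * (a i ^ 2 + a (i + 1) ^ 2 - 2) ^ 2 ≤ c := by
    refine le_trans ?_ hc
    refine le_trans ?_ (Finset.single_le_sum (fun j _ => ?_) hi)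
    · have : 0 ≤ 1 / Real.sqrt (2 * δ) * (shrink δ (a (i + 1)) - shrink δ (a i)) ^ 2 := by
        positivity
      linarith
    · positivity
  set h := Real.sqrt (2 * δ) with hh
  have hpos : 0 < h := by positivity
  have hδh : δ = h ^ 2 / 2 := by rw [hh, Real.sq_sqrt (by positivity)]; ring
  have hs : δ * (a i ^ 2 + a (i + 1) ^ 2) ≤ h ^ 2 + Real.sqrt (c * h ^ 3) := by
    have : δ * (a i ^ 2 + a (i + 1) ^ 2 - 2) ≤ Real.sqrt (c * h ^ 3) := by
      refine Real.le_sqrt_of_sq_le ?_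
      rw [mul_pow, hδh]
      calc (h ^ 2 / 2) ^ 2 * (a i ^ 2 + a (i + 1) ^ 2 - 2) ^ 2
          = h ^ 3 * (h / 4 * (a i ^ 2 + a (i + 1) ^ 2 - 2) ^ 2) := by ring
        _ ≤ h ^ 3 * c := by gcongr
        _ = c * h ^ 3 := by ring
    nlinarith
  have h1 : 0 ≤ δ * a i ^ 2 := by positivity
  have h2 : 0 ≤ δ * a (i + 1) ^ 2 := by positivity
  have key := le_shrink_sub_sq hδ hε (a := a i) (b := a (i + 1)) (by linarith) (by linarith)
  have e : ∀ κ D : ℝ, κ / h * D = 1 / h * (κ * D) := fun κ D => by ring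
  rw [e]
  exact add_le_add le_rfl (mul_le_mul_of_nonneg_left key (by positivity))


/-! ### Lattice cells and piecewise constant functions on the unit interval -/

theorem muI_eq_Ico : muI = volume.restrict (Set.Ico (0 : ℝ) 1) :=
  Measure.restrict_congr_set Ioo_ae_eq_Ico

theorem muI_eq_Ioc : muI = volume.restrict (Set.Ioc (0 : ℝ) 1) :=
  Measure.restrict_congr_set Ioo_ae_eq_Ioc

instance : IsProbabilityMeasure muI := ⟨by simp [muI]⟩

theorem ae_mem_Ioo : ∀ᵐ x ∂muI, x ∈ Set.Ioo (0 : ℝ) 1 := ae_restrict_mem measurableSet_Ioo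

theorem mul_numCells_le {lam : ℝ} (hlam : 0 < lam) : lam * numCells lam ≤ 1 := by
  have := Nat.floor_le (show 0 ≤ 1 / lam by positivity)
  rw [le_div_iff₀ hlam] at this
  unfold numCells
  linarith

theorem lt_mul_numCells {lam : ℝ} (hlam : 0 < lam) : 1 - lam < lam * numCells lam := by
  have := Nat.lt_floor_add_one (1 / lam)
  rw [div_lt_iff₀ hlam] at this
  unfold numCells
  linarith

theorem mem_Ico_iff_floor {lam x : ℝ} (hlam : 0 < lam) (hx : 0 ≤ x) (i : ℕ) :
    x ∈ Set.Ico (lam * i) (lam * (i + 1)) ↔ ⌊x / lam⌋₊ = i := by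
  rw [Nat.floor_eq_iff (by positivity), Set.mem_Ico, le_div_iff₀ hlam, div_lt_iff₀ hlam,
    mul_comm lam, mul_comm lam]

theorem mul_floor_le {lam x : ℝ} (hlam : 0 < lam) (hx : 0 ≤ x) : lam * ⌊x / lam⌋₊ ≤ x :=
  ((mem_Ico_iff_floor hlam hx _).2 rfl).1

theorem lt_mul_floor {lam x : ℝ} (hlam : 0 < lam) (hx : 0 ≤ x) : x < lam * (⌊x / lam⌋₊ + 1) :=
  ((mem_Ico_iff_floor hlam hx _).2 rfl).2

theorem tendsto_mul_floor {lam : ℕ → ℝ} (hlam : ∀ n, 0 < lam n) (hlam0 : Tendsto lam atTop (𝓝 0))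
    {x : ℝ} (hx : 0 ≤ x) : Tendsto (fun n => lam n * ⌊x / lam n⌋₊) atTop (𝓝 x) := by
  have h1 : Tendsto (fun n => x - lam n) atTop (𝓝 x) := by
    simpa using tendsto_const_nhds.sub hlam0
  refine tendsto_of_tendsto_of_tendsto_of_le_of_le h1 tendsto_const_nhds (fun n => ?_)
    fun n => mul_floor_le (hlam n) hx
  have := lt_mul_floor (hlam n) hx
  simp only
  linarith

/-- The cells of the chain may miss a final piece of `(0,1)` shorter than `λ`; a fixed `x < 1` and
its next `k` cells are eventually covered. -/
theorem eventually_floor_add_lt {lam : ℕ → ℝ} (hlam : ∀ n, 0 < lam n)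
    (hlam0 : Tendsto lam atTop (𝓝 0)) {x : ℝ} (hx : 0 ≤ x) (hx1 : x < 1) (k : ℕ) :
    ∀ᶠ n in atTop, ⌊x / lam n⌋₊ + k < numCells (lam n) := by
  have h1 : Tendsto (fun n => (k + 1 : ℝ) * lam n) atTop (𝓝 0) := by
    simpa using hlam0.const_mul (k + 1 : ℝ)
  filter_upwards [h1.eventually (gt_mem_nhds (sub_pos.2 hx1))] with n hn
  have h2 := mul_floor_le (hlam n) hx
  have h3 := lt_mul_numCells (hlam n)
  have : lam n * (⌊x / lam n⌋₊ + k) < lam n * numCells (lam n) := by nlinarith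
  exact_mod_cast lt_of_mul_lt_mul_left this (hlam n).le

theorem eventually_le_numCells {lam : ℕ → ℝ} (hlam : ∀ n, 0 < lam n)
    (hlam0 : Tendsto lam atTop (𝓝 0)) (k : ℕ) : ∀ᶠ n in atTop, k ≤ numCells (lam n) := by
  filter_upwards [eventually_floor_add_lt hlam hlam0 le_rfl one_pos k] with n hn
  omega

theorem tendsto_mul_numCells {lam : ℕ → ℝ} (hlam : ∀ n, 0 < lam n)
    (hlam0 : Tendsto lam atTop (𝓝 0)) :
    Tendsto (fun n => lam n * numCells (lam n)) atTop (𝓝 1) := by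
  have h1 : Tendsto (fun n => 1 - lam n) atTop (𝓝 1) := by
    simpa using tendsto_const_nhds.sub hlam0
  exact tendsto_of_tendsto_of_tendsto_of_le_of_le h1 tendsto_const_nhds
    (fun n => (lt_mul_numCells (hlam n)).le) fun n => mul_numCells_le (hlam n)

theorem measurable_comp_floor {α : Type*} [MeasurableSpace α] (lam : ℝ) (b : ℕ → α) :
    Measurable fun x : ℝ => b ⌊x / lam⌋₊ :=
  (measurable_from_nat (f := b)).comp (Nat.measurable_floor.comp (measurable_id.div_const lam))

theorem ae_eq_comp_floor {lam : ℝ} (hlam : 0 < lam) {N : ℕ} {a : ℕ → ℝ} {z : ℝ → ℝ}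
    (hz : ∀ i < N, ∀ᵐ x ∂muI, x ∈ Set.Ico (lam * i) (lam * (i + 1)) → z x = a i) :
    ∀ᵐ x ∂muI, ⌊x / lam⌋₊ < N → z x = a ⌊x / lam⌋₊ := by
  have : ∀ᵐ x ∂muI, ∀ i, i < N → x ∈ Set.Ico (lam * i) (lam * (i + 1)) → z x = a i := by
    refine ae_all_iff.2 fun i => ?_
    by_cases hi : i < N
    · filter_upwards [hz i hi] with x hx _ using hx
    · exact Eventually.of_forall fun x h => absurd h hi
  filter_upwards [this, ae_mem_Ioo] with x hx hxI hN
  exact hx _ hN ((mem_Ico_iff_floor hlam hxI.1.le _).2 rfl)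

theorem comp_floor_eq_sum_indicator {M : Type*} [AddCommMonoid M] {lam x : ℝ} (hlam : 0 < lam)
    (hx : 0 ≤ x) {N : ℕ} (F : ℕ → ℝ → M) (hF : ∀ i, N ≤ i → F i x = 0) :
    F ⌊x / lam⌋₊ x = ∑ i ∈ Finset.range N,
      (Set.Ico (lam * i) (lam * (i + 1))).indicator (F i) x := by
  simp only [Set.indicator_apply, mem_Ico_iff_floor hlam hx, Finset.sum_ite_eq, Finset.mem_range]
  split_ifs with h
  · rfl
  · exact hF _ (not_lt.1 h)

theorem Ico_cell_subset {lam : ℝ} (hlam : 0 < lam) {N i : ℕ} (hN : lam * N ≤ 1) (hi : i < N) :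
    Set.Ico (lam * i) (lam * (i + 1)) ⊆ Set.Ico (0 : ℝ) 1 := by
  intro x hx
  have : (i + 1 : ℝ) ≤ N := by exact_mod_cast hi
  exact ⟨le_trans (by positivity) hx.1, hx.2.trans_le (le_trans (by gcongr) hN)⟩

theorem lintegral_comp_floor {lam : ℝ} (hlam : 0 < lam) {N : ℕ} (hN : lam * N ≤ 1)
    (F : ℕ → ℝ≥0∞) (hF : ∀ i, N ≤ i → F i = 0) :
    ∫⁻ x, F ⌊x / lam⌋₊ ∂muI = ∑ i ∈ Finset.range N, ENNReal.ofReal lam * F i := by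
  rw [muI_eq_Ico]
  rw [setLIntegral_congr_fun measurableSet_Ico (fun x hx =>
    comp_floor_eq_sum_indicator hlam hx.1 (fun i _ => F i) hF)]
  rw [lintegral_finsetSum _ fun i _ => measurable_const.indicator measurableSet_Ico]
  refine Finset.sum_congr rfl fun i hi => ?_
  rw [lintegral_indicator_const measurableSet_Ico, Measure.restrict_apply measurableSet_Ico,
    Set.inter_eq_left.2 (Ico_cell_subset hlam hN (Finset.mem_range.1 hi)), Real.volume_Ico,
    mul_comm]
  congr 2
  ring

theorem integral_comp_floor_mul {lam : ℝ} (hlam : 0 < lam) {N : ℕ} (hN : lam * N ≤ 1)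
    (b : ℕ → ℝ) (hb : ∀ i, N ≤ i → b i = 0) {φ : ℝ → ℝ} (hφ : Continuous φ) :
    ∫ x, b ⌊x / lam⌋₊ * φ x ∂muI =
      ∑ i ∈ Finset.range N, b i * ∫ x in (lam * i)..(lam * (i + 1)), φ x := by
  rw [muI_eq_Ico]
  rw [setIntegral_congr_fun measurableSet_Ico (fun x hx =>
    comp_floor_eq_sum_indicator hlam hx.1 (fun i x => b i * φ x) fun i hi => by simp [hb i hi])]
  have hint : ∀ i, Integrable (fun x => b i * φ x) (volume.restrict (Set.Ico (0 : ℝ) 1)) :=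
    fun i => ((hφ.const_mul (b i) : Continuous _).integrableOn_Icc (a := 0) (b := 1)).mono_set
      Set.Ico_subset_Icc_self
  rw [integral_finsetSum _ fun i _ => (hint i).indicator measurableSet_Ico]
  refine Finset.sum_congr rfl fun i hi => ?_
  rw [integral_indicator measurableSet_Ico, Measure.restrict_restrict measurableSet_Ico,
    Set.inter_eq_left.2 (Ico_cell_subset hlam hN (Finset.mem_range.1 hi)), integral_const_mul,
    intervalIntegral.integral_of_le (by nlinarith), integral_Ico_eq_integral_Ioc]

theorem integral_comp_floor {lam : ℝ} (hlam : 0 < lam) {N : ℕ} (hN : lam * N ≤ 1)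
    (b : ℕ → ℝ) (hb : ∀ i, N ≤ i → b i = 0) :
    ∫ x, b ⌊x / lam⌋₊ ∂muI = ∑ i ∈ Finset.range N, lam * b i := by
  have := integral_comp_floor_mul hlam hN b hb (φ := fun _ => 1) continuous_const
  simp only [mul_one] at this
  rw [this]
  refine Finset.sum_congr rfl fun i _ => ?_
  simp
  ring

/-- Summation by parts. -/
theorem sum_mul_sub_eq (a f : ℕ → ℝ) (N : ℕ) :
    ∑ i ∈ Finset.range (N + 1), a i * (f (i + 1) - f i) =
      a N * f (N + 1) - a 0 * f 0 - ∑ i ∈ Finset.range N, (a (i + 1) - a i) * f (i + 1) := by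
  induction N with
  | zero => simp; ring
  | succ N ih => rw [Finset.sum_range_succ, ih, Finset.sum_range_succ]; ring

/-! ### Reduction of the two Γ-inequalities to chains -/

/-- The limit of a sequence of chains of bounded energy. -/
structure ChainLimit (lam h κ : ℕ → ℝ) (c : ℝ) (a : ℕ → ℕ → ℝ) (z : ℝ → ℝ) : Prop where
  lam_pos : ∀ n, 0 < lam n
  lam_lim : Tendsto lam atTop (𝓝 0)
  h_pos : ∀ n, 0 < h n
  h_lim : Tendsto h atTop (𝓝 0)
  κ_pos : ∀ n, 0 < κ n
  κ_lim : Tendsto κ atTop (𝓝 1)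
  two_le : ∀ n, 2 ≤ numCells (lam n)
  energy : ∀ n, quadEnergy (h n) (κ n) (numCells (lam n)) (a n) ≤ c
  periodic : ∀ n, |a n 0| = |a n (numCells (lam n) - 1)|
  lim : ∀ᵐ x ∂muI, Tendsto (fun n => a n ⌊x / lam n⌋₊) atTop (𝓝 (z x))

theorem ChainLimit.comp {lam h κ : ℕ → ℝ} {c : ℝ} {a : ℕ → ℕ → ℝ} {z : ℝ → ℝ}
    (H : ChainLimit lam h κ c a z) {φ : ℕ → ℕ} (hφ : Tendsto φ atTop atTop) :
    ChainLimit (lam ∘ φ) (h ∘ φ) (κ ∘ φ) c (a ∘ φ) z where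
  lam_pos n := H.lam_pos _
  lam_lim := H.lam_lim.comp hφ
  h_pos n := H.h_pos _
  h_lim := H.h_lim.comp hφ
  κ_pos n := H.κ_pos _
  κ_lim := H.κ_lim.comp hφ
  two_le n := H.two_le _
  energy n := H.energy _
  periodic n := H.periodic _
  lim := by
    filter_upwards [H.lim] with x hx
    exact hx.comp hφ

/-- Sequences along which the energy is below a bound yield a `ChainLimit`. -/
theorem exists_chainLimit {lam del : ℕ → ℝ} (hlam : ∀ n, 0 < lam n)
    (hlam0 : Tendsto lam atTop (𝓝 0)) (hdel : ∀ n, 0 < del n) (hdel0 : Tendsto del atTop (𝓝 0))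
    {y : ℕ → L1I} {z : L1I} (hy : Tendsto y atTop (𝓝 z)) {c : ℝ}
    (hc : liminf (fun n => scaledHhf (lam n) (del n) (y n)) atTop < ENNReal.ofReal c) :
    ∃ (φ : ℕ → ℕ) (κ : ℕ → ℝ) (a : ℕ → ℕ → ℝ), Tendsto φ atTop atTop ∧
      ChainLimit (lam ∘ φ) (fun n => Real.sqrt (2 * del (φ n))) κ c a z := by
  have hh0 : Tendsto (fun n => Real.sqrt (2 * del n)) atTop (𝓝 0) := by
    exact (Real.continuous_sqrt.tendsto' 0 0 Real.sqrt_zero).comp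
      (by simpa using hdel0.const_mul 2)
  set ε : ℕ → ℝ := fun n => Real.sqrt (2 * del n) ^ 2 + Real.sqrt (c * Real.sqrt (2 * del n) ^ 3)
    with hε
  have hε0 : Tendsto ε atTop (𝓝 0) := by
    have h1 := (Real.continuous_sqrt.tendsto' 0 0 Real.sqrt_zero).comp
      (show Tendsto (fun n => c * Real.sqrt (2 * del n) ^ 3) atTop (𝓝 0) by
        simpa using (hh0.pow 3).const_mul c)
    have := (hh0.pow 2).add h1
    rwa [zero_pow two_ne_zero, zero_add] at this
  have hfr := frequently_lt_of_liminf_lt (by isBoundedDefault) hc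
  have hev : ∀ᶠ n in atTop, 2 ≤ numCells (lam n) ∧ ε n < 1 / 2 :=
    (eventually_le_numCells hlam hlam0 2).and (hε0.eventually (gt_mem_nhds (by norm_num)))
  -- First subsequence: the energy is below `c` and `ε < 1/2`. A second one, `χ`, upgrades `L¹`
  -- convergence to convergence a.e. through convergence in measure.
  obtain ⟨ψ, hψ, hψ2⟩ := extraction_of_frequently_atTop (hfr.and_eventually hev)
  have hmeas : TendstoInMeasure muI (fun n => (y (ψ n) : ℝ → ℝ)) atTop z :=
    tendstoInMeasure_of_tendsto_Lp (hy.comp hψ.tendsto_atTop)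
  obtain ⟨χ, hχ, hae⟩ := hmeas.exists_seq_tendsto_ae
  have hφ : Tendsto (ψ ∘ χ) atTop atTop := (hψ.comp hχ).tendsto_atTop
  have key := fun n => exists_of_scaledHhf_lt (hlam (ψ (χ n))) (hdel _)
    (le_trans (by norm_num) (hψ2 (χ n)).2.1) (hψ2 (χ n)).1
  choose a h1 h2 h3 h4 using key
  refine ⟨ψ ∘ χ, fun n => (1 - 2 * ε (ψ (χ n))) ^ 2, a, hφ, fun n => hlam _, hlam0.comp hφ,
    fun n => Real.sqrt_pos.2 (mul_pos two_pos (hdel _)), hh0.comp hφ,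
    fun n => pow_pos (by linarith [(hψ2 (χ n)).2.2]) 2, ?_, fun n => (hψ2 (χ n)).2.1, fun n => ?_,
    h2, ?_⟩
  · have := ((hε0.comp hφ).const_mul 2).const_sub 1 |>.pow 2
    simpa using this
  · have hlt := h4 n
    have : chainEnergy (del (ψ (χ n))) (numCells (lam (ψ (χ n)))) (a n) ≤ c := by
      by_contra! hcon
      exact absurd hlt (not_lt.2 (ENNReal.ofReal_le_ofReal hcon.le))
    exact quadEnergy_le (hdel _) this (hψ2 (χ n)).2.2.le
  · have hall : ∀ᵐ x ∂muI, ∀ n, ⌊x / lam (ψ (χ n))⌋₊ < numCells (lam (ψ (χ n))) →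
        y (ψ (χ n)) x = a n ⌊x / lam (ψ (χ n))⌋₊ :=
      ae_all_iff.2 fun n => ae_eq_comp_floor (hlam _) (h3 n)
    filter_upwards [hall, hae, ae_mem_Ioo] with x hx1 hx2 hx3
    refine hx2.congr' ?_
    have := (eventually_floor_add_lt hlam hlam0 hx3.1.le hx3.2 0)
    filter_upwards [hφ.eventually this] with n hn
    exact hx1 n hn

/-- If the liminf were below `F`, a real `c` would fit strictly between, and chains of energy at
most `c` would contradict `hF`. -/
theorem le_liminf_of_chainLimit {lam del : ℕ → ℝ} (hlam : ∀ n, 0 < lam n)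
    (hlam0 : Tendsto lam atTop (𝓝 0)) (hdel : ∀ n, 0 < del n) (hdel0 : Tendsto del atTop (𝓝 0))
    {F : ℝ≥0∞} {z : L1I}
    (hF : ∀ (φ : ℕ → ℕ) (κ : ℕ → ℝ) (a : ℕ → ℕ → ℝ) (c : ℝ), 0 ≤ c → Tendsto φ atTop atTop →
      ChainLimit (lam ∘ φ) (fun n => Real.sqrt (2 * del (φ n))) κ c a z → F ≤ ENNReal.ofReal c)
    {y : ℕ → L1I} (hy : Tendsto y atTop (𝓝 z)) :
    F ≤ liminf (fun n => scaledHhf (lam n) (del n) (y n)) atTop := by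
  by_contra! hlt
  obtain ⟨c, h1, h2⟩ := ENNReal.lt_iff_exists_nnreal_btwn.1 hlt
  obtain ⟨φ, κ, a, hφ, H⟩ := exists_chainLimit hlam hlam0 hdel hdel0 hy (c := c) (by simpa using h1)
  have := hF φ κ a c c.2 hφ H
  rw [ENNReal.ofReal_coe_nnreal] at this
  exact absurd h2 (not_lt.2 this)


/-- A uniform bound `B` makes `δ a² ≤ 1` for large `n`. The chain is then realised by spins, and
`shrink` can only lower its energy. -/
theorem limsup_scaledHhf_le {lam del : ℕ → ℝ} (hlam : ∀ n, 0 < lam n)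
    (hlam0 : Tendsto lam atTop (𝓝 0)) (hdel : ∀ n, 0 < del n) (hdel0 : Tendsto del atTop (𝓝 0))
    {y : ℕ → L1I} {a : ℕ → ℕ → ℝ} {B : ℝ} (hB : ∀ n i, |a n i| ≤ B)
    (hper : ∀ᶠ n in atTop, |a n 0| = |a n (numCells (lam n) - 1)|)
    (hy : ∀ᶠ n in atTop, ∀ᵐ x ∂muI, ⌊x / lam n⌋₊ < numCells (lam n) → y n x = a n ⌊x / lam n⌋₊)
    {e : ℕ → ℝ} {e₀ : ℝ} (he : Tendsto e atTop (𝓝 e₀))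
    (hle : ∀ᶠ n in atTop, quadEnergy (Real.sqrt (2 * del n)) 1 (numCells (lam n)) (a n) ≤ e n) :
    limsup (fun n => scaledHhf (lam n) (del n) (y n)) atTop ≤ ENNReal.ofReal e₀ := by
  have hd : ∀ᶠ n in atTop, del n * B ^ 2 < 1 := by
    have : Tendsto (fun n => del n * B ^ 2) atTop (𝓝 0) := by simpa using hdel0.mul_const (B ^ 2)
    exact this.eventually (gt_mem_nhds one_pos)
  have hmain : ∀ᶠ n in atTop, scaledHhf (lam n) (del n) (y n) ≤ ENNReal.ofReal (e n) := by
    filter_upwards [hper, hy, hle, hd, eventually_le_numCells hlam hlam0 1] with n h1 h2 h3 h4 h5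
    have ha : ∀ i, del n * a n i ^ 2 ≤ 1 := fun i => by
      refine le_trans (mul_le_mul_of_nonneg_left ?_ (hdel n).le) h4.le
      exact sq_le_sq' (abs_le.1 (hB n i)).1 (abs_le.1 (hB n i)).2
    refine (scaledHhf_le (hlam n) (hdel n) h5 (fun i => (ha i).trans_lt one_lt_two) h1 ?_).trans
      (ENNReal.ofReal_le_ofReal ((chainEnergy_le_quadEnergy (hdel n) ha _).trans h3))
    intro i hi
    filter_upwards [h2, ae_mem_Ioo] with x hx hxI hxi
    rw [mem_Ico_iff_floor (hlam n) hxI.1.le] at hxi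
    rw [hx (by rwa [hxi]), hxi]
  refine (limsup_le_limsup hmain).trans (le_of_eq ?_)
  exact ((ENNReal.continuous_ofReal.tendsto _).comp he).limsup_eq

/-! ### A priori estimates for chains of bounded energy -/

/-- Telescoping and Cauchy–Schwarz: the discrete form of Hölder-1/2 continuity. -/
theorem sq_sub_le_mul_sum (a : ℕ → ℝ) {M i j : ℕ} (hij : i ≤ j) (hj : j ≤ M) :
    (a j - a i) ^ 2 ≤ (j - i : ℝ) * ∑ k ∈ Finset.range M, (a (k + 1) - a k) ^ 2 := by
  rw [← Finset.sum_Ico_sub a hij]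
  refine (sq_sum_le_card_mul_sum_sq).trans ?_
  rw [Nat.card_Ico, Nat.cast_sub hij]
  refine mul_le_mul_of_nonneg_left ?_ (sub_nonneg.2 (by exact_mod_cast hij))
  refine Finset.sum_le_sum_of_subset_of_nonneg (fun k hk => ?_) fun k _ _ => sq_nonneg _
  simp only [Finset.mem_Ico, Finset.mem_range] at hk ⊢
  omega

/-- Written this way the potential is a Riemann sum with weight `h/λ → 1/l`; the second term is `κ
λ/h` times the discrete Dirichlet energy. -/
theorem quadEnergy_eq {lam : ℝ} (hlam : lam ≠ 0) (h κ : ℝ) (N : ℕ) (a : ℕ → ℝ) :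
    quadEnergy h κ N a =
      h / lam * (∑ i ∈ Finset.range (N - 1), lam * ((a i ^ 2 + a (i + 1) ^ 2) / 2 - 1) ^ 2) +
        κ / h * (∑ i ∈ Finset.range (N - 1), (a (i + 1) - a i) ^ 2) := by
  rw [quadEnergy, Finset.sum_add_distrib, Finset.mul_sum, Finset.mul_sum]
  congr 1
  refine Finset.sum_congr rfl fun i _ => ?_
  field_simp
  ring

namespace ChainLimit

variable {lam h κ : ℕ → ℝ} {c : ℝ} {a : ℕ → ℕ → ℝ} {z : ℝ → ℝ}

theorem sum_pot_add_sum_grad_le (H : ChainLimit lam h κ c a z) (n : ℕ) :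
    h n / lam n * (∑ i ∈ Finset.range (numCells (lam n) - 1),
        lam n * ((a n i ^ 2 + a n (i + 1) ^ 2) / 2 - 1) ^ 2) +
      κ n / h n * (∑ i ∈ Finset.range (numCells (lam n) - 1), (a n (i + 1) - a n i) ^ 2) ≤ c := by
  rw [← quadEnergy_eq (H.lam_pos n).ne']
  exact H.energy n

theorem sum_pot_nonneg (H : ChainLimit lam h κ c a z) (n : ℕ) :
    0 ≤ ∑ i ∈ Finset.range (numCells (lam n) - 1),
        lam n * ((a n i ^ 2 + a n (i + 1) ^ 2) / 2 - 1) ^ 2 :=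
  Finset.sum_nonneg fun _ _ => mul_nonneg (H.lam_pos n).le (sq_nonneg _)

theorem sum_pot_le (H : ChainLimit lam h κ c a z) (n : ℕ) :
    ∑ i ∈ Finset.range (numCells (lam n) - 1),
        lam n * ((a n i ^ 2 + a n (i + 1) ^ 2) / 2 - 1) ^ 2 ≤ c * (lam n / h n) := by
  have h1 := H.sum_pot_add_sum_grad_le n
  have h2 : 0 ≤ κ n / h n * (∑ i ∈ Finset.range (numCells (lam n) - 1),
      (a n (i + 1) - a n i) ^ 2) :=
    mul_nonneg (div_nonneg (H.κ_pos n).le (H.h_pos n).le)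
      (Finset.sum_nonneg fun i _ => sq_nonneg _)
  have hh := H.h_pos n
  have hl := H.lam_pos n
  have h3 := le_of_add_le_of_nonneg_left h1 h2
  rw [div_mul_eq_mul_div, div_le_iff₀ hl] at h3
  rw [← mul_div_assoc, le_div_iff₀ hh]
  linarith

theorem sum_grad_le (H : ChainLimit lam h κ c a z) (n : ℕ) :
    ∑ i ∈ Finset.range (numCells (lam n) - 1), (a n (i + 1) - a n i) ^ 2 ≤ c / κ n * h n := by
  have h1 := H.sum_pot_add_sum_grad_le n
  have h2 := mul_nonneg (div_nonneg (H.h_pos n).le (H.lam_pos n).le) (H.sum_pot_nonneg n)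
  have hh := H.h_pos n
  have hk := H.κ_pos n
  have h3 := le_of_add_le_of_nonneg_right h1 h2
  rw [div_mul_eq_mul_div, div_le_iff₀ hh] at h3
  rw [div_mul_eq_mul_div, le_div_iff₀ hk]
  linarith

theorem tendsto_div_κ (H : ChainLimit lam h κ c a z) : Tendsto (fun n => c / κ n) atTop (𝓝 c) := by
  have := (tendsto_const_nhds (x := c)).div H.κ_lim one_ne_zero
  rw [div_one] at this
  exact this

theorem c_nonneg (H : ChainLimit lam h κ c a z) : 0 ≤ c := by
  refine (add_nonneg (mul_nonneg (div_nonneg (H.h_pos 0).le (H.lam_pos 0).le) (H.sum_pot_nonneg 0))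
    (mul_nonneg (div_nonneg (H.κ_pos 0).le (H.h_pos 0).le)
      (Finset.sum_nonneg fun i _ => sq_nonneg _))).trans (H.sum_pot_add_sum_grad_le 0)

/-- One squared increment is at most the sum of all of them, which is `O(h)`. Hence neighbouring
cells have the same limit. -/
theorem tendsto_step (H : ChainLimit lam h κ c a z) {x : ℝ} (hx : 0 ≤ x) (hx1 : x < 1) :
    Tendsto (fun n => a n (⌊x / lam n⌋₊ + 1) - a n ⌊x / lam n⌋₊) atTop (𝓝 0) := by
  have h0 : Tendsto (fun n => c / κ n * h n) atTop (𝓝 0) := by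
    simpa using H.tendsto_div_κ.mul H.h_lim
  have hsq : Tendsto (fun n => (a n (⌊x / lam n⌋₊ + 1) - a n ⌊x / lam n⌋₊) ^ 2) atTop (𝓝 0) := by
    refine tendsto_of_tendsto_of_tendsto_of_le_of_le' tendsto_const_nhds h0
      (Eventually.of_forall fun n => sq_nonneg _) ?_
    filter_upwards [eventually_floor_add_lt H.lam_pos H.lam_lim hx hx1 1] with n hn
    refine le_trans ?_ (H.sum_grad_le n)
    exact Finset.single_le_sum (f := fun i => (a n (i + 1) - a n i) ^ 2)
      (fun i _ => sq_nonneg _) (Finset.mem_range.2 (by omega))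
  have := (Real.continuous_sqrt.tendsto' 0 0 Real.sqrt_zero).comp hsq
  rw [tendsto_zero_iff_abs_tendsto_zero]
  refine this.congr fun n => ?_
  simp [Real.sqrt_sq_eq_abs]

/-- Fatou's lemma for the potential term. -/
theorem lintegral_pot_le (H : ChainLimit lam h κ c a z) {p : ℝ}
    (hp : Tendsto (fun n => ∑ i ∈ Finset.range (numCells (lam n) - 1),
        lam n * ((a n i ^ 2 + a n (i + 1) ^ 2) / 2 - 1) ^ 2) atTop (𝓝 p)) :
    ∫⁻ x, ENNReal.ofReal ((z x ^ 2 - 1) ^ 2) ∂muI ≤ ENNReal.ofReal p := by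
  -- Cut off at the last bond, whose right neighbour is not part of the chain.
  set F : ℕ → ℕ → ℝ≥0∞ := fun n i => if i < numCells (lam n) - 1 then
    ENNReal.ofReal (((a n i ^ 2 + a n (i + 1) ^ 2) / 2 - 1) ^ 2) else 0 with hF
  have hsum : ∀ n, ∫⁻ x, F n ⌊x / lam n⌋₊ ∂muI =
      ENNReal.ofReal (∑ i ∈ Finset.range (numCells (lam n) - 1),
        lam n * ((a n i ^ 2 + a n (i + 1) ^ 2) / 2 - 1) ^ 2) := fun n => by
    rw [lintegral_comp_floor (H.lam_pos n) (N := numCells (lam n) - 1) _ (F n)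
      fun i hi => by simp [hF, not_lt.2 hi]]
    · rw [ENNReal.ofReal_sum_of_nonneg fun i _ => mul_nonneg (H.lam_pos n).le (sq_nonneg _)]
      refine Finset.sum_congr rfl fun i hi => ?_
      rw [ENNReal.ofReal_mul (H.lam_pos n).le]
      simp [hF, Finset.mem_range.1 hi]
    · refine le_trans ?_ (mul_numCells_le (H.lam_pos n))
      exact mul_le_mul_of_nonneg_left (by exact_mod_cast Nat.sub_le _ _) (H.lam_pos n).le
  have hlim : ∀ᵐ x ∂muI, Tendsto (fun n => F n ⌊x / lam n⌋₊) atTop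
      (𝓝 (ENNReal.ofReal ((z x ^ 2 - 1) ^ 2))) := by
    filter_upwards [H.lim, ae_mem_Ioo] with x hx hxI
    have h1 : Tendsto (fun n => a n (⌊x / lam n⌋₊ + 1)) atTop (𝓝 (z x)) := by
      simpa using (H.tendsto_step hxI.1.le hxI.2).add hx
    have h2 := ((((hx.pow 2).add (h1.pow 2)).div_const 2).sub_const 1).pow 2
    rw [show (z x ^ 2 + z x ^ 2) / 2 - 1 = z x ^ 2 - 1 by ring] at h2
    refine ((ENNReal.continuous_ofReal.tendsto _).comp h2).congr' ?_
    filter_upwards [eventually_floor_add_lt H.lam_pos H.lam_lim hxI.1.le hxI.2 1] with n hn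
    simp only [hF, Function.comp]
    rw [if_pos (by omega)]
  calc ∫⁻ x, ENNReal.ofReal ((z x ^ 2 - 1) ^ 2) ∂muI
      = ∫⁻ x, liminf (fun n => F n ⌊x / lam n⌋₊) atTop ∂muI :=
        lintegral_congr_ae (hlim.mono fun x hx => hx.liminf_eq.symm)
    _ ≤ liminf (fun n => ∫⁻ x, F n ⌊x / lam n⌋₊ ∂muI) atTop :=
        lintegral_liminf_le fun n => measurable_comp_floor _ _
    _ = ENNReal.ofReal p := by
        simp only [hsum]
        exact ((ENNReal.continuous_ofReal.tendsto _).comp hp).liminf_eq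

/-! ### The case `l = ∞` -/

/-- If the steps get small in the mean, `z` is a constant. -/
theorem ae_eq_const (H : ChainLimit lam h κ c a z)
    (hl : Tendsto (fun n => lam n / h n) atTop atTop) : ∃ b : ℝ, z =ᵐ[muI] fun _ => b := by
  have hhl : Tendsto (fun n => h n / lam n) atTop (𝓝 0) := by
    refine hl.inv_tendsto_atTop.congr fun n => ?_
    simp
  have h0 : Tendsto (fun n => c / κ n * (h n / lam n)) atTop (𝓝 0) := by
    simpa using H.tendsto_div_κ.mul hhl
  have hgood := H.lim.and ae_mem_Ioo
  obtain ⟨x₀, hx₀, hx₀I⟩ := hgood.exists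
  refine ⟨z x₀, ?_⟩
  filter_upwards [hgood] with x hx
  have hsq : Tendsto (fun n => (a n ⌊x / lam n⌋₊ - a n ⌊x₀ / lam n⌋₊) ^ 2) atTop (𝓝 0) := by
    refine tendsto_of_tendsto_of_tendsto_of_le_of_le' tendsto_const_nhds h0
      (Eventually.of_forall fun n => sq_nonneg _) ?_
    filter_upwards [eventually_floor_add_lt H.lam_pos H.lam_lim hx.2.1.le hx.2.2 1,
      eventually_floor_add_lt H.lam_pos H.lam_lim hx₀I.1.le hx₀I.2 1] with n h1 h2
    -- There are at most `1/λ` bonds between the two cells, and the squared increments sum to at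
    -- most `(c/κ) h`.
    have key : ∀ i j : ℕ, i ≤ j → j ≤ numCells (lam n) - 1 →
        (a n j - a n i) ^ 2 ≤ c / κ n * (h n / lam n) := fun i j hij hj => by
      refine (sq_sub_le_mul_sum (a n) hij hj).trans ?_
      have hj' : ((j : ℝ) - i) * lam n ≤ 1 := by
        have h3 := mul_numCells_le (H.lam_pos n)
        have h4 : (j : ℝ) ≤ numCells (lam n) := by exact_mod_cast hj.trans (Nat.sub_le _ _)
        have h5 : (0 : ℝ) ≤ i := by positivity
        nlinarith [H.lam_pos n]
      have hj0 : (0 : ℝ) ≤ j - i := sub_nonneg.2 (by exact_mod_cast hij)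
      have hck : 0 ≤ c / κ n * h n :=
        mul_nonneg (div_nonneg H.c_nonneg (H.κ_pos n).le) (H.h_pos n).le
      calc ((j : ℝ) - i) * _ ≤ ((j : ℝ) - i) * (c / κ n * h n) :=
            mul_le_mul_of_nonneg_left (H.sum_grad_le n) hj0
        _ ≤ 1 / lam n * (c / κ n * h n) := by
            refine mul_le_mul_of_nonneg_right ?_ hck
            rwa [le_div_iff₀ (H.lam_pos n)]
        _ = _ := by ring
    rcases le_total ⌊x / lam n⌋₊ ⌊x₀ / lam n⌋₊ with hle | hle
    · rw [← neg_sub, neg_sq]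
      exact key _ _ hle (by omega)
    · exact key _ _ hle (by omega)
  have := tendsto_nhds_unique hsq ((hx.1.sub hx₀).pow 2)
  have : z x - z x₀ = 0 := by
    rw [← sq_eq_zero_iff]
    exact this.symm
  linarith

end ChainLimit

/-- The constant chain `b` has no gradient energy, and its potential energy is at most `(b² - 1)²
h/λ → 0`. -/
theorem gammaConverges_limitTop {lam del : ℕ → ℝ} (hlam : ∀ n, 0 < lam n)
    (hlam0 : Tendsto lam atTop (𝓝 0)) (hdel : ∀ n, 0 < del n) (hdel0 : Tendsto del atTop (𝓝 0))
    (hl : Tendsto (fun n => lam n / Real.sqrt (2 * del n)) atTop atTop) :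
    GammaConverges (fun n => scaledHhf (lam n) (del n)) limitTop := by
  intro z
  refine ⟨fun y hy => le_liminf_of_chainLimit hlam hlam0 hdel hdel0 ?_ hy, ?_⟩
  · intro φ κ a c _ hφ H
    rw [limitTop, if_pos (H.ae_eq_const (hl.comp hφ))]
    exact zero_le
  · refine ⟨fun _ => z, tendsto_const_nhds, ?_⟩
    by_cases hz : ∃ b : ℝ, z =ᵐ[muI] fun _ => b
    · obtain ⟨b, hb⟩ := hz
      rw [limitTop, if_pos ⟨b, hb⟩, ← ENNReal.ofReal_zero]
      have hhl : Tendsto (fun n => Real.sqrt (2 * del n) / lam n) atTop (𝓝 0) := by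
        refine hl.inv_tendsto_atTop.congr fun n => ?_
        simp
      have he : Tendsto (fun n => (b ^ 2 - 1) ^ 2 * (Real.sqrt (2 * del n) / lam n)) atTop
          (𝓝 0) := by
        simpa using hhl.const_mul ((b ^ 2 - 1) ^ 2)
      refine limsup_scaledHhf_le hlam hlam0 hdel hdel0 (a := fun _ _ => b) (fun _ _ => le_rfl)
        (Eventually.of_forall fun _ => rfl) (Eventually.of_forall fun n => ?_) he
        (Eventually.of_forall fun n => ?_)
      · filter_upwards [hb] with x hx _ using hx
      · have h1 : ((numCells (lam n) - 1 : ℕ) : ℝ) * lam n ≤ 1 := by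
          refine le_trans ?_ (mul_numCells_le (hlam n))
          rw [mul_comm]
          exact mul_le_mul_of_nonneg_left (by exact_mod_cast Nat.sub_le _ _) (hlam n).le
        rw [← le_div_iff₀ (hlam n)] at h1
        simp only [quadEnergy, sub_self, Finset.sum_const, Finset.card_range, nsmul_eq_mul]
        calc _ = ((numCells (lam n) - 1 : ℕ) : ℝ) *
                (Real.sqrt (2 * del n) * (b ^ 2 - 1) ^ 2) := by ring
          _ ≤ 1 / lam n * (Real.sqrt (2 * del n) * (b ^ 2 - 1) ^ 2) := by gcongr
          _ = _ := by ring
    · rw [limitTop, if_neg hz]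
      exact le_top


/-! ### The case `l = 0`: the Modica–Mortola lower bound -/

/-- On each cell `deriv φ` integrates exactly to an increment of `φ`; summation by parts moves the
differences onto `f`. -/
theorem integral_comp_floor_mul_deriv {lam : ℝ} (hlam : 0 < lam) {N : ℕ} (hN0 : 1 ≤ N)
    (hN : lam * N ≤ 1) (f : ℕ → ℝ) {φ : ℝ → ℝ} (hφ : ContDiff ℝ ∞ φ) :
    ∫ x, (if ⌊x / lam⌋₊ < N then f ⌊x / lam⌋₊ else 0) * deriv φ x ∂muI =
      f (N - 1) * φ (lam * N) - f 0 * φ 0 -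
        ∑ i ∈ Finset.range (N - 1), (f (i + 1) - f i) * φ (lam * (i + 1)) := by
  have hc : Continuous (deriv φ) := hφ.continuous_deriv (by simp)
  rw [integral_comp_floor_mul hlam hN (fun i => if i < N then f i else 0)
    (fun i hi => if_neg (not_lt.2 hi)) hc]
  obtain ⟨M, rfl⟩ : ∃ M, N = M + 1 := ⟨N - 1, by omega⟩
  have := sum_mul_sub_eq f (fun i => φ (lam * i)) M
  simp only [Nat.cast_add, Nat.cast_one, Nat.cast_zero, mul_zero, Nat.add_sub_cancel] at this ⊢
  rw [← this]
  refine Finset.sum_congr rfl fun i hi => ?_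
  rw [if_pos (Finset.mem_range.1 hi), intervalIntegral.integral_deriv_eq_sub
    (fun x _ => (hφ.differentiable (by simp)).differentiableAt) (hc.intervalIntegrable _ _)]

/-- The primitive of `(1 - t²)⁺`. -/
noncomputable def wellPrimitive (t : ℝ) : ℝ :=
  max (-1) (min 1 t) - max (-1) (min 1 t) ^ 3 / 3

theorem continuous_wellPrimitive : Continuous wellPrimitive := by
  unfold wellPrimitive
  fun_prop

theorem wellPrimitive_of_abs_le {t : ℝ} (h1 : -1 ≤ t) (h2 : t ≤ 1) :
    wellPrimitive t = t - t ^ 3 / 3 := by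
  rw [wellPrimitive, min_eq_right h2, max_eq_right h1]

theorem wellPrimitive_of_one_le {t : ℝ} (h : 1 ≤ t) : wellPrimitive t = 2 / 3 := by
  rw [wellPrimitive, min_eq_left h]
  norm_num

theorem wellPrimitive_of_le_neg_one {t : ℝ} (h : t ≤ -1) : wellPrimitive t = -2 / 3 := by
  rw [wellPrimitive, min_eq_right (by linarith), max_eq_left h]
  norm_num

theorem abs_wellPrimitive_le (t : ℝ) : |wellPrimitive t| ≤ 1 := by
  rw [abs_le]
  rcases le_total t (-1) with h | h
  · rw [wellPrimitive_of_le_neg_one h]; norm_num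
  rcases le_total 1 t with h' | h'
  · rw [wellPrimitive_of_one_le h']; norm_num
  rw [wellPrimitive_of_abs_le h h']
  constructor <;> nlinarith [mul_nonneg (sub_nonneg.2 h') (sub_nonneg.2 h), sq_nonneg t]

/-- Between the wells the increment is exactly `(t - s)(1 - (s² + t²)/2) + (t - s)³/6`, and `t - s ≤
2` makes the cubic term at most a square. When a well is crossed, the whole increment is at most `(t
- s)²`. This error is harmless, since the energy controls `(t - s)²/h`. -/
theorem abs_wellPrimitive_sub_le (s t : ℝ) :
    |wellPrimitive t - wellPrimitive s| ≤ |t - s| * |(s ^ 2 + t ^ 2) / 2 - 1| + (t - s) ^ 2 := by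
  wlog hst : s ≤ t generalizing s t
  · have := this t s (not_le.1 hst).le
    rwa [abs_sub_comm, abs_sub_comm t s, add_comm (s ^ 2), ← neg_sub s t, neg_sq]
  have hA := mul_nonneg (abs_nonneg (t - s)) (abs_nonneg ((s ^ 2 + t ^ 2) / 2 - 1))
  rcases le_total t (-1) with h1 | h1
  · rw [wellPrimitive_of_le_neg_one h1, wellPrimitive_of_le_neg_one (hst.trans h1), sub_self,
      abs_zero]
    positivity
  rcases le_total 1 s with h2 | h2
  · rw [wellPrimitive_of_one_le h2, wellPrimitive_of_one_le (h2.trans hst), sub_self, abs_zero]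
    positivity
  rcases le_total s (-1) with h3 | h3 <;> rcases le_total 1 t with h4 | h4
  · rw [wellPrimitive_of_le_neg_one h3, wellPrimitive_of_one_le h4]
    have : (2 : ℝ) ≤ t - s := by linarith
    rw [abs_of_pos (by norm_num)]
    nlinarith
  · rw [wellPrimitive_of_le_neg_one h3, wellPrimitive_of_abs_le h1 h4,
      show t - t ^ 3 / 3 - -2 / 3 = (1 + t) ^ 2 * (2 - t) / 3 by ring, abs_of_nonneg (by
        have := sq_nonneg (1 + t)
        have : 0 ≤ 2 - t := by linarith
        positivity)]
    have : (1 + t) ^ 2 ≤ (t - s) ^ 2 := pow_le_pow_left₀ (by linarith) (by linarith) 2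
    nlinarith [sq_nonneg (1 + t)]
  · rw [wellPrimitive_of_abs_le h3 h2, wellPrimitive_of_one_le h4,
      show 2 / 3 - (s - s ^ 3 / 3) = (1 - s) ^ 2 * (2 + s) / 3 by ring, abs_of_nonneg (by
        have := sq_nonneg (1 - s)
        have : 0 ≤ 2 + s := by linarith
        positivity)]
    have : (1 - s) ^ 2 ≤ (t - s) ^ 2 := pow_le_pow_left₀ (by linarith) (by linarith) 2
    nlinarith [sq_nonneg (1 - s)]
  · rw [wellPrimitive_of_abs_le h3 h2, wellPrimitive_of_abs_le h1 h4,
      show t - t ^ 3 / 3 - (s - s ^ 3 / 3) =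
        (t - s) * -((s ^ 2 + t ^ 2) / 2 - 1) + (t - s) ^ 3 / 6 by ring]
    refine (abs_add_le _ _).trans (add_le_add (by rw [abs_mul, abs_neg]) ?_)
    have h0 : 0 ≤ t - s := by linarith
    rw [abs_of_nonneg (by positivity)]
    nlinarith [sq_nonneg (t - s)]

theorem abs_sub_le_sum_Ico (f : ℕ → ℝ) {i j : ℕ} (hij : i ≤ j) :
    |f j - f i| ≤ ∑ k ∈ Finset.Ico i j, |f (k + 1) - f k| := by
  rw [← Finset.sum_Ico_sub f hij]
  exact Finset.abs_sum_le_sum_abs _ _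

namespace ChainLimit

variable {lam h κ : ℕ → ℝ} {c : ℝ} {a : ℕ → ℕ → ℝ} {z : ℝ → ℝ}

/-- Asymptotically optimal bound of the total variation of `wellPrimitive ∘ a n`. -/
theorem sum_wellPrimitive_le (H : ChainLimit lam h κ c a z) (n : ℕ) :
    ∑ i ∈ Finset.range (numCells (lam n) - 1),
      |wellPrimitive (a n (i + 1)) - wellPrimitive (a n i)| ≤
        max 1 ((1 + 2 * h n) / κ n) * c / 2 := by
  have hh := H.h_pos n
  have hk := H.κ_pos n
  -- `K` absorbs two defects: the factor `κ` and the quadratic error, as `2 D² = 2h · (D²/h)`. It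
  -- tends to `1`.
  set K := max 1 ((1 + 2 * h n) / κ n) with hK
  have hK1 : 1 ≤ K := le_max_left _ _
  have hK2 : 1 + 2 * h n ≤ K * κ n := by
    rw [← div_le_iff₀ hk]; exact le_max_right _ _
  rw [le_div_iff₀ two_pos, Finset.sum_mul]
  refine le_trans ?_ (mul_le_mul_of_nonneg_left (H.energy n) (by linarith))
  rw [quadEnergy, Finset.mul_sum]
  refine Finset.sum_le_sum fun i _ => ?_
  have h1 := abs_wellPrimitive_sub_le (a n i) (a n (i + 1))
  set A := (a n i ^ 2 + a n (i + 1) ^ 2) / 2 - 1 with hA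
  set D := a n (i + 1) - a n i with hD
  -- The Modica–Mortola step: the difference of the two sides is a square divided by `h`.
  have h2 : 2 * (|D| * |A|) ≤ h n * A ^ 2 + 1 / h n * D ^ 2 := by
    have e : h n * A ^ 2 + 1 / h n * D ^ 2 - 2 * (|D| * |A|) = (h n * |A| - |D|) ^ 2 / h n := by
      rw [← sq_abs A, ← sq_abs D]
      field_simp
      ring
    have : 0 ≤ (h n * |A| - |D|) ^ 2 / h n := by positivity
    linarith
  have h3 : h n / 4 * (a n i ^ 2 + a n (i + 1) ^ 2 - 2) ^ 2 = h n * A ^ 2 := by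
    rw [hA]; ring
  rw [h3]
  have h4 : h n * A ^ 2 ≤ K * (h n * A ^ 2) := le_mul_of_one_le_left (by positivity) hK1
  have h5 : (1 + 2 * h n) * (1 / h n * D ^ 2) ≤ K * κ n * (1 / h n * D ^ 2) :=
    mul_le_mul_of_nonneg_right hK2 (by positivity)
  have h6 : (1 + 2 * h n) * (1 / h n * D ^ 2) = 1 / h n * D ^ 2 + 2 * D ^ 2 := by
    field_simp
  have h7 : K * (h n * A ^ 2 + κ n / h n * D ^ 2) =
    K * (h n * A ^ 2) + K * κ n * (1 / h n * D ^ 2) := by ring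
  linarith

theorem tendsto_variation_bound (H : ChainLimit lam h κ c a z) :
    Tendsto (fun n => max 1 ((1 + 2 * h n) / κ n) * c / 2) atTop (𝓝 (c / 2)) := by
  have h1 : Tendsto (fun n => (1 + 2 * h n) / κ n) atTop (𝓝 1) := by
    have := ((H.h_lim.const_mul 2).const_add 1).div H.κ_lim one_ne_zero
    simp only [mul_zero, add_zero, div_one] at this
    exact this
  have := (((tendsto_const_nhds (x := (1 : ℝ))).max h1).mul_const c).div_const 2
  simpa using this

theorem ae_eq_one_or (H : ChainLimit lam h κ c a z)
    (hl : Tendsto (fun n => lam n / h n) atTop (𝓝 0)) : ∀ᵐ x ∂muI, z x = 1 ∨ z x = -1 := by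
  have hp : Tendsto (fun n => ∑ i ∈ Finset.range (numCells (lam n) - 1),
      lam n * ((a n i ^ 2 + a n (i + 1) ^ 2) / 2 - 1) ^ 2) atTop (𝓝 0) := by
    refine squeeze_zero H.sum_pot_nonneg H.sum_pot_le ?_
    simpa using hl.const_mul c
  have h0 := H.lintegral_pot_le hp
  rw [ENNReal.ofReal_zero, nonpos_iff_eq_zero, lintegral_eq_zero_iff'] at h0
  · filter_upwards [h0] with x hx
    have : (z x ^ 2 - 1) ^ 2 ≤ 0 := by simpa using hx
    have : z x ^ 2 - 1 = 0 := by
      rw [← sq_eq_zero_iff]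
      exact le_antisymm this (sq_nonneg _)
    rw [← sq_eq_one_iff]
    linarith
  · have : AEMeasurable z muI :=
      aemeasurable_of_tendsto_metrizable_ae atTop
        (fun n => (measurable_comp_floor (lam n) (a n)).aemeasurable) H.lim
    fun_prop

theorem isBVpm (H : ChainLimit lam h κ c a z)
    (hl : Tendsto (fun n => lam n / h n) atTop (𝓝 0)) : IsBVpm z := by
  have hz := H.ae_eq_one_or hl
  -- On the values `±1`, `z` is `3/2` times `wellPrimitive z`. The `2` bounds the two boundary terms
  -- of the summation by parts, `c / 2` the limiting variation.
  refine ⟨hz, 3 / 2 * (2 + c / 2), fun φ hφ hφ1 => ?_⟩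
  have hc : Continuous (deriv φ) := hφ.1.continuous_deriv (by simp)
  have hlim : Tendsto (fun n => ∫ x, (if ⌊x / lam n⌋₊ < numCells (lam n) then
      wellPrimitive (a n ⌊x / lam n⌋₊) else 0) * deriv φ x ∂muI) atTop
      (𝓝 (∫ x, 2 / 3 * (z x * deriv φ x) ∂muI)) := by
    refine tendsto_integral_of_dominated_convergence (fun x => |deriv φ x|) (fun n => ?_) ?_
      (fun n => ?_) ?_
    · exact ((measurable_comp_floor (lam n) (fun i => if i < numCells (lam n) then
        wellPrimitive (a n i) else 0)).mul hc.measurable).aestronglyMeasurable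
    · exact (hc.abs.integrableOn_Icc (a := 0) (b := 1)).mono_set Set.Ioo_subset_Icc_self
    · refine Eventually.of_forall fun x => ?_
      rw [norm_mul, Real.norm_eq_abs, Real.norm_eq_abs]
      refine mul_le_of_le_one_left (abs_nonneg _) ?_
      split_ifs
      · exact abs_wellPrimitive_le _
      · simp
    · filter_upwards [H.lim, hz, ae_mem_Ioo] with x hx hzx hxI
      have h1 : wellPrimitive (z x) = 2 / 3 * z x := by
        rcases hzx with h | h <;> rw [h]
        · rw [wellPrimitive_of_one_le le_rfl]; norm_num
        · rw [wellPrimitive_of_le_neg_one le_rfl]; norm_num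
      rw [← mul_assoc, ← h1]
      refine Tendsto.mul_const _ ?_
      refine ((continuous_wellPrimitive.tendsto _).comp hx).congr' ?_
      filter_upwards [eventually_floor_add_lt H.lam_pos H.lam_lim hxI.1.le hxI.2 0] with n hn
      rw [if_pos (by simpa using hn)]
      rfl
  have hle := le_of_tendsto_of_tendsto' hlim (H.tendsto_variation_bound.const_add 2) fun n => ?_
  · rw [integral_const_mul] at hle
    linarith
  · rw [integral_comp_floor_mul_deriv (H.lam_pos n) (one_le_two.trans (H.two_le n))
      (mul_numCells_le (H.lam_pos n)) (fun i => wellPrimitive (a n i)) hφ.1]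
    have hb : ∀ s t, |wellPrimitive s * φ t| ≤ 1 := fun s t => by
      rw [abs_mul]
      exact mul_le_one₀ (abs_wellPrimitive_le s) (abs_nonneg _) (hφ1 t)
    have h1 := (abs_le.1 (hb (a n (numCells (lam n) - 1)) (lam n * numCells (lam n)))).2
    have h2 := (abs_le.1 (hb (a n 0) 0)).1
    have h3 : -∑ i ∈ Finset.range (numCells (lam n) - 1),
        (wellPrimitive (a n (i + 1)) - wellPrimitive (a n i)) * φ (lam n * (i + 1)) ≤
        ∑ i ∈ Finset.range (numCells (lam n) - 1),
        |wellPrimitive (a n (i + 1)) - wellPrimitive (a n i)| := by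
      refine (neg_le_abs _).trans ((Finset.abs_sum_le_sum_abs _ _).trans ?_)
      refine Finset.sum_le_sum fun i _ => ?_
      rw [abs_mul]
      exact mul_le_of_le_one_right (abs_nonneg _) (hφ1 _)
    have h4 := H.sum_wellPrimitive_le n
    linarith

end ChainLimit

theorem exists_separating_radius {T : Finset ℝ} (hT : ∀ p ∈ T, p ∈ Set.Ioo (0 : ℝ) 1) :
    ∃ r > 0, (∀ p ∈ T, Metric.ball p r ⊆ Set.Ioo 0 1) ∧
      ∀ p ∈ T, ∀ q ∈ T, p ≠ q → Disjoint (Metric.ball p r) (Metric.ball q r) := by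
  have h1 : ∀ᶠ r in 𝓝[>] (0 : ℝ), ∀ p ∈ T, Metric.ball p r ⊆ Set.Ioo 0 1 := by
    rw [eventually_all_finset]
    intro p hp
    obtain ⟨ε, hε, h⟩ := Metric.isOpen_iff.1 isOpen_Ioo p (hT p hp)
    filter_upwards [Ioo_mem_nhdsGT hε] with r hr
    exact (Metric.ball_subset_ball hr.2.le).trans h
  have h2 : ∀ᶠ r in 𝓝[>] (0 : ℝ), ∀ p ∈ T, ∀ q ∈ T, p ≠ q →
      Disjoint (Metric.ball p r) (Metric.ball q r) := by
    rw [eventually_all_finset]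
    intro p _
    rw [eventually_all_finset]
    intro q _
    by_cases hpq : p = q
    · exact Eventually.of_forall fun r h => absurd hpq h
    · filter_upwards [Ioo_mem_nhdsGT (half_pos (dist_pos.2 hpq))] with r hr _
      exact Metric.ball_disjoint_ball (by linarith [hr.2])
  obtain ⟨r, ⟨hr1, hr2⟩, hr⟩ := ((h1.and h2).and self_mem_nhdsWithin).exists
  exact ⟨r, hr, hr1, hr2⟩

theorem notMem_jumpSet_of_ae_eq {z : ℝ → ℝ} {p r b : ℝ} (hr : 0 < r)
    (h : ∀ᵐ x ∂muI, x ∈ Metric.ball p r → z x = b) : p ∉ jumpSet z := by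
  rintro ⟨-, hp⟩
  refine hp ⟨b, ?_⟩
  refine tendsto_const_nhds.congr' ?_
  filter_upwards [Ioo_mem_nhdsGT hr] with ρ hρ
  have : ∫ y in Metric.ball p ρ, |z y - b| ∂muI = 0 := by
    refine integral_eq_zero_of_ae ?_
    rw [EventuallyEq, ae_restrict_iff' measurableSet_ball]
    filter_upwards [h] with x hx hxρ
    rw [hx (Metric.ball_subset_ball hρ.2.le hxρ)]
    simp
  rw [setAverage_eq, this, smul_zero]

/-- If one of the two values were missing among the points of the ball where `G` holds, `z` would be
a.e. constant there and `p` would not be a jump. In the application `G` is pointwise convergence of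
the chains. -/
theorem exists_sign_change {z : ℝ → ℝ} (hz : ∀ᵐ x ∂muI, z x = 1 ∨ z x = -1) {G : ℝ → Prop}
    (hG : ∀ᵐ x ∂muI, G x) {p r : ℝ} (hr : 0 < r) (hp : p ∈ jumpSet z) :
    ∃ x y, x < y ∧ x ∈ Metric.ball p r ∧ y ∈ Metric.ball p r ∧ G x ∧ G y ∧
      ((z x = 1 ∧ z y = -1) ∨ (z x = -1 ∧ z y = 1)) := by
  have hex : ∀ b b' : ℝ, (∀ t, t = 1 ∨ t = -1 → t = b ∨ t = b') →
      ∃ x ∈ Metric.ball p r, G x ∧ z x = b := by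
    intro b b' hbb
    by_contra! hcon
    refine notMem_jumpSet_of_ae_eq hr (b := b') ?_ hp
    filter_upwards [hz, hG] with x hx hGx hxb
    exact (hbb _ hx).resolve_left (hcon x hxb hGx)
  obtain ⟨x, hx, hGx, hzx⟩ := hex 1 (-1) fun t ht => ht
  obtain ⟨y, hy, hGy, hzy⟩ := hex (-1) 1 fun t ht => ht.symm
  have hxy : x ≠ y := by
    rintro rfl
    rw [hzx] at hzy
    norm_num at hzy
  rcases hxy.lt_or_gt with h | h
  · exact ⟨x, y, h, hx, hy, hGx, hGy, Or.inl ⟨hzx, hzy⟩⟩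
  · exact ⟨y, x, h, hy, hx, hGy, hGx, Or.inr ⟨hzy, hzx⟩⟩

namespace ChainLimit

variable {lam h κ : ℕ → ℝ} {c : ℝ} {a : ℕ → ℕ → ℝ} {z : ℝ → ℝ}

/-- Near each jump `wellPrimitive ∘ a n` passes between values close to `-2/3` and `2/3`. Disjoint
balls make these transitions use disjoint sets of bonds, so `4/3 · #T` is at most the limiting
variation `c/2`. -/
theorem card_mul_le (H : ChainLimit lam h κ c a z)
    (hl : Tendsto (fun n => lam n / h n) atTop (𝓝 0)) {T : Finset ℝ} (hT : ↑T ⊆ jumpSet z) :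
    8 / 3 * (T.card : ℝ) ≤ c := by
  obtain ⟨r, hr, hball, hdisj⟩ := exists_separating_radius fun p hp => (hT hp).1
  have hex := fun p (hp : p ∈ T) => exists_sign_change (H.ae_eq_one_or hl) H.lim hr (hT hp)
  choose! x y hxy hx hy hGx hGy hzz using hex
  have hlim : Tendsto (fun n => ∑ p ∈ T, |wellPrimitive (a n ⌊y p / lam n⌋₊) -
      wellPrimitive (a n ⌊x p / lam n⌋₊)|) atTop (𝓝 (∑ p ∈ T, 4 / 3)) := by
    refine tendsto_finsetSum _ fun p hp => ?_
    have h1 := (((continuous_wellPrimitive.tendsto _).comp (hGy p hp)).sub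
      ((continuous_wellPrimitive.tendsto _).comp (hGx p hp))).abs
    convert! h1 using 2
    rcases hzz p hp with ⟨e1, e2⟩ | ⟨e1, e2⟩ <;>
      rw [e1, e2, wellPrimitive_of_one_le le_rfl, wellPrimitive_of_le_neg_one le_rfl] <;> norm_num
  have hle : ∀ᶠ n in atTop, ∑ p ∈ T, |wellPrimitive (a n ⌊y p / lam n⌋₊) -
      wellPrimitive (a n ⌊x p / lam n⌋₊)| ≤ max 1 ((1 + 2 * h n) / κ n) * c / 2 := by
    have hN : ∀ᶠ n in atTop, ∀ p ∈ T, ⌊y p / lam n⌋₊ + 1 < numCells (lam n) := by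
      rw [eventually_all_finset]
      intro p hp
      have := hball p hp (hy p hp)
      exact eventually_floor_add_lt H.lam_pos H.lam_lim this.1.le this.2 1
    filter_upwards [hN] with n hn
    refine le_trans ?_ (H.sum_wellPrimitive_le n)
    have hlam := H.lam_pos n
    refine (Finset.sum_le_sum fun p hp => abs_sub_le_sum_Ico (fun i => wellPrimitive (a n i))
      (Nat.floor_mono (div_le_div_of_nonneg_right (hxy p hp).le hlam.le))).trans ?_
    -- The right ends of the bonds used for `p` lie between `x p` and `y p`, hence in the ball
    -- around `p`; no bond is counted twice.
    have hmem : ∀ p ∈ T, ∀ i ∈ Finset.Ico ⌊x p / lam n⌋₊ ⌊y p / lam n⌋₊,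
        lam n * (i + 1) ∈ Metric.ball p r := by
      intro p hp i hi
      rw [Finset.mem_Ico] at hi
      have hx0 := (hball p hp (hx p hp)).1
      have hy0 := (hball p hp (hy p hp)).1
      have h1 : x p ≤ lam n * (i + 1) := by
        refine (lt_mul_floor hlam hx0.le).le.trans ?_
        have : (⌊x p / lam n⌋₊ : ℝ) ≤ i := by exact_mod_cast hi.1
        gcongr
      have h2 : lam n * (i + 1) ≤ y p := by
        refine le_trans ?_ (mul_floor_le hlam hy0.le)
        have : (i + 1 : ℝ) ≤ ⌊y p / lam n⌋₊ := by exact_mod_cast hi.2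
        gcongr
      have hc := (Real.ball_eq_Ioo p r) ▸ Set.ordConnected_Ioo
      exact hc.out (hx p hp) (hy p hp) ⟨h1, h2⟩
    rw [← Finset.sum_biUnion]
    · refine Finset.sum_le_sum_of_subset_of_nonneg (fun i hi => ?_) fun _ _ _ => abs_nonneg _
      rw [Finset.mem_biUnion] at hi
      obtain ⟨p, hp, hi⟩ := hi
      have := hn p hp
      rw [Finset.mem_Ico] at hi
      rw [Finset.mem_range]
      omega
    · intro p hp q hq hpq
      rw [Function.onFun, Finset.disjoint_left]
      intro i hi hi'
      exact Set.disjoint_left.1 (hdisj p hp q hq hpq) (hmem p hp i hi) (hmem q hq i hi')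
  have := le_of_tendsto_of_tendsto hlim H.tendsto_variation_bound hle
  rw [Finset.sum_const, nsmul_eq_mul] at this
  linarith

theorem limitZero_le (H : ChainLimit lam h κ c a z)
    (hl : Tendsto (fun n => lam n / h n) atTop (𝓝 0)) :
    (8 / 3 : ℝ≥0∞) * ((jumpSet z).encard : ℝ≥0∞) ≤ ENNReal.ofReal c := by
  have h83 : (8 / 3 : ℝ≥0∞) = ENNReal.ofReal (8 / 3) := by
    rw [ENNReal.ofReal_div_of_pos (by norm_num)]
    norm_num
  have hfin : (jumpSet z).Finite := by
    by_contra hinf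
    -- `⌊c⌋ + 1` jumps would already cost more than `c`.
    obtain ⟨T, hT, hcard⟩ := Set.Infinite.exists_subset_card_eq hinf (⌊c⌋₊ + 1)
    have h1 := H.card_mul_le hl hT
    have h2 := Nat.lt_floor_add_one c
    rw [hcard] at h1
    push_cast at h1
    linarith [H.c_nonneg]
  have h1 := H.card_mul_le hl (T := hfin.toFinset) (by simp)
  rw [hfin.encard_eq_coe_toFinset_card, h83]
  refine le_trans (le_of_eq ?_) (ENNReal.ofReal_le_ofReal h1)
  rw [ENNReal.ofReal_mul (by norm_num)]
  simp

end ChainLimit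


/-! ### Functions with values `±1` and finitely many jumps -/

/-- The error of the difference quotient at `y` is controlled by the mean of `|z - b|` over the ball
of radius `2 |y - p|`, which contains the segment from `p` to `y`. Its length `4 |y - p|` explains
the tolerance `ε / 4`. -/
theorem hasDerivAt_integral_of_tendsto_average {z : ℝ → ℝ} (hz : Integrable z muI) {p b : ℝ}
    (hp : p ∈ Set.Ioo (0 : ℝ) 1)
    (h : Tendsto (fun r => ⨍ y in Metric.ball p r, |z y - b| ∂muI) (𝓝[>] 0) (𝓝 0)) :
    HasDerivAt (fun x => ∫ t in (0 : ℝ)..x, z t) b p := by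
  obtain ⟨r₀, hr₀, hball⟩ := Metric.isOpen_iff.1 isOpen_Ioo p hp
  have hint : ∀ x ∈ Set.Ioo (0 : ℝ) 1, ∀ y ∈ Set.Ioo (0 : ℝ) 1, IntervalIntegrable z volume x y := by
    intro x hx y hy
    rw [intervalIntegrable_iff]
    refine IntegrableOn.mono_set hz ?_
    exact Set.uIoc_subset_uIcc.trans (Set.ordConnected_Ioo.uIcc_subset hx hy)
  have hint0 : ∀ y ∈ Set.Ioo (0 : ℝ) 1, IntervalIntegrable z volume 0 y := by
    intro y hy
    rw [intervalIntegrable_iff]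
    refine IntegrableOn.mono_set (hz.mono_measure (le_of_eq muI_eq_Ioc.symm)) ?_
    rw [Set.uIoc_of_le hy.1.le]
    exact Set.Ioc_subset_Ioc_right hy.2.le
  rw [hasDerivAt_iff_isLittleO, Asymptotics.isLittleO_iff]
  intro ε hε
  have hav := h.eventually (gt_mem_nhds (show (0 : ℝ) < ε / 4 by positivity))
  obtain ⟨r₁, hr₁, hav⟩ := (mem_nhdsGT_iff_exists_Ioo_subset).1 hav
  have hr₁ : 0 < r₁ := hr₁
  filter_upwards [Metric.ball_mem_nhds p (half_pos (lt_min hr₀ hr₁))] with y hy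
  rcases eq_or_ne y p with rfl | hyp
  · simp
  set r := |y - p| with hr
  have hrpos : 0 < r := abs_pos.2 (sub_ne_zero.2 hyp)
  rw [Metric.mem_ball, Real.dist_eq, ← hr] at hy
  have h2r0 : 2 * r < r₀ := by linarith [min_le_left r₀ r₁]
  have h2r1 : 2 * r < r₁ := by linarith [min_le_right r₀ r₁]
  have hsub : Metric.ball p (2 * r) ⊆ Set.Ioo 0 1 := (Metric.ball_subset_ball h2r0.le).trans hball
  have hymem : y ∈ Metric.ball p (2 * r) := by
    rw [Metric.mem_ball, Real.dist_eq, ← hr]; linarith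
  have hyI := hsub hymem
  have hAvg : ⨍ t in Metric.ball p (2 * r), |z t - b| ∂muI < ε / 4 := hav ⟨by positivity, h2r1⟩
  have hzb : IntegrableOn (fun t => |z t - b|) (Metric.ball p (2 * r)) volume :=
    ((hz.sub (integrable_const b)).abs : Integrable (fun t => |z t - b|) muI).mono_measure
      (Measure.restrict_mono hsub le_rfl)
  rw [setAverage_eq, measureReal_restrict_apply measurableSet_ball, Set.inter_eq_left.2 hsub,
    measureReal_def, Real.volume_ball, ENNReal.toReal_ofReal (by positivity),
    Measure.restrict_restrict_of_subset hsub, smul_eq_mul, inv_mul_lt_iff₀ (by positivity)] at hAvg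
  have e : (∫ t in (0 : ℝ)..y, z t) - (∫ t in (0 : ℝ)..p, z t) - (y - p) • b =
      ∫ t in p..y, (z t - b) := by
    rw [intervalIntegral.integral_sub (hint p hp y hyI) intervalIntegrable_const,
      intervalIntegral.integral_interval_sub_left (hint0 y hyI) (hint0 p hp)]
    simp
  rw [e]
  calc ‖∫ t in p..y, (z t - b)‖ ≤ ∫ t in Set.uIoc p y, ‖z t - b‖ :=
        intervalIntegral.norm_integral_le_integral_norm_uIoc
    _ ≤ ∫ t in Metric.ball p (2 * r), ‖z t - b‖ := by
        refine setIntegral_mono_set hzb (Eventually.of_forall fun _ => norm_nonneg _) ?_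
        refine LE.le.eventuallyLE ?_
        refine Set.uIoc_subset_uIcc.trans ?_
        rw [Real.ball_eq_Ioo] at hymem ⊢
        exact Set.ordConnected_Ioo.uIcc_subset ⟨by linarith, by linarith⟩ hymem
    _ ≤ ε * ‖y - p‖ := by
        rw [Real.norm_eq_abs, ← hr]
        simp only [Real.norm_eq_abs]
        linarith

theorem integrable_of_ae_eq_one_or {z : ℝ → ℝ} (hm : AEStronglyMeasurable z muI)
    (hz : ∀ᵐ x ∂muI, z x = 1 ∨ z x = -1) : Integrable z muI := by
  refine Integrable.mono' (integrable_const (1 : ℝ)) hm ?_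
  filter_upwards [hz] with x hx
  rcases hx with h | h <;> rw [h] <;> norm_num

/-- A function with values `±1` without jump points is constant. -/
theorem exists_const_of_no_jump {z : ℝ → ℝ} (hm : AEStronglyMeasurable z muI)
    (hz : ∀ᵐ x ∂muI, z x = 1 ∨ z x = -1) {α β : ℝ}
    (hsub : Set.Ioo α β ⊆ Set.Ioo 0 1) (hj : ∀ p ∈ Set.Ioo α β, p ∉ jumpSet z) :
    ∃ b : ℝ, (b = 1 ∨ b = -1) ∧ ∀ᵐ x ∂muI, x ∈ Set.Ioo α β → z x = b := by
  have hint := integrable_of_ae_eq_one_or hm hz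
  set F : ℝ → ℝ := fun x => ∫ t in (0 : ℝ)..x, z t with hF
  have hd : ∀ p ∈ Set.Ioo α β, ∃ b, HasDerivAt F b p ∧
      Tendsto (fun r => ⨍ y in Metric.ball p r, |z y - b| ∂muI) (𝓝[>] 0) (𝓝 0) := by
    intro p hp
    have := hj p hp
    simp only [jumpSet, Set.mem_ofPred_eq, not_and, not_not] at this
    obtain ⟨b, hb⟩ := this (hsub hp)
    exact ⟨b, hasDerivAt_integral_of_tendsto_average hint (hsub hp) hb, hb⟩
  -- An approximate limit `0` is impossible, because the averages of `|z|` equal `1`.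
  have hne : ∀ p ∈ Set.Ioo α β, deriv F p ≠ 0 := by
    intro p hp h0
    obtain ⟨b, hb, hlim⟩ := hd p hp
    rw [hb.deriv] at h0
    subst h0
    have h1 : ∀ᶠ r in 𝓝[>] (0 : ℝ), ⨍ y in Metric.ball p r, |z y - 0| ∂muI = 1 := by
      filter_upwards [self_mem_nhdsWithin] with r hr
      have hr : 0 < r := hr
      have : ∀ᵐ y ∂muI.restrict (Metric.ball p r), |z y - 0| = 1 := by
        filter_upwards [ae_restrict_of_ae hz] with y hy
        rcases hy with h | h <;> rw [h] <;> norm_num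
      rw [average_congr this]
      refine setAverage_const ?_ (measure_ne_top _ _) _
      rw [Measure.restrict_apply measurableSet_ball]
      have hopen : IsOpen (Metric.ball p r ∩ Set.Ioo 0 1) := Metric.isOpen_ball.inter isOpen_Ioo
      exact (hopen.measure_pos volume ⟨p, Metric.mem_ball_self hr, hsub hp⟩).ne'
    have := tendsto_nhds_unique (hlim.congr' h1) tendsto_const_nhds
    norm_num at this
  -- Darboux: a derivative has the intermediate value property even without being continuous. As
  -- `deriv F` does not vanish, it keeps one sign, and it equals `z` a.e.
  have hord : (deriv F '' Set.Ioo α β).OrdConnected :=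
    Set.OrdConnected.image_deriv Set.ordConnected_Ioo
      fun p hp => (hd p hp).choose_spec.1.differentiableAt
  have hII : IntervalIntegrable z volume 0 1 := by
    rw [intervalIntegrable_iff, Set.uIoc_of_le zero_le_one]
    exact hint.mono_measure (le_of_eq muI_eq_Ioc.symm)
  have hderiv : ∀ᵐ x ∂muI, deriv F x = z x := by
    have h1 := ae_restrict_of_ae (s := Set.Ioo (0 : ℝ) 1) hII.ae_hasDerivAt_integral
    filter_upwards [h1, ae_mem_Ioo] with x hx hxI
    refine (hx ?_ 0 (by simp)).deriv
    rw [Set.uIcc_of_le zero_le_one]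
    exact Set.Ioo_subset_Icc_self hxI
  by_cases hpos : ∃ p ∈ Set.Ioo α β, 0 < deriv F p
  · obtain ⟨p, hp, hp0⟩ := hpos
    refine ⟨1, Or.inl rfl, ?_⟩
    filter_upwards [hz, hderiv] with x hx hdx hxI
    refine hx.resolve_right fun hneg => ?_
    rw [hneg] at hdx
    obtain ⟨q, hq, hq0⟩ := hord.out (Set.mem_image_of_mem _ hxI) (Set.mem_image_of_mem _ hp)
      ⟨show deriv F x ≤ 0 by rw [hdx]; norm_num, hp0.le⟩
    exact hne q hq hq0
  · push Not at hpos
    refine ⟨-1, Or.inr rfl, ?_⟩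
    filter_upwards [hz, hderiv] with x hx hdx hxI
    refine hx.resolve_left fun hone => ?_
    have := hpos x hxI
    rw [hdx, hone] at this
    norm_num at this

theorem mem_jumpSet_of_local {z w : ℝ → ℝ} {p r e : ℝ} (hr : 0 < r)
    (he : e = 1 ∨ e = -1) (h : ∀ᵐ x ∂muI, x ∈ Metric.ball p r → w x = e * z x)
    (hp : p ∈ jumpSet w) : p ∈ jumpSet z := by
  refine ⟨hp.1, fun ⟨b, hb⟩ => hp.2 ⟨e * b, hb.congr' ?_⟩⟩
  filter_upwards [Ioo_mem_nhdsGT hr] with ρ hρ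
  refine average_congr ?_
  rw [EventuallyEq, ae_restrict_iff' measurableSet_ball]
  filter_upwards [h] with x hx hxρ
  rw [hx (Metric.ball_subset_ball hρ.2.le hxρ), ← mul_sub, abs_mul]
  rcases he with rfl | rfl <;> simp

theorem sign_eq_one_or {t : ℝ} (ht : t ≠ 0) : Real.sign t = 1 ∨ Real.sign t = -1 :=
  (Real.sign_apply_eq_of_ne_zero t ht).symm

theorem ae_ne (p : ℝ) : ∀ᵐ x ∂muI, x ≠ p :=
  ae_restrict_of_ae (by simp [ae_iff, measure_singleton])

/-- A function with values `±1` and finitely many jump points is a product of signs. -/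
theorem exists_ae_eq_prod_sign (S : Finset ℝ) : ∀ z : ℝ → ℝ, AEStronglyMeasurable z muI →
    (∀ᵐ x ∂muI, z x = 1 ∨ z x = -1) → jumpSet z ⊆ ↑S → ∃ T ⊆ S, ∃ s : ℝ, (s = 1 ∨ s = -1) ∧
      ↑T ⊆ Set.Ioo (0 : ℝ) 1 ∧ ∀ᵐ x ∂muI, z x = s * ∏ p ∈ T, Real.sign (x - p) := by
  induction S using Finset.induction_on with
  | empty =>
    intro z hm hz hS
    obtain ⟨b, hb, h⟩ := exists_const_of_no_jump hm hz (α := 0) (β := 1) subset_rfl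
      fun p _ hp => absurd (hS hp) (by simp)
    refine ⟨∅, subset_rfl, b, hb, by simp, ?_⟩
    filter_upwards [h, ae_mem_Ioo] with x hx hxI
    simpa using hx hxI
  | insert p S hpS ih =>
    intro z hm hz hS
    by_cases hp : p ∈ jumpSet z
    swap
    · have : jumpSet z ⊆ ↑S := fun q hq => by
        have := hS hq
        rw [Finset.coe_insert, Set.mem_insert_iff] at this
        exact this.resolve_left (by rintro rfl; exact hp hq)
      obtain ⟨T, hT, h⟩ := ih z hm hz this
      exact ⟨T, hT.trans (Finset.subset_insert _ _), h⟩
    have hpI := hp.1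
    obtain ⟨r, hr, hball, hnoS⟩ : ∃ r > 0, Metric.ball p r ⊆ Set.Ioo 0 1 ∧
        ∀ q ∈ Metric.ball p r, q ∉ (S : Set ℝ) := by
      have hopen : IsOpen (Set.Ioo (0 : ℝ) 1 ∩ (S : Set ℝ)ᶜ) :=
        isOpen_Ioo.inter S.finite_toSet.isClosed.isOpen_compl
      obtain ⟨r, hr, h⟩ := Metric.isOpen_iff.1 hopen p ⟨hpI, by simpa using hpS⟩
      exact ⟨r, hr, fun q hq => (h hq).1, fun q hq => (h hq).2⟩
    rw [Real.ball_eq_Ioo] at hball hnoS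
    have hnj : ∀ q ∈ Set.Ioo (p - r) (p + r), q ≠ p → q ∉ jumpSet z := by
      intro q hq hqp hqj
      have := hS hqj
      rw [Finset.coe_insert, Set.mem_insert_iff] at this
      exact hnoS q hq (this.resolve_left hqp)
    have hsubL : Set.Ioo (p - r) p ⊆ Set.Ioo (p - r) (p + r) :=
      Set.Ioo_subset_Ioo_right (by linarith)
    have hsubR : Set.Ioo p (p + r) ⊆ Set.Ioo (p - r) (p + r) :=
      Set.Ioo_subset_Ioo_left (by linarith)
    obtain ⟨b₁, hb₁, h₁⟩ := exists_const_of_no_jump hm hz (hsubL.trans hball)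
      fun q hq => hnj q (hsubL hq) hq.2.ne
    obtain ⟨b₂, hb₂, h₂⟩ := exists_const_of_no_jump hm hz (hsubR.trans hball)
      fun q hq => hnj q (hsubR hq) hq.1.ne'
    -- Equal values on both sides would make `z` a.e. constant around `p`.
    have hb : b₂ = -b₁ := by
      by_contra hne
      have hbb : b₂ = b₁ := by
        rcases hb₁ with rfl | rfl <;> rcases hb₂ with rfl | rfl <;> simp_all
      refine notMem_jumpSet_of_ae_eq hr (b := b₁) ?_ hp
      filter_upwards [h₁, h₂, ae_ne p] with x hx₁ hx₂ hxp hx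
      rw [Real.ball_eq_Ioo] at hx
      rcases hxp.lt_or_gt with hlt | hgt
      · exact hx₁ ⟨hx.1, hlt⟩
      · exact (hx₂ ⟨hgt, hx.2⟩).trans hbb
    -- Multiplication by `sign (x - p)` removes the jump at `p` and creates none elsewhere, so the
    -- induction hypothesis applies to `w`.
    set w : ℝ → ℝ := fun x => z x * Real.sign (x - p) with hw
    have hsm : Measurable fun x : ℝ => Real.sign (x - p) := by
      unfold Real.sign
      refine Measurable.ite (measurableSet_lt (by fun_prop) (by fun_prop)) (by fun_prop) ?_
      exact Measurable.ite (measurableSet_lt (by fun_prop) (by fun_prop)) (by fun_prop)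
        (by fun_prop)
    have hwm : AEStronglyMeasurable w muI := hm.mul hsm.aestronglyMeasurable
    have hw1 : ∀ᵐ x ∂muI, w x = 1 ∨ w x = -1 := by
      filter_upwards [hz, ae_ne p] with x hx hxp
      rcases sign_eq_one_or (sub_ne_zero.2 hxp) with h | h <;> rcases hx with h' | h' <;>
        simp [hw, h, h']
    have hwS : jumpSet w ⊆ ↑S := by
      intro q hq
      rcases eq_or_ne q p with rfl | hqp
      · exfalso
        refine notMem_jumpSet_of_ae_eq hr (b := b₂) ?_ hq
        filter_upwards [h₁, h₂, ae_ne q] with x hx₁ hx₂ hxp hx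
        rw [Real.ball_eq_Ioo] at hx
        rcases hxp.lt_or_gt with hlt | hgt
        · simp only [hw]
          rw [hx₁ ⟨hx.1, hlt⟩, Real.sign_of_neg (by linarith), hb]
          ring
        · simp only [hw]
          rw [hx₂ ⟨hgt, hx.2⟩, Real.sign_of_pos (by linarith)]
          ring
      · have hqz : q ∈ jumpSet z := by
          refine mem_jumpSet_of_local (r := |q - p|) (e := Real.sign (q - p))
            (abs_pos.2 (sub_ne_zero.2 hqp)) (sign_eq_one_or (sub_ne_zero.2 hqp)) ?_ hq
          refine Eventually.of_forall fun x hx => ?_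
          simp only [hw]
          rw [mul_comm]
          congr 1
          rw [Metric.mem_ball, Real.dist_eq, abs_lt] at hx
          rcases hqp.lt_or_gt with hlt | hgt
          · rw [abs_of_neg (by linarith)] at hx
            rw [Real.sign_of_neg (by linarith), Real.sign_of_neg (by linarith)]
          · rw [abs_of_pos (by linarith)] at hx
            rw [Real.sign_of_pos (by linarith), Real.sign_of_pos (by linarith)]
        have := hS hqz
        rw [Finset.coe_insert, Set.mem_insert_iff] at this
        exact this.resolve_left hqp
    obtain ⟨T, hT, s, hs, hTI, h⟩ := ih w hwm hw1 hwS
    refine ⟨insert p T, Finset.insert_subset_insert _ hT, s, hs, ?_, ?_⟩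
    · rw [Finset.coe_insert]
      exact Set.insert_subset hpI hTI
    · filter_upwards [h, ae_ne p] with x hx hxp
      rw [Finset.prod_insert fun hpT => hpS (hT hpT)]
      have : Real.sign (x - p) * Real.sign (x - p) = 1 := by
        rcases sign_eq_one_or (sub_ne_zero.2 hxp) with h | h <;> rw [h] <;> norm_num
      calc z x = z x * (Real.sign (x - p) * Real.sign (x - p)) := by rw [this, mul_one]
        _ = w x * Real.sign (x - p) := by simp only [hw]; ring
        _ = _ := by rw [hx]; ring


/-! ### The case `l = 0`: the optimal profile -/

theorem exists_tendsto_L1 {lam : ℕ → ℝ} {a : ℕ → ℕ → ℝ} {B : ℝ} (hB : ∀ n i, |a n i| ≤ B) {z : L1I}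
    (hlim : ∀ᵐ x ∂muI, Tendsto (fun n => a n ⌊x / lam n⌋₊) atTop (𝓝 (z x))) :
    ∃ y : ℕ → L1I, Tendsto y atTop (𝓝 z) ∧ ∀ n, ∀ᵐ x ∂muI, y n x = a n ⌊x / lam n⌋₊ := by
  have hm : ∀ n, AEStronglyMeasurable (fun x => a n ⌊x / lam n⌋₊) muI := fun n =>
    (measurable_comp_floor (lam n) (a n)).aestronglyMeasurable
  have hmem : ∀ n, MemLp (fun x => a n ⌊x / lam n⌋₊) 1 muI := fun n =>
    MemLp.of_bound (hm n) B (Eventually.of_forall fun x => hB _ _)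
  refine ⟨fun n => (hmem n).toLp _, ?_, fun n => (hmem n).coeFn_toLp⟩
  rw [Lp.tendsto_Lp_iff_tendsto_eLpNorm']
  have hcongr : ∀ n, eLpNorm (((hmem n).toLp _ : ℝ → ℝ) - (z : ℝ → ℝ)) 1 muI =
      ∫⁻ x, ‖a n ⌊x / lam n⌋₊ - z x‖ₑ ∂muI := fun n => by
    rw [eLpNorm_one_eq_lintegral_enorm]
    refine lintegral_congr_ae ?_
    filter_upwards [(hmem n).coeFn_toLp] with x hx
    rw [Pi.sub_apply, hx]
  simp only [hcongr]
  rw [show (0 : ℝ≥0∞) = ∫⁻ _, 0 ∂muI by simp]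
  refine tendsto_lintegral_of_dominated_convergence' (fun _ => ENNReal.ofReal (B + B))
    (fun n => ((hm n).sub (Lp.aestronglyMeasurable z)).enorm) (fun n => ?_) (by simp) ?_
  · filter_upwards [hlim] with x hx
    have h1 : |z x| ≤ B := le_of_tendsto hx.abs (Eventually.of_forall fun n => hB _ _)
    rw [← ofReal_norm]
    refine ENNReal.ofReal_le_ofReal ((norm_sub_le _ _).trans (add_le_add (hB _ _) h1))
  · filter_upwards [hlim] with x hx
    have := (hx.sub_const (z x)).enorm
    simpa using this

/-- The equation `q' = 1 - q²` expresses equality of the two energy densities, hence equality in the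
Modica–Mortola inequality. -/
theorem hasDerivAt_tanh (t : ℝ) : HasDerivAt Real.tanh (1 - Real.tanh t ^ 2) t := by
  have hc := (Real.cosh_pos t).ne'
  have h := (Real.hasDerivAt_sinh t).div (Real.hasDerivAt_cosh t) hc
  have e : (Real.sinh / Real.cosh : ℝ → ℝ) = Real.tanh := by
    funext x
    exact (Real.tanh_eq_sinh_div_cosh x).symm
  rw [e] at h
  convert! h using 1
  rw [Real.tanh_eq_sinh_div_cosh]
  field_simp

theorem abs_tanh_le (t : ℝ) : |Real.tanh t| ≤ 1 :=
  abs_le.2 ⟨(Real.neg_one_lt_tanh t).le, (Real.tanh_lt_one t).le⟩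

theorem tanh_sq_le (t : ℝ) : Real.tanh t ^ 2 ≤ 1 := by
  rw [sq_le_one_iff_abs_le_one]
  exact abs_tanh_le t

theorem tanh_monotone : Monotone Real.tanh :=
  monotone_of_deriv_nonneg (fun t => (hasDerivAt_tanh t).differentiableAt) fun t => by
    rw [(hasDerivAt_tanh t).deriv]
    linarith [tanh_sq_le t]

theorem tendsto_tanh_atTop : Tendsto Real.tanh atTop (𝓝 1) := by
  have h1 : Tendsto (fun t : ℝ => 1 - 2 * Real.exp (-t) / Real.exp t) atTop (𝓝 1) := by
    have h2 : Tendsto (fun t : ℝ => Real.exp (-t)) atTop (𝓝 0) :=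
      Real.tendsto_exp_neg_atTop_nhds_zero
    have h3 := ((h2.mul h2).const_mul 2).const_sub 1
    simp only [mul_zero, sub_zero] at h3
    refine h3.congr fun t => ?_
    rw [Real.exp_neg]
    field_simp
  refine tendsto_of_tendsto_of_tendsto_of_le_of_le h1 tendsto_const_nhds (fun t => ?_)
    fun t => (Real.tanh_lt_one t).le
  have h2 := Real.exp_pos t
  have h3 := Real.exp_pos (-t)
  simp only
  rw [Real.tanh_eq_sinh_div_cosh, Real.sinh_eq, Real.cosh_eq, div_div_div_cancel_right₀ two_ne_zero,
    sub_le_iff_le_add, ← sub_le_iff_le_add', show 1 - (Real.exp t - Real.exp (-t)) /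
      (Real.exp t + Real.exp (-t)) = 2 * Real.exp (-t) / (Real.exp t + Real.exp (-t)) by
      field_simp; ring]
  gcongr
  linarith

/-- The primitive of `(1 - tanh²)²`. -/
noncomputable def kinkPrimitive (t : ℝ) : ℝ := Real.tanh t - Real.tanh t ^ 3 / 3

theorem hasDerivAt_kinkPrimitive (t : ℝ) :
    HasDerivAt kinkPrimitive ((1 - Real.tanh t ^ 2) ^ 2) t := by
  have h := (hasDerivAt_tanh t).sub (((hasDerivAt_tanh t).pow 3).div_const 3)
  convert! h using 1
  push_cast
  ring

theorem abs_kinkPrimitive_le (t : ℝ) : |kinkPrimitive t| ≤ 2 / 3 := by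
  have h := abs_le.1 (abs_tanh_le t)
  unfold kinkPrimitive
  set x := Real.tanh t
  rw [abs_le]
  constructor
  · nlinarith [mul_nonneg (sq_nonneg (1 + x)) (show 0 ≤ 2 - x by linarith)]
  · nlinarith [mul_nonneg (sq_nonneg (1 - x)) (show 0 ≤ 2 + x by linarith)]

theorem kinkPrimitive_neg (t : ℝ) : kinkPrimitive (-t) = -kinkPrimitive t := by
  unfold kinkPrimitive
  rw [Real.tanh_neg]
  ring

/-- Cauchy–Schwarz in differential form: with `s` the slope of the chord, `kinkPrimitive - 2 s tanh
+ s² x` has derivative `(1 - tanh² - s)² ≥ 0`. -/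
theorem tanh_sub_sq_le {t h : ℝ} (hh : 0 < h) :
    (Real.tanh (t + h) - Real.tanh t) ^ 2 ≤ h * (kinkPrimitive (t + h) - kinkPrimitive t) := by
  set s := (Real.tanh (t + h) - Real.tanh t) / h with hs
  have hd : ∀ x, HasDerivAt (fun x => kinkPrimitive x - 2 * s * Real.tanh x + s ^ 2 * x)
      ((1 - Real.tanh x ^ 2) ^ 2 - 2 * s * (1 - Real.tanh x ^ 2) + s ^ 2 * 1) x := fun x =>
    ((hasDerivAt_kinkPrimitive x).sub ((hasDerivAt_tanh x).const_mul (2 * s))).add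
      ((hasDerivAt_id x).const_mul (s ^ 2))
  have hmono : Monotone fun x => kinkPrimitive x - 2 * s * Real.tanh x + s ^ 2 * x :=
    monotone_of_deriv_nonneg (fun x => (hd x).differentiableAt) fun x => by
      rw [(hd x).deriv]
      nlinarith [sq_nonneg (1 - Real.tanh x ^ 2 - s)]
  have h1 := hmono (show t ≤ t + h by linarith)
  simp only at h1
  have h2 : Real.tanh (t + h) - Real.tanh t = s * h := by rw [hs]; field_simp
  rw [h2]
  have h3 : s ^ 2 * h ≤ kinkPrimitive (t + h) - kinkPrimitive t := by
    have : 2 * s * Real.tanh (t + h) - 2 * s * Real.tanh t = 2 * s * (s * h) := by rw [← h2]; ring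
    nlinarith
  nlinarith

/-- The product `(1 - tanh²)² exp (4x)` is nondecreasing, so over a step `h` the density falls at
most by the factor `exp (-4h)` below its value at the left end. -/
theorem mul_kink_le {t h : ℝ} (hh : 0 < h) :
    h * (1 - Real.tanh t ^ 2) ^ 2 ≤
      Real.exp (4 * h) * (kinkPrimitive (t + h) - kinkPrimitive t) := by
  have hd : ∀ x, HasDerivAt (fun x => (1 - Real.tanh x ^ 2) ^ 2 * Real.exp (4 * x))
      ((2 * (1 - Real.tanh x ^ 2) * -(2 * Real.tanh x * (1 - Real.tanh x ^ 2))) * Real.exp (4 * x) +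
        (1 - Real.tanh x ^ 2) ^ 2 * (Real.exp (4 * x) * 4)) x := fun x => by
    have h1 := (((hasDerivAt_tanh x).pow 2).const_sub 1).pow 2
    have h2 : HasDerivAt (fun x : ℝ => Real.exp (4 * x)) (Real.exp (4 * x) * 4) x := by
      simpa using ((hasDerivAt_id x).const_mul 4).exp
    have h3 := h1.mul h2
    convert! h3 using 1
    simp only [Pi.pow_apply]
    push_cast
    ring
  have hmono : Monotone fun x => (1 - Real.tanh x ^ 2) ^ 2 * Real.exp (4 * x) :=
    monotone_of_deriv_nonneg (fun x => (hd x).differentiableAt) fun x => by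
      rw [(hd x).deriv]
      have e : (2 * (1 - Real.tanh x ^ 2) * -(2 * Real.tanh x * (1 - Real.tanh x ^ 2))) *
          Real.exp (4 * x) + (1 - Real.tanh x ^ 2) ^ 2 * (Real.exp (4 * x) * 4) =
          4 * (1 - Real.tanh x ^ 2) ^ 2 * Real.exp (4 * x) * (1 - Real.tanh x) := by ring
      rw [e]
      have : 0 ≤ 1 - Real.tanh x := by linarith [Real.tanh_lt_one x]
      positivity
  have hlow : ∀ x ∈ interior (Set.Icc t (t + h)),
      Real.exp (-(4 * h)) * (1 - Real.tanh t ^ 2) ^ 2 ≤ deriv kinkPrimitive x := fun x hx => by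
    rw [interior_Icc] at hx
    rw [(hasDerivAt_kinkPrimitive x).deriv]
    have h1 := hmono hx.1.le
    simp only at h1
    have h2 : (1 - Real.tanh x ^ 2) ^ 2 * Real.exp (4 * x) ≤
        (1 - Real.tanh x ^ 2) ^ 2 * Real.exp (4 * (t + h)) := by
      gcongr
      exact hx.2.le
    have h3 : Real.exp (4 * (t + h)) = Real.exp (4 * t) * Real.exp (4 * h) := by
      rw [← Real.exp_add]; ring_nf
    rw [h3] at h2
    have h4 := Real.exp_pos (4 * t)
    have h5 := Real.exp_pos (4 * h)
    rw [Real.exp_neg, inv_mul_le_iff₀ h5]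
    nlinarith
  have := (convex_Icc t (t + h)).mul_sub_le_image_sub_of_le_deriv
    (fun x _ => (hasDerivAt_kinkPrimitive x).continuousAt.continuousWithinAt)
    (fun x _ => (hasDerivAt_kinkPrimitive x).differentiableAt.differentiableWithinAt) hlow
    t (by simp [hh.le]) (t + h) (by simp [hh.le]) (by linarith)
  rw [Real.exp_neg, add_sub_cancel_left, mul_assoc, inv_mul_le_iff₀ (Real.exp_pos _)] at this
  linarith

/-- The optimal profile `tanh`, steepened by `k` and cut off at `±1`. -/
noncomputable def kink (k t : ℝ) : ℝ := max (-1) (min 1 (k * Real.tanh t))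

theorem abs_kink_le (k t : ℝ) : |kink k t| ≤ 1 :=
  abs_le.2 ⟨le_max_left _ _, max_le (by norm_num) (min_le_left _ _)⟩

theorem abs_kink_sub_le {k : ℝ} (hk : 0 ≤ k) (s t : ℝ) :
    |kink k t - kink k s| ≤ k * |Real.tanh t - Real.tanh s| := by
  unfold kink
  have h1 := abs_max_sub_max_le_max (-1) (min 1 (k * Real.tanh t)) (-1) (min 1 (k * Real.tanh s))
  have h2 := abs_min_sub_min_le_max 1 (k * Real.tanh t) 1 (k * Real.tanh s)
  rw [sub_self, abs_zero] at h1
  refine ((h1.trans (max_le (abs_nonneg _) le_rfl)).trans h2).trans ?_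
  rw [sub_self, abs_zero, ← mul_sub, abs_mul, abs_of_nonneg hk]
  exact max_le (by positivity) le_rfl

theorem tanh_sq_le_kink_sq {k : ℝ} (hk : 1 ≤ k) (t : ℝ) : Real.tanh t ^ 2 ≤ kink k t ^ 2 := by
  rw [sq_le_sq]
  unfold kink
  have h1 := abs_le.1 (abs_tanh_le t)
  rcases le_total 0 (Real.tanh t) with h | h
  · have h2 : Real.tanh t ≤ k * Real.tanh t := le_mul_of_one_le_left h hk
    rw [abs_of_nonneg h]
    refine le_trans ?_ (le_abs_self _)
    exact le_max_of_le_right (le_min h1.2 h2)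
  · have h2 : k * Real.tanh t ≤ Real.tanh t := by nlinarith
    rw [abs_of_nonpos h]
    refine le_trans ?_ (neg_le_abs _)
    rw [neg_le_neg_iff]
    exact max_le h1.1 (le_trans (min_le_right _ _) h2)

/-- The energy of a bond pair. -/
noncomputable def stepEnergy (h x y : ℝ) : ℝ :=
  h / 4 * (x ^ 2 + y ^ 2 - 2) ^ 2 + 1 / h * (y - x) ^ 2

theorem stepEnergy_nonneg {h : ℝ} (hh : 0 < h) (x y : ℝ) : 0 ≤ stepEnergy h x y := by
  unfold stepEnergy
  positivity

/-- Truncation is 1-Lipschitz, so steepening costs at most `k²` in the gradient term. It moves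
values towards the wells, so the potential is at most that of `tanh`. -/
theorem stepEnergy_kink_le {k h t : ℝ} (hk : 1 ≤ k) (hh : 0 < h) :
    stepEnergy h (kink k t) (kink k (t + h)) ≤
      (k ^ 2 + Real.exp (4 * h)) * (kinkPrimitive (t + h) - kinkPrimitive t) := by
  have hgrad : 1 / h * (kink k (t + h) - kink k t) ^ 2 ≤
      k ^ 2 * (kinkPrimitive (t + h) - kinkPrimitive t) := by
    have h1 := abs_kink_sub_le (zero_le_one.trans hk) t (t + h)
    have h2 := pow_le_pow_left₀ (abs_nonneg _) h1 2
    rw [sq_abs, mul_pow, sq_abs] at h2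
    rw [one_div, inv_mul_le_iff₀ hh]
    calc _ ≤ _ := h2
      _ ≤ k ^ 2 * (h * (kinkPrimitive (t + h) - kinkPrimitive t)) := by
          gcongr; exact tanh_sub_sq_le hh
      _ = _ := by ring
  have hpot : h / 4 * (kink k t ^ 2 + kink k (t + h) ^ 2 - 2) ^ 2 ≤
      Real.exp (4 * h) * (kinkPrimitive (t + h) - kinkPrimitive t) := by
    have e1 := mul_kink_le (t := t) hh
    -- The reflected point supplies the bound at the right end of the step.
    have e2 := mul_kink_le (t := -(t + h)) hh
    rw [Real.tanh_neg, neg_sq, show -(t + h) + h = -t by ring, kinkPrimitive_neg,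
      kinkPrimitive_neg] at e2
    have b1 := tanh_sq_le_kink_sq hk t
    have b2 := tanh_sq_le_kink_sq hk (t + h)
    have c1 : kink k t ^ 2 ≤ 1 := by
      rw [sq_le_one_iff_abs_le_one]; exact abs_kink_le _ _
    have c2 : kink k (t + h) ^ 2 ≤ 1 := by
      rw [sq_le_one_iff_abs_le_one]; exact abs_kink_le _ _
    set u := Real.tanh t ^ 2
    set v := Real.tanh (t + h) ^ 2
    have hsq : (kink k t ^ 2 + kink k (t + h) ^ 2 - 2) ^ 2 ≤ ((1 - u) + (1 - v)) ^ 2 := by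
      rw [← neg_sq (kink k t ^ 2 + kink k (t + h) ^ 2 - 2)]
      exact pow_le_pow_left₀ (by linarith) (by linarith) 2
    have hsq2 : ((1 - u) + (1 - v)) ^ 2 ≤ 2 * (1 - u) ^ 2 + 2 * (1 - v) ^ 2 := by
      nlinarith [sq_nonneg (u - v)]
    calc _ ≤ h / 4 * (2 * (1 - u) ^ 2 + 2 * (1 - v) ^ 2) := by
          gcongr; exact hsq.trans hsq2
      _ ≤ _ := by linarith
  unfold stepEnergy
  rw [add_mul]
  linarith

/-- The increments telescope and `kinkPrimitive` grows by at most `4/3` in all. As `k → 1` and `h →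
0` the prefactor tends to `2`, whence `8/3` per kink. -/
theorem sum_stepEnergy_kink_le {k h : ℝ} (hk : 1 ≤ k) (hh : 0 < h) (t : ℝ) (M : ℕ) :
    ∑ i ∈ Finset.range M, stepEnergy h (kink k (t + h * i)) (kink k (t + h * (i + 1 : ℕ))) ≤
      (k ^ 2 + Real.exp (4 * h)) * (4 / 3) := by
  calc _ ≤ ∑ i ∈ Finset.range M, (k ^ 2 + Real.exp (4 * h)) *
        (kinkPrimitive (t + h * (i + 1 : ℕ)) - kinkPrimitive (t + h * i)) := by
        refine Finset.sum_le_sum fun i _ => ?_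
        have := stepEnergy_kink_le (t := t + h * i) hk hh
        rwa [show t + h * i + h = t + h * (i + 1 : ℕ) by push_cast; ring] at this
    _ = (k ^ 2 + Real.exp (4 * h)) * (kinkPrimitive (t + h * M) - kinkPrimitive (t + h * 0)) := by
        rw [← Finset.mul_sum, Finset.sum_range_sub (fun i : ℕ => kinkPrimitive (t + h * i))]
        simp
    _ ≤ _ := by
        have h1 := (abs_le.1 (abs_kinkPrimitive_le (t + h * M))).2
        have h2 := (abs_le.1 (abs_kinkPrimitive_le (t + h * 0))).1
        have := Real.exp_pos (4 * h)
        gcongr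
        linarith

/-- The steepening `k = 1 / tanh T` is chosen so that the profile reaches `±1` exactly at `|t| = T`.
-/
theorem kink_eq_sign {k T t : ℝ} (hT : 0 < T) (hk : k * Real.tanh T = 1) (ht : T ≤ |t|) :
    kink k t = Real.sign t := by
  have hk0 : 0 ≤ k := by
    have : 0 ≤ Real.tanh T := by simpa using tanh_monotone hT.le
    by_contra! h
    nlinarith
  unfold kink
  rcases le_total 0 t with h | h
  · rw [abs_of_nonneg h] at ht
    have h1 : 1 ≤ k * Real.tanh t := by
      rw [← hk]; exact mul_le_mul_of_nonneg_left (tanh_monotone ht) hk0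
    rw [min_eq_left h1, Real.sign_of_pos (hT.trans_le ht), max_eq_right (by norm_num)]
  · rw [abs_of_nonpos h] at ht
    have h1 : k * Real.tanh t ≤ -1 := by
      rw [← hk]
      have := mul_le_mul_of_nonneg_left (tanh_monotone ht) hk0
      rw [Real.tanh_neg] at this
      linarith
    rw [Real.sign_of_neg (by linarith), max_eq_left (le_trans (min_le_right _ _) h1)]


/-! ### Gluing kinks and Γ-convergence for `l = 0` -/

theorem quadEnergy_eq_sum_stepEnergy (h : ℝ) (N : ℕ) (a : ℕ → ℝ) :
    quadEnergy h 1 N a = ∑ i ∈ Finset.range (N - 1), stepEnergy h (a i) (a (i + 1)) := rfl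

theorem stepEnergy_mul {h e : ℝ} (he : e = 1 ∨ e = -1) (x y : ℝ) :
    stepEnergy h (e * x) (e * y) = stepEnergy h x y := by
  rcases he with rfl | rfl <;> simp only [stepEnergy] <;> ring

theorem stepEnergy_self {h e : ℝ} (he : e = 1 ∨ e = -1) : stepEnergy h e e = 0 := by
  rcases he with rfl | rfl <;> norm_num [stepEnergy]

theorem mul_prod_eq_one_or {ι : Type*} {s : ℝ} (hs : s = 1 ∨ s = -1) {T : Finset ι} {f : ι → ℝ}
    (hf : ∀ p ∈ T, f p = 1 ∨ f p = -1) : s * ∏ p ∈ T, f p = 1 ∨ s * ∏ p ∈ T, f p = -1 := by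
  classical
  induction T using Finset.induction_on with
  | empty => simpa using hs
  | insert q T hq ih =>
    rw [Finset.prod_insert hq]
    have h1 := ih fun p hp => hf p (Finset.mem_insert_of_mem hp)
    rw [show s * (f q * ∏ p ∈ T, f p) = f q * (s * ∏ p ∈ T, f p) by ring]
    rcases hf q (Finset.mem_insert_self _ _) with h | h <;> rcases h1 with h' | h' <;>
      simp [h, h']

section Kinks

variable {k lam l h τ s r : ℝ} {T : Finset ℝ}

/-- The chain with a kink at each point of `T`. -/
noncomputable def kinkChain (k lam l s : ℝ) (T : Finset ℝ) (i : ℕ) : ℝ :=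
  s * ∏ p ∈ T, kink k ((lam * i - p) / l)

theorem abs_kinkChain_le (hs : s = 1 ∨ s = -1) (i : ℕ) : |kinkChain k lam l s T i| ≤ 1 := by
  have hs' : |s| = 1 := by rcases hs with rfl | rfl <;> simp
  rw [kinkChain, abs_mul, hs', one_mul, Finset.abs_prod]
  exact Finset.prod_le_one (fun _ _ => abs_nonneg _) fun _ _ => abs_kink_le _ _

theorem sign_div {x : ℝ} (hl : 0 < l) : Real.sign (x / l) = Real.sign x := by
  rcases lt_trichotomy x 0 with h | rfl | h
  · rw [Real.sign_of_neg h, Real.sign_of_neg (div_neg_of_neg_of_pos h hl)]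
  · simp
  · rw [Real.sign_of_pos h, Real.sign_of_pos (div_pos h hl)]

theorem kink_div_eq_sign {x : ℝ} (hl : 0 < l) (hτ : 0 < τ) (hk : k * Real.tanh τ = 1)
    (hx : l * τ ≤ |x|) : kink k (x / l) = Real.sign x := by
  rw [kink_eq_sign hτ hk, sign_div hl]
  rwa [abs_div, abs_of_pos hl, le_div_iff₀ hl, mul_comm]

theorem kink_div_eq_sign' {x : ℝ} (hlam : 0 < lam) (hl : 0 < l) (hτ : 0 < τ)
    (hk : k * Real.tanh τ = 1) (hx : l * τ + lam ≤ |x|) :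
    kink k ((x + lam) / l) = Real.sign x := by
  have hlτ : 0 < l * τ := mul_pos hl hτ
  rcases le_total 0 x with h | h
  · rw [abs_of_nonneg h] at hx
    rw [kink_div_eq_sign hl hτ hk (by rw [abs_of_nonneg] <;> linarith),
      Real.sign_of_pos (by linarith), Real.sign_of_pos (by linarith)]
  · rw [abs_of_nonpos h] at hx
    rw [kink_div_eq_sign hl hτ hk (by rw [abs_of_nonpos] <;> linarith),
      Real.sign_of_neg (by linarith), Real.sign_of_neg (by linarith)]

/-- At any site at most one kink is in transition. All other factors are `±1` and agree at the next
site, the margin `lam` in `hr` covering that step; a common sign does not change the energy. -/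
theorem stepEnergy_kinkChain_le (hlam : 0 < lam) (hl : 0 < l) (hh : 0 < h) (hτ : 0 < τ)
    (hk : k * Real.tanh τ = 1) (hs : s = 1 ∨ s = -1) (hr : l * τ + lam ≤ r)
    (hdisj : ∀ p ∈ T, ∀ q ∈ T, p ≠ q → Disjoint (Metric.ball p r) (Metric.ball q r)) (i : ℕ) :
    stepEnergy h (kinkChain k lam l s T i) (kinkChain k lam l s T (i + 1)) ≤
      ∑ p ∈ T, stepEnergy h (kink k ((lam * i - p) / l)) (kink k ((lam * (i + 1 : ℕ) - p) / l)) := by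
  have hfar : ∀ p, r ≤ |lam * i - p| → (kink k ((lam * i - p) / l) = 1 ∨
      kink k ((lam * i - p) / l) = -1) ∧
      kink k ((lam * (i + 1 : ℕ) - p) / l) = kink k ((lam * i - p) / l) := by
    intro p hp
    have h1 := kink_div_eq_sign hl hτ hk (x := lam * i - p) (by linarith)
    have h2 := kink_div_eq_sign' hlam hl hτ hk (x := lam * i - p) (by linarith)
    rw [show lam * (i + 1 : ℕ) - p = lam * i - p + lam by push_cast; ring, h1, h2]
    refine ⟨sign_eq_one_or ?_, rfl⟩
    have : 0 < |lam * i - p| := lt_of_lt_of_le (by positivity) (hr.trans hp)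
    exact abs_pos.1 this
  have hnn : 0 ≤ ∑ p ∈ T, stepEnergy h (kink k ((lam * i - p) / l))
      (kink k ((lam * (i + 1 : ℕ) - p) / l)) := Finset.sum_nonneg fun _ _ => stepEnergy_nonneg hh _ _
  by_cases hact : ∃ q ∈ T, |lam * i - q| < r
  · obtain ⟨q, hq, hqr⟩ := hact
    have hothers : ∀ p ∈ T.erase q, r ≤ |lam * i - p| := by
      intro p hp
      by_contra! hlt
      have hpq := Finset.ne_of_mem_erase hp
      refine Set.disjoint_left.1 (hdisj p (Finset.mem_of_mem_erase hp) q hq hpq)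
        (show lam * (i : ℝ) ∈ Metric.ball p r from ?_) ?_ <;> rwa [Metric.mem_ball, Real.dist_eq]
    set e := s * ∏ p ∈ T.erase q, kink k ((lam * i - p) / l) with he
    have he1 : e = 1 ∨ e = -1 := mul_prod_eq_one_or hs fun p hp => (hfar p (hothers p hp)).1
    have e1 : kinkChain k lam l s T i = e * kink k ((lam * i - q) / l) := by
      rw [kinkChain, ← Finset.mul_prod_erase T _ hq, he]; ring
    have e2 : kinkChain k lam l s T (i + 1) = e * kink k ((lam * (i + 1 : ℕ) - q) / l) := by
      rw [kinkChain, ← Finset.mul_prod_erase T _ hq, he,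
        Finset.prod_congr rfl fun p hp => (hfar p (hothers p hp)).2]
      ring
    rw [e1, e2, stepEnergy_mul he1]
    exact Finset.single_le_sum (f := fun p => stepEnergy h (kink k ((lam * i - p) / l))
      (kink k ((lam * (i + 1 : ℕ) - p) / l))) (fun _ _ => stepEnergy_nonneg hh _ _) hq
  · push Not at hact
    have he1 : kinkChain k lam l s T i = 1 ∨ kinkChain k lam l s T i = -1 :=
      mul_prod_eq_one_or hs fun p hp => (hfar p (hact p hp)).1
    have e2 : kinkChain k lam l s T (i + 1) = kinkChain k lam l s T i := by
      rw [kinkChain, kinkChain, Finset.prod_congr rfl fun p hp => (hfar p (hact p hp)).2]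
    rw [e2, stepEnergy_self he1]
    exact hnn

theorem quadEnergy_kinkChain_le (hlam : 0 < lam) (hl : 0 < l) (hh : 0 < h) (hlh : lam = l * h)
    (hτ : 0 < τ) (hk : k * Real.tanh τ = 1) (hs : s = 1 ∨ s = -1) (hr : l * τ + lam ≤ r)
    (hdisj : ∀ p ∈ T, ∀ q ∈ T, p ≠ q → Disjoint (Metric.ball p r) (Metric.ball q r)) (N : ℕ) :
    quadEnergy h 1 N (kinkChain k lam l s T) ≤ T.card * ((k ^ 2 + Real.exp (4 * h)) * (4 / 3)) := by
  have hk1 : 1 ≤ k := by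
    have h1 := Real.tanh_lt_one τ
    have h0 : 0 ≤ Real.tanh τ := by simpa using tanh_monotone hτ.le
    by_contra! hlt
    nlinarith
  rw [quadEnergy_eq_sum_stepEnergy]
  refine (Finset.sum_le_sum fun i _ => stepEnergy_kinkChain_le hlam hl hh hτ hk hs hr hdisj i).trans ?_
  rw [Finset.sum_comm, ← nsmul_eq_mul]
  refine Finset.sum_le_card_nsmul _ _ _ fun p _ => ?_
  have := sum_stepEnergy_kink_le hk1 hh (-p / l) (N - 1)
  refine le_of_eq_of_le (Finset.sum_congr rfl fun i _ => ?_) this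
  -- Because `lam = l * h`, a lattice step is a step `h` in the variable of the profile.
  have e : ∀ j : ℕ, (lam * j - p) / l = -p / l + h * j := fun j => by
    rw [hlh]
    field_simp
    ring
  rw [e, e]

theorem abs_kinkChain_eq_one (hl : 0 < l) (hτ : 0 < τ) (hk : k * Real.tanh τ = 1)
    (hs : s = 1 ∨ s = -1) {i : ℕ} (hi : ∀ p ∈ T, l * τ ≤ |lam * i - p|) :
    |kinkChain k lam l s T i| = 1 := by
  have : kinkChain k lam l s T i = 1 ∨ kinkChain k lam l s T i = -1 := by
    refine mul_prod_eq_one_or hs fun p hp => ?_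
    rw [kink_div_eq_sign hl hτ hk (hi p hp)]
    refine sign_eq_one_or ?_
    exact abs_pos.1 ((mul_pos hl hτ).trans_le (hi p hp))
  rcases this with h | h <;> rw [h] <;> simp

end Kinks

theorem exists_recovery_prod_sign {lam del : ℕ → ℝ} (hlam : ∀ n, 0 < lam n)
    (hlam0 : Tendsto lam atTop (𝓝 0)) (hdel : ∀ n, 0 < del n) (hdel0 : Tendsto del atTop (𝓝 0))
    (hl : Tendsto (fun n => lam n / Real.sqrt (2 * del n)) atTop (𝓝 0)) {T : Finset ℝ}
    (hT : ↑T ⊆ Set.Ioo (0 : ℝ) 1) {s : ℝ} (hs : s = 1 ∨ s = -1) {z : L1I}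
    (hz : ∀ᵐ x ∂muI, z x = s * ∏ p ∈ T, Real.sign (x - p)) :
    ∃ y : ℕ → L1I, Tendsto y atTop (𝓝 z) ∧
      limsup (fun n => scaledHhf (lam n) (del n) (y n)) atTop ≤ ENNReal.ofReal (8 / 3 * T.card) := by
  obtain ⟨r, hr, hball, hdisj⟩ := exists_separating_radius fun p hp => hT hp
  set h : ℕ → ℝ := fun n => Real.sqrt (2 * del n) with hh
  have hhpos : ∀ n, 0 < h n := fun n => Real.sqrt_pos.2 (mul_pos two_pos (hdel n))
  have hh0 : Tendsto h atTop (𝓝 0) :=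
    (Real.continuous_sqrt.tendsto' 0 0 Real.sqrt_zero).comp (by simpa using hdel0.const_mul 2)
  set l : ℕ → ℝ := fun n => lam n / h n with hl'
  have hlpos : ∀ n, 0 < l n := fun n => div_pos (hlam n) (hhpos n)
  -- With `τ = l^(-1/2)` the cut-off tends to infinity, so that `k → 1`, while the half-width `l τ =
  -- √l` of a transition still tends to zero.
  set τ : ℕ → ℝ := fun n => (Real.sqrt (l n))⁻¹ with hτ
  have hτpos : ∀ n, 0 < τ n := fun n => inv_pos.2 (Real.sqrt_pos.2 (hlpos n))
  have hsqrt0 : Tendsto (fun n => Real.sqrt (l n)) atTop (𝓝 0) :=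
    (Real.continuous_sqrt.tendsto' 0 0 Real.sqrt_zero).comp hl
  have hτtop : Tendsto τ atTop atTop := by
    refine tendsto_inv_nhdsGT_zero.comp ?_
    exact tendsto_nhdsWithin_iff.2 ⟨hsqrt0, Eventually.of_forall fun n => Real.sqrt_pos.2 (hlpos n)⟩
  have hlτ : ∀ n, l n * τ n = Real.sqrt (l n) := fun n => by
    have := (Real.sqrt_pos.2 (hlpos n)).ne'
    simp only [hτ]
    rw [← div_eq_mul_inv, Real.div_sqrt]
  set k : ℕ → ℝ := fun n => (Real.tanh (τ n))⁻¹ with hk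
  have htanh : ∀ n, 0 < Real.tanh (τ n) := fun n => by
    rw [Real.tanh_eq_sinh_div_cosh]
    exact div_pos (Real.sinh_pos_iff.2 (hτpos n)) (Real.cosh_pos _)
  have hkτ : ∀ n, k n * Real.tanh (τ n) = 1 := fun n => inv_mul_cancel₀ (htanh n).ne'
  have hk1 : Tendsto k atTop (𝓝 1) := by
    simpa using (tendsto_tanh_atTop.comp hτtop).inv₀ one_ne_zero
  set ρ : ℕ → ℝ := fun n => l n * τ n + lam n with hρ
  have hρ0 : Tendsto ρ atTop (𝓝 0) := by
    simp only [hρ, hlτ]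
    simpa using hsqrt0.add hlam0
  have hlam_eq : ∀ n, lam n = l n * h n := fun n => (div_mul_cancel₀ _ (hhpos n).ne').symm
  set a : ℕ → ℕ → ℝ := fun n => kinkChain (k n) (lam n) (l n) s T with ha
  have hB : ∀ n i, |a n i| ≤ 1 := fun n i => abs_kinkChain_le hs i
  have hlim : ∀ᵐ x ∂muI, Tendsto (fun n => a n ⌊x / lam n⌋₊) atTop (𝓝 (z x)) := by
    have hTne : ∀ᵐ x ∂muI, ∀ p ∈ T, x ≠ p := by
      rw [Filter.eventually_all_finset]
      exact fun p _ => ae_ne p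
    filter_upwards [hz, hTne, ae_mem_Ioo] with x hx hxT hxI
    rw [hx]
    refine Tendsto.const_mul s (tendsto_finsetProd _ fun p hp => ?_)
    refine tendsto_const_nhds.congr' ?_
    have hxp := sub_ne_zero.2 (hxT p hp)
    have h1 : Tendsto (fun n => lam n * ⌊x / lam n⌋₊ - p) atTop (𝓝 (x - p)) :=
      (tendsto_mul_floor hlam hlam0 hxI.1.le).sub_const p
    have h2 : ∀ᶠ n in atTop, ρ n < |lam n * ⌊x / lam n⌋₊ - p| :=
      hρ0.eventually_lt h1.abs (abs_pos.2 hxp)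
    have h3 : ∀ᶠ n in atTop, Real.sign (lam n * ⌊x / lam n⌋₊ - p) = Real.sign (x - p) := by
      rcases hxp.lt_or_gt with hlt | hgt
      · filter_upwards [h1.eventually (gt_mem_nhds hlt)] with n hn
        rw [Real.sign_of_neg hn, Real.sign_of_neg hlt]
      · filter_upwards [h1.eventually (lt_mem_nhds hgt)] with n hn
        rw [Real.sign_of_pos hn, Real.sign_of_pos hgt]
    filter_upwards [h2, h3] with n hn2 hn3
    rw [kink_div_eq_sign (hlpos n) (hτpos n) (hkτ n), hn3]
    refine le_trans ?_ hn2.le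
    simp only [hρ]
    linarith [hlam n]
  obtain ⟨y, hy, hya⟩ := exists_tendsto_L1 hB hlim
  refine ⟨y, hy, ?_⟩
  have he : Tendsto (fun n => (T.card : ℝ) * ((k n ^ 2 + Real.exp (4 * h n)) * (4 / 3))) atTop
      (𝓝 (8 / 3 * (T.card : ℝ))) := by
    have h1 : Tendsto (fun n => Real.exp (4 * h n)) atTop (𝓝 1) :=
      (Real.continuous_exp.tendsto' 0 1 Real.exp_zero).comp (by simpa using hh0.const_mul 4)
    have := (((hk1.pow 2).add h1).mul_const (4 / 3)).const_mul (T.card : ℝ)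
    convert! this using 2
    ring
  have hρr : ∀ᶠ n in atTop, ρ n + lam n * 2 < r := by
    have : Tendsto (fun n => ρ n + lam n * 2) atTop (𝓝 0) := by
      simpa using hρ0.add (hlam0.mul_const 2)
    exact this.eventually (gt_mem_nhds hr)
  refine limsup_scaledHhf_le hlam hlam0 hdel hdel0 hB ?_
    (Eventually.of_forall fun n => (hya n).mono fun x hx _ => hx) he ?_
  -- The transitions stay away from both ends, so the chain is `±1` there and satisfies the boundary
  -- condition.
  · filter_upwards [hρr, eventually_le_numCells hlam hlam0 1] with n hn hN
    have hρn : l n * τ n ≤ ρ n := by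
      simp only [hρ]; linarith [hlam n]
    have hend : ∀ p ∈ T, r ≤ p ∧ p + r ≤ 1 := fun p hp => by
      have := hball p hp
      rw [Real.ball_eq_Ioo] at this
      have := (Set.Ioo_subset_Ioo_iff (by linarith)).1 this
      exact ⟨by linarith, this.2⟩
    have h0 : |a n 0| = 1 := by
      refine abs_kinkChain_eq_one (hlpos n) (hτpos n) (hkτ n) hs fun p hp => ?_
      have := hend p hp
      rw [Nat.cast_zero, mul_zero, zero_sub, abs_neg, abs_of_pos (by linarith)]
      linarith [hlam n]
    have h1 : |a n (numCells (lam n) - 1)| = 1 := by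
      refine abs_kinkChain_eq_one (hlpos n) (hτpos n) (hkτ n) hs fun p hp => ?_
      have := hend p hp
      have h2 := lt_mul_numCells (hlam n)
      have h3 : lam n * (numCells (lam n) - 1 : ℕ) = lam n * numCells (lam n) - lam n := by
        rw [Nat.cast_sub hN]
        push_cast
        ring
      rw [h3]
      refine le_trans ?_ (le_abs_self _)
      linarith
    rw [h0, h1]
  · filter_upwards [hρr] with n hn
    exact quadEnergy_kinkChain_le (hlam n) (hlpos n) (hhpos n) (hlam_eq n) (hτpos n) (hkτ n) hs
      (by have := hlam n; simp only [hρ] at hn; linarith) hdisj _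

/-- For infinitely many jumps the limit value is `⊤` and any sequence recovers it; otherwise `z` is
a product of signs centred in its jump set. -/
theorem gammaConverges_limitZero {lam del : ℕ → ℝ} (hlam : ∀ n, 0 < lam n)
    (hlam0 : Tendsto lam atTop (𝓝 0)) (hdel : ∀ n, 0 < del n) (hdel0 : Tendsto del atTop (𝓝 0))
    (hl : Tendsto (fun n => lam n / Real.sqrt (2 * del n)) atTop (𝓝 0)) :
    GammaConverges (fun n => scaledHhf (lam n) (del n)) limitZero := by
  intro z
  refine ⟨fun y hy => le_liminf_of_chainLimit hlam hlam0 hdel hdel0 ?_ hy, ?_⟩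
  · intro φ κ a c _ hφ H
    rw [limitZero, if_pos (H.isBVpm (hl.comp hφ))]
    exact H.limitZero_le (hl.comp hφ)
  · by_cases hz : IsBVpm z
    swap
    · rw [limitZero, if_neg hz]
      exact ⟨fun _ => z, tendsto_const_nhds, le_top⟩
    rw [limitZero, if_pos hz]
    have h83 : (8 / 3 : ℝ≥0∞) = ENNReal.ofReal (8 / 3) := by
      rw [ENNReal.ofReal_div_of_pos (by norm_num)]
      norm_num
    by_cases hfin : (jumpSet z).Finite
    swap
    · refine ⟨fun _ => z, tendsto_const_nhds, ?_⟩
      rw [Set.encard_eq_top_iff.2 hfin, h83, ENat.toENNReal_top, ENNReal.mul_top (by simp)]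
      exact le_top
    obtain ⟨T, hTS, s, hs, hTI, hzT⟩ := exists_ae_eq_prod_sign hfin.toFinset z
      (Lp.aestronglyMeasurable z) hz.1 (by simp)
    obtain ⟨y, hy, hle⟩ := exists_recovery_prod_sign hlam hlam0 hdel hdel0 hl hTI hs hzT
    refine ⟨y, hy, hle.trans ?_⟩
    rw [hfin.encard_eq_coe_toFinset_card, h83, ENNReal.ofReal_mul (by norm_num)]
    have : T.card ≤ hfin.toFinset.card := Finset.card_le_card hTS
    gcongr
    simpa using this


/-! ### Weak derivatives and primitives on the unit interval -/

theorem IsTestFun.continuous {φ : ℝ → ℝ} (h : IsTestFun φ) : Continuous φ := h.1.continuous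

theorem IsTestFun.continuous_deriv {φ : ℝ → ℝ} (h : IsTestFun φ) : Continuous (deriv φ) :=
  h.1.continuous_deriv (by simp)

theorem IsTestFun.eq_zero {φ : ℝ → ℝ} (h : IsTestFun φ) {x : ℝ} (hx : x ∉ Set.Ioo (0 : ℝ) 1) :
    φ x = 0 := image_eq_zero_of_notMem_tsupport fun hx' => hx (h.2.2 hx')

theorem exists_bound_of_continuous {f : ℝ → ℝ} (hf : Continuous f) :
    ∃ B, 0 ≤ B ∧ ∀ x ∈ Set.Icc (0 : ℝ) 1, |f x| ≤ B := by
  obtain ⟨B, hB⟩ := isCompact_Icc.exists_bound_of_continuousOn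
    (hf.continuousOn (s := Set.Icc (0 : ℝ) 1))
  exact ⟨B, (norm_nonneg _).trans (hB 0 (by simp)), hB⟩

theorem integrable_mul_continuous {g f : ℝ → ℝ} (hg : Integrable g muI) (hf : Continuous f) :
    Integrable (fun x => g x * f x) muI := by
  obtain ⟨B, -, hB⟩ := exists_bound_of_continuous hf
  refine hg.mul_bdd (c := B) hf.aestronglyMeasurable ?_
  filter_upwards [ae_mem_Ioo] with x hx
  exact hB x (Set.Ioo_subset_Icc_self hx)

theorem integrable_mul_testFun {g φ : ℝ → ℝ} (hg : LocallyIntegrableOn g (Set.Ioo 0 1))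
    (hφ : IsTestFun φ) : Integrable (fun x => g x * φ x) := by
  have h1 : IntegrableOn g (tsupport φ) := hg.integrableOn_compact_subset hφ.2.2 hφ.2.1
  obtain ⟨B, hB⟩ := hφ.2.1.exists_bound_of_continuous hφ.continuous
  have h2 : IntegrableOn (fun x => g x * φ x) (tsupport φ) :=
    h1.mul_bdd (c := B) hφ.continuous.aestronglyMeasurable (Eventually.of_forall hB)
  refine (integrableOn_iff_integrable_of_support_subset fun x hx => ?_).1 h2
  refine subset_tsupport _ (fun h0 => hx ?_)
  simp [h0]

theorem integral_mul_testFun {g φ : ℝ → ℝ} (hφ : IsTestFun φ) :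
    ∫ x, g x * φ x ∂muI = ∫ x, g x * φ x :=
  setIntegral_eq_integral_of_forall_compl_eq_zero fun x hx => by rw [hφ.eq_zero hx, mul_zero]

theorem ae_eq_zero_of_integral_testFun {f : ℝ → ℝ} (hf : LocallyIntegrableOn f (Set.Ioo 0 1))
    (h : ∀ φ, IsTestFun φ → ∫ x, f x * φ x ∂muI = 0) : ∀ᵐ x ∂muI, f x = 0 := by
  have := isOpen_Ioo.ae_eq_zero_of_integral_contDiff_smul_eq_zero hf fun φ h1 h2 h3 => by
    have := h φ ⟨h1, h2, h3⟩
    rw [integral_mul_testFun ⟨h1, h2, h3⟩] at this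
    rw [← this]
    exact integral_congr_ae (Eventually.of_forall fun x => by simp [mul_comm])
  rw [ae_restrict_iff' measurableSet_Ioo]
  exact this

theorem locallyIntegrableOn_of_integrable {g : ℝ → ℝ} (hg : Integrable g muI) :
    LocallyIntegrableOn g (Set.Ioo 0 1) :=
  IntegrableOn.locallyIntegrableOn hg

theorem IsWeakDeriv.ae_eq {z g g' : ℝ → ℝ} (h : IsWeakDeriv z g) (h' : IsWeakDeriv z g') :
    g =ᵐ[muI] g' := by
  have := ae_eq_zero_of_integral_testFun (h.1.sub h'.1) fun φ hφ => by
    have e1 := h.2 φ hφ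
    have e2 := h'.2 φ hφ
    have i1 := (integrable_mul_testFun h.1 hφ).integrableOn (s := Set.Ioo 0 1)
    have i2 := (integrable_mul_testFun h'.1 hφ).integrableOn (s := Set.Ioo 0 1)
    have := integral_sub i1 i2
    simp only [Pi.sub_apply, sub_mul]
    rw [this]
    linarith
  filter_upwards [this] with x hx
  exact sub_eq_zero.1 hx

theorem integral_muI_eq {f : ℝ → ℝ} : ∫ x, f x ∂muI = ∫ x in (0 : ℝ)..1, f x := by
  rw [intervalIntegral.integral_of_le zero_le_one, muI_eq_Ioc]

theorem exists_Icc_of_testFun {φ : ℝ → ℝ} (hφ : IsTestFun φ) :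
    ∃ α β, 0 < α ∧ β < 1 ∧ ∀ x, φ x ≠ 0 → x ∈ Set.Icc α β := by
  rcases (tsupport φ).eq_empty_or_nonempty with h | h
  -- For empty support the empty interval `[1, 0]` will do.
  · refine ⟨1, 0, one_pos, one_pos, fun x hx => ?_⟩
    have := subset_tsupport φ hx
    rw [h] at this
    exact absurd this (Set.notMem_empty x)
  · obtain ⟨α, hα, hα'⟩ := hφ.2.1.isCompact.exists_isLeast h
    obtain ⟨β, hβ, hβ'⟩ := hφ.2.1.isCompact.exists_isGreatest h
    exact ⟨α, β, (hφ.2.2 hα).1, (hφ.2.2 hβ).2, fun x hx =>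
      ⟨hα' (subset_tsupport φ hx), hβ' (subset_tsupport φ hx)⟩⟩

/-- The mean-zero hypothesis makes the primitive vanish again to the right of the support. -/
theorem exists_primitive_testFun {f : ℝ → ℝ} (hf : IsTestFun f) (h0 : ∫ x, f x ∂muI = 0) :
    ∃ φ, IsTestFun φ ∧ deriv φ = f := by
  have hd : ∀ x, HasDerivAt (fun x => ∫ t in (0 : ℝ)..x, f t) (f x) x := fun x =>
    intervalIntegral.integral_hasDerivAt_right (hf.continuous.intervalIntegrable _ _)
      (hf.continuous.stronglyMeasurableAtFilter _ _) hf.continuous.continuousAt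
  have hderiv : deriv (fun x => ∫ t in (0 : ℝ)..x, f t) = f := funext fun x => (hd x).deriv
  obtain ⟨α, β, hα, hβ, hsupp⟩ := exists_Icc_of_testFun hf
  have hsub : Function.support (fun x => ∫ t in (0 : ℝ)..x, f t) ⊆ Set.Icc α β := by
    intro x hx
    by_contra hxI
    refine hx ?_
    simp only
    rw [Set.mem_Icc, not_and_or, not_le, not_le] at hxI
    rcases hxI with hlt | hgt
    · refine intervalIntegral.integral_zero_ae (Eventually.of_forall fun t ht => ?_)
      by_contra hne
      have h1 := (hsupp t hne).1
      rw [Set.mem_uIoc] at ht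
      rcases ht with ht | ht <;> linarith
    · have h1 : ∫ t in (0 : ℝ)..1, f t = 0 := by
        rw [← integral_muI_eq, h0]
      rw [← intervalIntegral.integral_add_adjacent_intervals
        (hf.continuous.intervalIntegrable 0 1) (hf.continuous.intervalIntegrable 1 x), h1, zero_add]
      refine intervalIntegral.integral_zero_ae (Eventually.of_forall fun t ht => ?_)
      by_contra hne
      have h1 := (hsupp t hne).2
      rw [Set.mem_uIoc] at ht
      rcases ht with ht | ht <;> linarith
  have hts : tsupport (fun x => ∫ t in (0 : ℝ)..x, f t) ⊆ Set.Icc α β :=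
    closure_minimal hsub isClosed_Icc
  refine ⟨_, ⟨?_, HasCompactSupport.of_support_subset_isCompact isCompact_Icc hsub, ?_⟩, hderiv⟩
  · rw [contDiff_infty_iff_deriv]
    exact ⟨fun x => (hd x).differentiableAt, by rw [hderiv]; exact hf.1⟩
  · exact hts.trans fun x hx => ⟨hα.trans_le hx.1, hx.2.trans_lt hβ⟩

theorem exists_testFun_integral_eq_one : ∃ ρ, IsTestFun ρ ∧ ∫ x, ρ x ∂muI = 1 := by
  let b : ContDiffBump (1 / 2 : ℝ) := ⟨1 / 8, 1 / 4, by norm_num, by norm_num⟩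
  have hts : tsupport (b.normed volume) ⊆ Set.Ioo 0 1 := by
    rw [b.tsupport_normed_eq, Real.closedBall_eq_Icc]
    intro x hx
    have h1 : (1 / 2 : ℝ) - 1 / 4 ≤ x := hx.1
    have h2 : x ≤ (1 / 2 : ℝ) + 1 / 4 := hx.2
    exact ⟨by linarith, by linarith⟩
  refine ⟨b.normed volume, ⟨b.contDiff_normed, b.hasCompactSupport_normed, hts⟩, ?_⟩
  refine Eq.trans ?_ (b.integral_normed (μ := volume))
  exact setIntegral_eq_integral_of_forall_compl_eq_zero fun x hx =>
    image_eq_zero_of_notMem_tsupport fun h => hx (hts h)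

/-- The lemma of du Bois-Reymond. -/
theorem ae_const_of_integral_deriv {v : ℝ → ℝ} (hv : Integrable v muI)
    (h : ∀ φ, IsTestFun φ → ∫ x, v x * deriv φ x ∂muI = 0) : ∃ C, ∀ᵐ x ∂muI, v x = C := by
  obtain ⟨ρ, hρ, hρ1⟩ := exists_testFun_integral_eq_one
  refine ⟨∫ x, v x * ρ x ∂muI, ?_⟩
  set C := ∫ x, v x * ρ x ∂muI with hC
  have := ae_eq_zero_of_integral_testFun (f := fun x => v x - C)
    (locallyIntegrableOn_of_integrable (hv.sub (integrable_const C))) fun ψ hψ => by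
    have hiψ : Integrable ψ muI := by
      simpa using integrable_mul_continuous (integrable_const (1 : ℝ)) hψ.continuous
    have hiρ : Integrable ρ muI := by
      simpa using integrable_mul_continuous (integrable_const (1 : ℝ)) hρ.continuous
    set m := ∫ x, ψ x ∂muI with hm
    -- Subtracting `m ρ` gives mean zero, so this function is the derivative of a test function.
    have htest : IsTestFun fun x => ψ x - m * ρ x := by
      refine ⟨hψ.1.sub (contDiff_const.mul hρ.1), hψ.2.1.sub hρ.2.1.mul_left, ?_⟩
      refine (tsupport_sub _ _).trans (Set.union_subset hψ.2.2 ?_)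
      exact (tsupport_mul_subset_right (f := fun _ => m)).trans hρ.2.2
    obtain ⟨φ, hφ, hφd⟩ := exists_primitive_testFun htest (by
      rw [integral_sub hiψ (hiρ.const_mul m), integral_const_mul, hρ1, mul_one, sub_self])
    have h1 := h φ hφ
    rw [hφd] at h1
    have i1 := integrable_mul_continuous hv hψ.continuous
    have i2 := integrable_mul_continuous hv hρ.continuous
    have h2 : ∫ x, v x * (ψ x - m * ρ x) ∂muI = (∫ x, v x * ψ x ∂muI) - m * C := by
      rw [hC, ← integral_const_mul, ← integral_sub i1 (i2.const_mul m)]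
      congr 1
      funext x
      ring
    have h3 : ∫ x, (v x - C) * ψ x ∂muI = (∫ x, v x * ψ x ∂muI) - C * m := by
      rw [hm, ← integral_const_mul, ← integral_sub i1 (hiψ.const_mul C)]
      congr 1
      funext x
      ring
    rw [h3]
    linarith
  filter_upwards [this] with x hx
  linarith

theorem intervalIntegrable_of_integrable {g : ℝ → ℝ} (hg : Integrable g muI) :
    IntervalIntegrable g volume 0 1 := by
  rw [intervalIntegrable_iff, Set.uIoc_of_le zero_le_one]
  exact hg.mono_measure (le_of_eq muI_eq_Ioc.symm)

theorem intervalIntegrable_of_integrable' {g : ℝ → ℝ} (hg : Integrable g muI) {x y : ℝ}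
    (hx : x ∈ Set.Icc (0 : ℝ) 1) (hy : y ∈ Set.Icc (0 : ℝ) 1) : IntervalIntegrable g volume x y :=
  (intervalIntegrable_of_integrable hg).mono_set
    (Set.uIcc_subset_uIcc (by rwa [Set.uIcc_of_le zero_le_one])
      (by rwa [Set.uIcc_of_le zero_le_one]))

theorem continuousOn_primitive {g : ℝ → ℝ} (hg : Integrable g muI) :
    ContinuousOn (fun x => ∫ t in (0 : ℝ)..x, g t) (Set.Icc 0 1) := by
  have := ((intervalIntegrable_of_integrable hg).absolutelyContinuousOnInterval_intervalIntegral
    (c := 0) (by simp)).continuousOn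
  rwa [Set.uIcc_of_le zero_le_one] at this

theorem integral_primitive_mul_deriv {g φ : ℝ → ℝ} (hg : Integrable g muI) (hφ : IsTestFun φ) :
    ∫ x, (∫ t in (0 : ℝ)..x, g t) * deriv φ x ∂muI = -∫ x, g x * φ x ∂muI := by
  have hII := intervalIntegrable_of_integrable hg
  have hG := hII.absolutelyContinuousOnInterval_intervalIntegral (c := 0) (by simp)
  have hφac : AbsolutelyContinuousOnInterval φ 0 1 :=
    ((hφ.1.of_le (by simp) : ContDiff ℝ 1 φ).contDiffOn).absolutelyContinuousOnInterval
  have := hG.integral_mul_deriv_eq_deriv_mul hφac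
  rw [integral_muI_eq, this, hφ.eq_zero (by simp), hφ.eq_zero (by simp), integral_muI_eq]
  simp only [mul_zero, sub_self, zero_sub, neg_inj]
  refine intervalIntegral.integral_congr_ae ?_
  filter_upwards [hII.ae_hasDerivAt_integral] with x hx hxI
  rw [(hx (Set.uIoc_subset_uIcc hxI) 0 (by simp)).deriv]

/-- The difference between `z` and the primitive of `g` has zero weak derivative; the lemma of du
Bois-Reymond applies. -/
theorem IsWeakDeriv.exists_ae_eq_primitive {z g : ℝ → ℝ} (h : IsWeakDeriv z g)
    (hz : Integrable z muI) (hg : Integrable g muI) :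
    ∃ C, ∀ᵐ x ∂muI, z x = C + ∫ t in (0 : ℝ)..x, g t := by
  have hGi : Integrable (fun x => ∫ t in (0 : ℝ)..x, g t) muI :=
    ((continuousOn_primitive hg).integrableOn_Icc).mono_set Set.Ioo_subset_Icc_self
  obtain ⟨C, hC⟩ := ae_const_of_integral_deriv (hz.sub hGi) fun φ hφ => by
    have h1 := integral_primitive_mul_deriv hg hφ
    have h2 := h.2 φ hφ
    have i1 := integrable_mul_continuous hz hφ.continuous_deriv
    have i2 := integrable_mul_continuous hGi hφ.continuous_deriv
    simp only [Pi.sub_apply, sub_mul]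
    rw [integral_sub i1 i2, h1, h2, sub_self]
  refine ⟨C, ?_⟩
  filter_upwards [hC] with x hx
  rw [Pi.sub_apply] at hx
  linarith

/-- Expand `∫ (g - m)² ≥ 0` with `m` the mean of `g`. -/
theorem sq_intervalIntegral_le {g : ℝ → ℝ} {x y : ℝ} (hxy : x ≤ y)
    (hg : IntervalIntegrable g volume x y)
    (hg2 : IntervalIntegrable (fun t => g t ^ 2) volume x y) :
    (∫ t in x..y, g t) ^ 2 ≤ (y - x) * ∫ t in x..y, g t ^ 2 := by
  rcases hxy.eq_or_lt with rfl | hlt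
  · simp
  set m := (∫ t in x..y, g t) / (y - x) with hm
  have hne : y - x ≠ 0 := by linarith
  have h0 : 0 ≤ ∫ t in x..y, (g t - m) ^ 2 :=
    intervalIntegral.integral_nonneg hxy fun t _ => sq_nonneg _
  have e : ∫ t in x..y, (g t - m) ^ 2 =
      (∫ t in x..y, g t ^ 2) - 2 * m * (∫ t in x..y, g t) + m ^ 2 * (y - x) := by
    have e1 : ∀ t, (g t - m) ^ 2 = g t ^ 2 - 2 * m * g t + m ^ 2 := fun t => by ring
    simp only [e1]
    rw [intervalIntegral.integral_add (hg2.sub (hg.const_mul _)) intervalIntegrable_const,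
      intervalIntegral.integral_sub hg2 (hg.const_mul _), intervalIntegral.integral_const_mul,
      intervalIntegral.integral_const, smul_eq_mul]
    ring
  rw [e] at h0
  have hI : ∫ t in x..y, g t = m * (y - x) := by rw [hm]; field_simp
  rw [hI] at h0 ⊢
  nlinarith


theorem isWeakDeriv_weakDeriv {z g : ℝ → ℝ} (h : IsWeakDeriv z g) :
    IsWeakDeriv z (weakDeriv z) := by
  have hex : ∃ g, IsWeakDeriv z g := ⟨g, h⟩
  rw [weakDeriv, dif_pos hex]
  exact hex.choose_spec

theorem IsWeakDeriv.weakDeriv_ae_eq {z g : ℝ → ℝ} (h : IsWeakDeriv z g) :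
    weakDeriv z =ᵐ[muI] g :=
  (isWeakDeriv_weakDeriv h).ae_eq h

/-! ### Weak compactness in `L²(I)` -/

theorem inner_toLp_eq {f g : ℝ → ℝ} (hf : MemLp f 2 muI) (hg : MemLp g 2 muI) :
    inner ℝ (hf.toLp f) (hg.toLp g) = ∫ x, f x * g x ∂muI := by
  rw [L2.inner_def]
  refine integral_congr_ae ?_
  filter_upwards [hf.coeFn_toLp, hg.coeFn_toLp] with x h1 h2
  rw [h1, h2]
  simp [mul_comm]

/-- Weak sequential compactness of bounded sequences in `L²(I)`. -/
theorem exists_weak_limit {G : ℕ → ℝ → ℝ} (hG : ∀ n, MemLp (G n) 2 muI) {Q : ℝ}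
    (hQ : Tendsto (fun n => ∫ x, G n x ^ 2 ∂muI) atTop (𝓝 Q)) :
    ∃ g : ℝ → ℝ, MemLp g 2 muI ∧ ∫ x, g x ^ 2 ∂muI ≤ Q ∧ ∃ φ : ℕ → ℕ, StrictMono φ ∧
      ∀ f, MemLp f 2 muI →
        Tendsto (fun n => ∫ x, G (φ n) x * f x ∂muI) atTop (𝓝 (∫ x, g x * f x ∂muI)) := by
  have hnorm : ∀ n, ‖(hG n).toLp (G n)‖ ^ 2 = ∫ x, G n x ^ 2 ∂muI := fun n => by
    rw [← real_inner_self_eq_norm_sq, inner_toLp_eq]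
    simp only [sq]
  obtain ⟨R, hR⟩ := hQ.bddAbove_range
  -- Through the Riesz isometry the sequence lies in a ball of the dual, which is weak-*
  -- sequentially compact.
  let D : ℕ → WeakDual ℝ (Lp ℝ 2 muI) := fun n =>
    StrongDual.toWeakDual (InnerProductSpace.toDual ℝ (Lp ℝ 2 muI) ((hG n).toLp (G n)))
  have hD : ∀ n, D n ∈ WeakDual.toStrongDual ⁻¹'
      Metric.closedBall (0 : StrongDual ℝ (Lp ℝ 2 muI)) (Real.sqrt R) := fun n => by
    simp only [Set.mem_preimage, mem_closedBall_zero_iff]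
    have : ‖InnerProductSpace.toDual ℝ (Lp ℝ 2 muI) ((hG n).toLp (G n))‖ ≤ Real.sqrt R := by
      rw [LinearIsometryEquiv.norm_map]
      refine Real.le_sqrt_of_sq_le ?_
      rw [hnorm]
      exact hR ⟨n, rfl⟩
    exact this
  have : Fact ((2 : ℝ≥0∞) ≠ ⊤) := ⟨by simp⟩
  obtain ⟨T, -, φ, hφ, hT⟩ := WeakDual.isSeqCompact_closedBall ℝ (Lp ℝ 2 muI) 0 (Real.sqrt R) hD
  set g := (InnerProductSpace.toDual ℝ (Lp ℝ 2 muI)).symm (WeakDual.toStrongDual T) with hg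
  have hconv : ∀ f : Lp ℝ 2 muI,
      Tendsto (fun n => inner ℝ ((hG (φ n)).toLp (G (φ n))) f) atTop (𝓝 (inner ℝ g f)) := by
    intro f
    have h1 := (WeakDual.eval_continuous f).continuousAt.tendsto.comp hT
    have h2 : inner ℝ g f = T f := by
      rw [hg, InnerProductSpace.toDual_symm_apply]
      rfl
    rw [h2]
    exact h1
  refine ⟨g, Lp.memLp g, ?_, φ, hφ, fun f hf => ?_⟩
  · have h1 : ∫ x, g x ^ 2 ∂muI = inner ℝ g g := by
      have := inner_toLp_eq (Lp.memLp g) (Lp.memLp g)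
      simp only [Lp.toLp_coeFn] at this
      rw [this]
      simp only [sq]
    -- Lower semicontinuity of the norm: pass to the limit in `2 ⟨G, g⟩ ≤ ‖G‖² + ‖g‖²`.
    have h2 := (hconv g).const_mul 2
    have h3 := (hQ.comp hφ.tendsto_atTop).add_const (inner ℝ g g)
    have h4 := le_of_tendsto_of_tendsto' h2 h3 fun n => by
      simp only [Function.comp]
      rw [← hnorm, real_inner_self_eq_norm_sq]
      have := real_inner_le_norm ((hG (φ n)).toLp (G (φ n))) g
      nlinarith [sq_nonneg (‖(hG (φ n)).toLp (G (φ n))‖ - ‖g‖)]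
    rw [h1]
    linarith
  · have h1 := hconv (hf.toLp f)
    have h2 := inner_toLp_eq (Lp.memLp g) hf
    simp only [Lp.toLp_coeFn] at h2
    rw [h2] at h1
    refine h1.congr fun n => inner_toLp_eq (hG (φ n)) hf

theorem lintegral_ofReal_sq {g : ℝ → ℝ} (hg : MemLp g 2 muI) :
    ∫⁻ x, ENNReal.ofReal (g x ^ 2) ∂muI = ENNReal.ofReal (∫ x, g x ^ 2 ∂muI) :=
  (ofReal_integral_eq_lintegral_ofReal hg.integrable_sq
    (Eventually.of_forall fun _ => sq_nonneg _)).symm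

theorem exists_mem_Ioo_of_ae {p : ℝ → Prop} (hp : ∀ᵐ x ∂muI, p x) {α β : ℝ} (hα : 0 ≤ α)
    (hαβ : α < β) (hβ : β ≤ 1) : ∃ x ∈ Set.Ioo α β, p x := by
  by_contra! hcon
  have h1 : ∀ᵐ x ∂muI, x ∉ Set.Ioo α β := by
    filter_upwards [hp] with x hx hxI using hcon x hxI hx
  rw [ae_iff] at h1
  simp only [not_not] at h1
  have h2 : muI (Set.Ioo α β) = 0 := h1
  rw [Measure.restrict_apply measurableSet_Ioo,
    Set.inter_eq_left.2 (Set.Ioo_subset_Ioo hα hβ), Real.volume_Ioo] at h2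
  simp only [ENNReal.ofReal_eq_zero] at h2
  linarith

/-! ### The case `0 < l < ∞`: lower bound -/

namespace ChainLimit

variable {lam h κ : ℕ → ℝ} {c l : ℝ} {a : ℕ → ℕ → ℝ} {z : ℝ → ℝ}

/-- The discrete Dirichlet energy. -/
noncomputable def dirichlet (lam : ℝ) (a : ℕ → ℝ) : ℝ :=
  (∑ i ∈ Finset.range (numCells lam - 1), (a (i + 1) - a i) ^ 2) / lam

/-- The discrete potential energy. -/
noncomputable def potential (lam : ℝ) (a : ℕ → ℝ) : ℝ :=
  ∑ i ∈ Finset.range (numCells lam - 1), lam * ((a i ^ 2 + a (i + 1) ^ 2) / 2 - 1) ^ 2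

theorem dirichlet_nonneg (H : ChainLimit lam h κ c a z) (n : ℕ) : 0 ≤ dirichlet (lam n) (a n) :=
  div_nonneg (Finset.sum_nonneg fun _ _ => sq_nonneg _) (H.lam_pos n).le

theorem sq_sub_le (H : ChainLimit lam h κ c a z) (n : ℕ) {i j : ℕ} (hij : i ≤ j)
    (hj : j ≤ numCells (lam n) - 1) :
    (a n j - a n i) ^ 2 ≤ (lam n * (j - i)) * dirichlet (lam n) (a n) := by
  refine (sq_sub_le_mul_sum (a n) hij hj).trans (le_of_eq ?_)
  have := (H.lam_pos n).ne'
  unfold dirichlet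
  field_simp

theorem abs_sub_floor_le (H : ChainLimit lam h κ c a z) (n : ℕ) {i j : ℕ}
    (hi : i ≤ numCells (lam n) - 1) (hj : j ≤ numCells (lam n) - 1) :
    |a n j - a n i| ≤ Real.sqrt (dirichlet (lam n) (a n)) := by
  wlog hij : i ≤ j generalizing i j
  · rw [abs_sub_comm]
    exact this hj hi (not_le.1 hij).le
  refine Real.abs_le_sqrt ((H.sq_sub_le n hij hj).trans ?_)
  refine mul_le_of_le_one_left (H.dirichlet_nonneg n) ?_
  have h1 := mul_numCells_le (H.lam_pos n)
  have h2 : (j : ℝ) ≤ numCells (lam n) := by exact_mod_cast hj.trans (Nat.sub_le _ _)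
  have h3 : (0 : ℝ) ≤ i := Nat.cast_nonneg i
  have := H.lam_pos n
  nlinarith

/-- The Dirichlet energy bounds the oscillation of the chain, and the values converge at some point.
-/
theorem exists_bound (H : ChainLimit lam h κ c a z) {Q : ℝ}
    (hQ : Tendsto (fun n => dirichlet (lam n) (a n)) atTop (𝓝 Q)) :
    ∃ B, ∀ᶠ n in atTop, ∀ i < numCells (lam n), |a n i| ≤ B := by
  obtain ⟨x, hx, hxI⟩ := (H.lim.and ae_mem_Ioo).exists
  have h1 : Tendsto (fun n => |a n ⌊x / lam n⌋₊| + Real.sqrt (dirichlet (lam n) (a n))) atTop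
      (𝓝 (|z x| + Real.sqrt Q)) := hx.abs.add ((Real.continuous_sqrt.tendsto _).comp hQ)
  refine ⟨|z x| + Real.sqrt Q + 1, ?_⟩
  filter_upwards [h1.eventually (gt_mem_nhds (lt_add_one _)),
    eventually_floor_add_lt H.lam_pos H.lam_lim hxI.1.le hxI.2 0] with n hn1 hn2 i hi
  have := H.abs_sub_floor_le n (i := ⌊x / lam n⌋₊) (j := i) (by omega) (by omega)
  have h2 := abs_sub_abs_le_abs_sub (a n i) (a n ⌊x / lam n⌋₊)
  linarith

/-- The boundary terms of the summation by parts disappear because `φ 0 = 0` and `φ (λ N) → φ 1 =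
0`. -/
theorem tendsto_integral_mul_deriv (H : ChainLimit lam h κ c a z) {B : ℝ}
    (hB : ∀ᶠ n in atTop, ∀ i < numCells (lam n), |a n i| ≤ B) {φ : ℝ → ℝ} (hφ : IsTestFun φ) :
    Tendsto (fun n => -∑ i ∈ Finset.range (numCells (lam n) - 1),
      (a n (i + 1) - a n i) * φ (lam n * (i + 1))) atTop (𝓝 (∫ x, z x * deriv φ x ∂muI)) := by
  have hlim : Tendsto (fun n => ∫ x, (if ⌊x / lam n⌋₊ < numCells (lam n) then
      a n ⌊x / lam n⌋₊ else 0) * deriv φ x ∂muI) atTop (𝓝 (∫ x, z x * deriv φ x ∂muI)) := by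
    refine tendsto_integral_filter_of_dominated_convergence (fun x => |B| * |deriv φ x|)
      (Eventually.of_forall fun n => ?_) ?_ ?_ ?_
    · exact ((measurable_comp_floor (lam n) (fun i => if i < numCells (lam n) then a n i
        else 0)).mul hφ.continuous_deriv.measurable).aestronglyMeasurable
    · filter_upwards [hB] with n hn
      refine Eventually.of_forall fun x => ?_
      rw [norm_mul, Real.norm_eq_abs, Real.norm_eq_abs]
      refine mul_le_mul_of_nonneg_right ?_ (abs_nonneg _)
      split_ifs with hlt
      · exact (hn _ hlt).trans (le_abs_self _)
      · simp
    · exact ((hφ.continuous_deriv.abs.const_mul |B| : Continuous _).integrableOn_Icc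
        (a := 0) (b := 1)).mono_set Set.Ioo_subset_Icc_self
    · filter_upwards [H.lim, ae_mem_Ioo] with x hx hxI
      refine Tendsto.mul_const _ (hx.congr' ?_)
      filter_upwards [eventually_floor_add_lt H.lam_pos H.lam_lim hxI.1.le hxI.2 0] with n hn
      rw [if_pos (by simpa using hn)]
  have hend : Tendsto (fun n => a n (numCells (lam n) - 1) * φ (lam n * numCells (lam n))) atTop
      (𝓝 0) := by
    have h1 : Tendsto (fun n => φ (lam n * numCells (lam n))) atTop (𝓝 0) := by
      have := (hφ.continuous.tendsto 1).comp (tendsto_mul_numCells H.lam_pos H.lam_lim)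
      rwa [hφ.eq_zero (by simp)] at this
    refine squeeze_zero_norm' ?_ (by simpa using h1.abs.const_mul B)
    filter_upwards [hB] with n hn
    rw [norm_mul, Real.norm_eq_abs, Real.norm_eq_abs]
    have := H.two_le n
    exact mul_le_mul_of_nonneg_right (hn _ (by omega)) (abs_nonneg _)
  have := hlim.sub hend
  rw [sub_zero] at this
  refine this.congr fun n => ?_
  rw [integral_comp_floor_mul_deriv (H.lam_pos n) (one_le_two.trans (H.two_le n))
    (mul_numCells_le (H.lam_pos n)) (a n) hφ.1, hφ.eq_zero (x := 0) (by simp)]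
  ring

/-- The difference quotient as a function on `I`. -/
noncomputable def diffQuot (lam : ℝ) (a : ℕ → ℝ) (i : ℕ) : ℝ :=
  if i < numCells lam - 1 then (a (i + 1) - a i) / lam else 0

theorem pred_mul_le (H : ChainLimit lam h κ c a z) (n : ℕ) :
    lam n * (numCells (lam n) - 1 : ℕ) ≤ 1 :=
  (mul_le_mul_of_nonneg_left (by exact_mod_cast Nat.sub_le _ _) (H.lam_pos n).le).trans
    (mul_numCells_le (H.lam_pos n))

theorem integral_diffQuot_sq (H : ChainLimit lam h κ c a z) (n : ℕ) :
    ∫ x, diffQuot (lam n) (a n) ⌊x / lam n⌋₊ ^ 2 ∂muI = dirichlet (lam n) (a n) := by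
  rw [integral_comp_floor (H.lam_pos n) (N := numCells (lam n) - 1) (H.pred_mul_le n)
    (fun i => diffQuot (lam n) (a n) i ^ 2) fun i hi => by simp [diffQuot, not_lt.2 hi],
    dirichlet, Finset.sum_div]
  refine Finset.sum_congr rfl fun i hi => ?_
  have := (H.lam_pos n).ne'
  rw [diffQuot, if_pos (Finset.mem_range.1 hi)]
  field_simp

theorem memLp_diffQuot (lam : ℝ) (a : ℕ → ℝ) :
    MemLp (fun x => diffQuot (lam) (a) ⌊x / lam⌋₊) 2 muI := by
  refine MemLp.of_bound (measurable_comp_floor _ _).aestronglyMeasurable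
    (∑ i ∈ Finset.range (numCells (lam) - 1), |diffQuot (lam) (a) i|)
    (Eventually.of_forall fun x => ?_)
  by_cases hlt : ⌊x / lam⌋₊ < numCells (lam) - 1
  · exact Finset.single_le_sum (f := fun i => |diffQuot (lam) (a) i|)
      (fun _ _ => abs_nonneg _) (Finset.mem_range.2 hlt)
  · rw [diffQuot, if_neg hlt, norm_zero]
    exact Finset.sum_nonneg fun _ _ => abs_nonneg _

/-- Replacing `φ` at the right end of a cell by its cell mean costs at most `L λ |D| ≤ L (D² + λ²)`,
in total `L λ` times a bounded quantity. -/
theorem tendsto_integral_diffQuot_mul_sub (H : ChainLimit lam h κ c a z) {Q : ℝ}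
    (hQ : Tendsto (fun n => dirichlet (lam n) (a n)) atTop (𝓝 Q)) {φ : ℝ → ℝ} (hφ : IsTestFun φ) :
    Tendsto (fun n => (∑ i ∈ Finset.range (numCells (lam n) - 1),
      (a n (i + 1) - a n i) * φ (lam n * (i + 1))) -
        ∫ x, diffQuot (lam n) (a n) ⌊x / lam n⌋₊ * φ x ∂muI) atTop (𝓝 0) := by
  obtain ⟨L, hL⟩ := hφ.1.lipschitzWith_of_hasCompactSupport hφ.2.1 (by simp)
  have h0 : Tendsto (fun n => (L : ℝ) * (lam n * (dirichlet (lam n) (a n) + 1))) atTop (𝓝 0) := by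
    simpa using (H.lam_lim.mul (hQ.add_const 1)).const_mul (L : ℝ)
  refine squeeze_zero_norm (fun n => ?_) h0
  have hlam := H.lam_pos n
  rw [integral_comp_floor_mul hlam (N := numCells (lam n) - 1) (H.pred_mul_le n)
    (diffQuot (lam n) (a n)) (fun i hi => by simp [diffQuot, not_lt.2 hi]) hφ.continuous,
    ← Finset.sum_sub_distrib]
  have hterm : ∀ i ∈ Finset.range (numCells (lam n) - 1),
      ‖(a n (i + 1) - a n i) * φ (lam n * (i + 1)) -
        diffQuot (lam n) (a n) i * ∫ x in (lam n * i)..(lam n * (i + 1)), φ x‖ ≤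
      (L : ℝ) * ((a n (i + 1) - a n i) ^ 2 + lam n ^ 2) := by
    intro i hi
    have hle : lam n * i ≤ lam n * (i + 1) := by nlinarith
    have e : (a n (i + 1) - a n i) * φ (lam n * (i + 1)) -
        diffQuot (lam n) (a n) i * ∫ x in (lam n * i)..(lam n * (i + 1)), φ x =
        (a n (i + 1) - a n i) / lam n *
          ∫ x in (lam n * i)..(lam n * (i + 1)), (φ (lam n * (i + 1)) - φ x) := by
      rw [intervalIntegral.integral_sub intervalIntegrable_const
        (hφ.continuous.intervalIntegrable _ _), intervalIntegral.integral_const, smul_eq_mul,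
        diffQuot, if_pos (Finset.mem_range.1 hi)]
      field_simp
      ring
    have hb := intervalIntegral.norm_integral_le_of_norm_le_const (a := lam n * i)
      (b := lam n * (i + 1)) (f := fun x => φ (lam n * (i + 1)) - φ x) (C := L * lam n)
      fun x hx => by
        rw [Set.uIoc_of_le hle] at hx
        have := hL.dist_le_mul (lam n * (i + 1)) x
        rw [Real.dist_eq, Real.dist_eq,
            abs_of_nonneg (show 0 ≤ lam n * ((i : ℝ) + 1) - x by linarith [hx.2])] at this
        refine this.trans (mul_le_mul_of_nonneg_left ?_ L.2)
        linarith [hx.1]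
    rw [show lam n * ((i : ℝ) + 1) - lam n * i = lam n by ring, abs_of_pos hlam] at hb
    rw [e, norm_mul, norm_div, Real.norm_eq_abs, Real.norm_eq_abs, abs_of_pos hlam]
    calc _ ≤ |a n (i + 1) - a n i| / lam n * (L * lam n * lam n) := by gcongr
      _ = L * (|a n (i + 1) - a n i| * lam n) := by field_simp
      _ ≤ _ := by
        refine mul_le_mul_of_nonneg_left ?_ L.2
        rw [← sq_abs (a n (i + 1) - a n i)]
        nlinarith [sq_nonneg (|a n (i + 1) - a n i| - lam n), sq_nonneg (a n (i + 1) - a n i),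
          sq_nonneg (lam n), sq_abs (a n (i + 1) - a n i)]
  refine (norm_sum_le _ _).trans ((Finset.sum_le_sum hterm).trans ?_)
  rw [← Finset.mul_sum, Finset.sum_add_distrib]
  refine mul_le_mul_of_nonneg_left ?_ L.2
  rw [Finset.sum_const, Finset.card_range, nsmul_eq_mul, mul_add, mul_one]
  have h1 : lam n * dirichlet (lam n) (a n) =
      ∑ i ∈ Finset.range (numCells (lam n) - 1), (a n (i + 1) - a n i) ^ 2 := by
    rw [dirichlet]; field_simp
  rw [h1]
  have h2 := H.pred_mul_le n
  nlinarith

/-- A weak `L²` limit of the difference quotients is the weak derivative, by summation by parts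
against test functions. -/
theorem exists_weakDeriv (H : ChainLimit lam h κ c a z) {Q : ℝ}
    (hQ : Tendsto (fun n => dirichlet (lam n) (a n)) atTop (𝓝 Q)) :
    ∃ g, MemLp g 2 muI ∧ ∫ x, g x ^ 2 ∂muI ≤ Q ∧ IsWeakDeriv z g := by
  obtain ⟨B, hB⟩ := H.exists_bound hQ
  obtain ⟨g, hg, hgQ, ψ, hψ, hconv⟩ := exists_weak_limit (fun n => memLp_diffQuot (lam n) (a n)) (Q := Q)
    (hQ.congr fun n => (H.integral_diffQuot_sq n).symm)
  refine ⟨g, hg, hgQ, locallyIntegrableOn_of_integrable (hg.integrable one_le_two),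
    fun φ hφ => ?_⟩
  have hφ2 : MemLp φ 2 muI := by
    obtain ⟨C, hC⟩ := hφ.2.1.exists_bound_of_continuous hφ.continuous
    exact MemLp.of_bound hφ.continuous.aestronglyMeasurable C (Eventually.of_forall hC)
  have h1 := (H.tendsto_integral_mul_deriv hB hφ).comp hψ.tendsto_atTop
  have h2 := (H.tendsto_integral_diffQuot_mul_sub hQ hφ).comp hψ.tendsto_atTop
  have h3 := hconv φ hφ2
  have h4 := (h1.add h2).add h3
  have h5 : ∫ x, z x * deriv φ x ∂muI + 0 + ∫ x, g x * φ x ∂muI = 0 := by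
    refine tendsto_nhds_unique h4 ?_
    refine tendsto_const_nhds.congr fun n => ?_
    simp only [Function.comp]
    ring
  linarith

/-- Go from `x` to the left end and from `y` to the right end by the Hölder estimate; the chain has
equal moduli at its two ends. -/
theorem abs_abs_sub_abs_le (H : ChainLimit lam h κ c a z) {Q : ℝ}
    (hQ : Tendsto (fun n => dirichlet (lam n) (a n)) atTop (𝓝 Q)) {x y : ℝ}
    (hx : x ∈ Set.Ioo (0 : ℝ) 1) (hy : y ∈ Set.Ioo (0 : ℝ) 1)
    (hzx : Tendsto (fun n => a n ⌊x / lam n⌋₊) atTop (𝓝 (z x)))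
    (hzy : Tendsto (fun n => a n ⌊y / lam n⌋₊) atTop (𝓝 (z y))) :
    |(|z x| - |z y|)| ≤ Real.sqrt (x * Q) + Real.sqrt ((1 - y) * Q) := by
  have h1 : Tendsto (fun n => Real.sqrt (x * dirichlet (lam n) (a n)) +
      Real.sqrt ((1 - y) * dirichlet (lam n) (a n))) atTop
      (𝓝 (Real.sqrt (x * Q) + Real.sqrt ((1 - y) * Q))) :=
    ((Real.continuous_sqrt.tendsto _).comp (hQ.const_mul x)).add
      ((Real.continuous_sqrt.tendsto _).comp (hQ.const_mul (1 - y)))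
  refine le_of_tendsto_of_tendsto (hzx.abs.sub hzy.abs).abs h1 ?_
  filter_upwards [eventually_floor_add_lt H.lam_pos H.lam_lim hx.1.le hx.2 0,
    eventually_floor_add_lt H.lam_pos H.lam_lim hy.1.le hy.2 0] with n hnx hny
  have hlam := H.lam_pos n
  have hD := H.dirichlet_nonneg n
  have e1 : |a n ⌊x / lam n⌋₊ - a n 0| ≤ Real.sqrt (x * dirichlet (lam n) (a n)) := by
    refine Real.abs_le_sqrt ((H.sq_sub_le n (Nat.zero_le _) (by omega)).trans ?_)
    refine mul_le_mul_of_nonneg_right ?_ hD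
    simpa using mul_floor_le hlam hx.1.le
  have e2 : |a n (numCells (lam n) - 1) - a n ⌊y / lam n⌋₊| ≤
      Real.sqrt ((1 - y) * dirichlet (lam n) (a n)) := by
    refine Real.abs_le_sqrt ((H.sq_sub_le n (by omega) le_rfl).trans ?_)
    refine mul_le_mul_of_nonneg_right ?_ hD
    have h2 := lt_mul_floor hlam hy.1.le
    have h3 := mul_numCells_le hlam
    rw [Nat.cast_sub (one_le_two.trans (H.two_le n))]
    push_cast
    nlinarith
  have e3 := abs_abs_sub_abs_le_abs_sub (a n ⌊x / lam n⌋₊) (a n 0)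
  have e4 := abs_abs_sub_abs_le_abs_sub (a n (numCells (lam n) - 1)) (a n ⌊y / lam n⌋₊)
  rw [← H.periodic n] at e4
  calc _ = |(|a n ⌊x / lam n⌋₊| - |a n 0|) + (|a n 0| - |a n ⌊y / lam n⌋₊|)| := by ring_nf
    _ ≤ _ := (abs_add_le _ _).trans (add_le_add (e3.trans e1) (e4.trans e2))

theorem abs_endpoints_eq (H : ChainLimit lam h κ c a z) {Q : ℝ}
    (hQ : Tendsto (fun n => dirichlet (lam n) (a n)) atTop (𝓝 Q)) {w : ℝ → ℝ}
    (hw : ContinuousOn w (Set.Icc 0 1)) (hzw : z =ᵐ[muI] w) : |w 0| = |w 1| := by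
  have hgood := H.lim.and hzw
  have hε : ∀ k : ℕ, (1 : ℝ) / (k + 1) ≤ 1 := fun k => by
    rw [div_le_one (by positivity)]
    linarith [(Nat.cast_nonneg k : (0 : ℝ) ≤ k)]
  have hε0 : ∀ k : ℕ, (0 : ℝ) < 1 / (k + 1) := fun k => Nat.one_div_pos_of_nat
  have hx := fun k : ℕ => exists_mem_Ioo_of_ae hgood le_rfl (hε0 k) (hε k)
  have hy := fun k : ℕ => exists_mem_Ioo_of_ae hgood (sub_nonneg.2 (hε k))
    (sub_lt_self 1 (hε0 k)) le_rfl
  choose x hxI hxg using hx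
  choose y hyI hyg using hy
  have hx1 : ∀ k, x k ∈ Set.Ioo (0 : ℝ) 1 := fun k => ⟨(hxI k).1, (hxI k).2.trans_le (hε k)⟩
  have hy1 : ∀ k, y k ∈ Set.Ioo (0 : ℝ) 1 := fun k =>
    ⟨(sub_nonneg.2 (hε k)).trans_lt (hyI k).1, (hyI k).2⟩
  have hlim0 : Tendsto (fun k : ℕ => (1 : ℝ) / (k + 1)) atTop (𝓝 0) :=
    tendsto_one_div_add_atTop_nhds_zero_nat
  have hxlim : Tendsto x atTop (𝓝 0) :=
    squeeze_zero (fun k => (hxI k).1.le) (fun k => (hxI k).2.le) hlim0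
  have hylim : Tendsto y atTop (𝓝 1) :=
    tendsto_of_tendsto_of_tendsto_of_le_of_le (by simpa using hlim0.const_sub 1)
      tendsto_const_nhds (fun k => (hyI k).1.le) fun k => (hyI k).2.le
  have hwx : Tendsto (fun k => w (x k)) atTop (𝓝 (w 0)) :=
    (hw 0 (by simp)).tendsto.comp (tendsto_nhdsWithin_iff.2
      ⟨hxlim, Eventually.of_forall fun k => Set.Ioo_subset_Icc_self (hx1 k)⟩)
  have hwy : Tendsto (fun k => w (y k)) atTop (𝓝 (w 1)) :=
    (hw 1 (by simp)).tendsto.comp (tendsto_nhdsWithin_iff.2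
      ⟨hylim, Eventually.of_forall fun k => Set.Ioo_subset_Icc_self (hy1 k)⟩)
  have hR : Tendsto (fun k => Real.sqrt (x k * Q) + Real.sqrt ((1 - y k) * Q)) atTop (𝓝 0) := by
    have h1 := (Real.continuous_sqrt.tendsto' 0 0 Real.sqrt_zero).comp
      (show Tendsto (fun k => x k * Q) atTop (𝓝 0) by simpa using hxlim.mul_const Q)
    have h2 := (Real.continuous_sqrt.tendsto' 0 0 Real.sqrt_zero).comp
      (show Tendsto (fun k => (1 - y k) * Q) atTop (𝓝 0) by
        simpa using (hylim.const_sub 1).mul_const Q)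
    simpa using h1.add h2
  have hle := le_of_tendsto_of_tendsto' (hwx.abs.sub hwy.abs).abs hR fun k => by
    have := H.abs_abs_sub_abs_le hQ (hx1 k) (hy1 k) (hxg k).1 (hyg k).1
    rwa [(hxg k).2, (hyg k).2] at this
  have := abs_nonpos_iff.1 hle
  linarith

theorem limitFinite_le_of_tendsto {z : L1I} (H : ChainLimit lam h κ c a z) (hl0 : 0 < l)
    (hl : Tendsto (fun n => lam n / h n) atTop (𝓝 l)) {P Q : ℝ}
    (hP : Tendsto (fun n => potential (lam n) (a n)) atTop (𝓝 P))
    (hQ : Tendsto (fun n => dirichlet (lam n) (a n)) atTop (𝓝 Q)) :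
    limitFinite l z ≤ ENNReal.ofReal c := by
  obtain ⟨g, hg, hgQ, hzg⟩ := H.exists_weakDeriv hQ
  have hzi : Integrable z muI := memLp_one_iff_integrable.1 (Lp.memLp z)
  have hgi : Integrable g muI := hg.integrable one_le_two
  obtain ⟨C, hC⟩ := hzg.exists_ae_eq_primitive hzi hgi
  have hwc : ContinuousOn (fun x => C + ∫ t in (0 : ℝ)..x, g t) (Set.Icc 0 1) :=
    continuousOn_const.add (continuousOn_primitive hgi)
  have hz2 : MemLp z 2 muI := by
    obtain ⟨B, hB⟩ := isCompact_Icc.exists_bound_of_continuousOn hwc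
    refine MemLp.of_bound (Lp.aestronglyMeasurable z) B ?_
    filter_upwards [hC, ae_mem_Ioo] with x hx hxI
    rw [hx]
    exact hB x (Set.Ioo_subset_Icc_self hxI)
  have hper : IsW12per z :=
    ⟨⟨hz2, g, hg, hzg⟩, _, hwc, hC, H.abs_endpoints_eq hQ hwc hC⟩
  rw [limitFinite, if_pos hper]
  have hPle := H.lintegral_pot_le hP
  have hgrad : ∫⁻ x, ENNReal.ofReal (weakDeriv z x ^ 2) ∂muI ≤ ENNReal.ofReal Q := by
    rw [lintegral_congr_ae (hzg.weakDeriv_ae_eq.mono fun x hx => by rw [hx]), lintegral_ofReal_sq hg]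
    exact ENNReal.ofReal_le_ofReal hgQ
  have hP0 : 0 ≤ P := ge_of_tendsto' hP H.sum_pot_nonneg
  have hQ0 : 0 ≤ Q := ge_of_tendsto' hQ H.dirichlet_nonneg
  have hsum : 1 / l * P + l * Q ≤ c := by
    have h1 : Tendsto (fun n => (lam n / h n)⁻¹ * potential (lam n) (a n) +
        κ n * (lam n / h n) * dirichlet (lam n) (a n)) atTop (𝓝 (l⁻¹ * P + 1 * l * Q)) :=
      ((hl.inv₀ hl0.ne').mul hP).add ((H.κ_lim.mul hl).mul hQ)
    rw [one_mul] at h1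
    rw [one_div]
    refine le_of_tendsto' h1 fun n => le_of_eq_of_le ?_ (H.sum_pot_add_sum_grad_le n)
    have := (H.lam_pos n).ne'
    have := (H.h_pos n).ne'
    rw [potential, dirichlet, inv_div]
    congr 1
    field_simp
  calc _ ≤ ENNReal.ofReal (1 / l) * ENNReal.ofReal P + ENNReal.ofReal l * ENNReal.ofReal Q := by
        gcongr
    _ = ENNReal.ofReal (1 / l * P + l * Q) := by
        rw [← ENNReal.ofReal_mul (by positivity), ← ENNReal.ofReal_mul hl0.le,
          ← ENNReal.ofReal_add (by positivity) (by positivity)]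
    _ ≤ _ := ENNReal.ofReal_le_ofReal hsum

/-- Both parts of the energy are bounded separately, so along a subsequence each converges. -/
theorem limitFinite_le {z : L1I} (H : ChainLimit lam h κ c a z) (hl0 : 0 < l)
    (hl : Tendsto (fun n => lam n / h n) atTop (𝓝 l)) : limitFinite l z ≤ ENNReal.ofReal c := by
  obtain ⟨R₁, hR₁⟩ := (hl.const_mul c).bddAbove_range
  obtain ⟨R₂, hR₂⟩ := (H.tendsto_div_κ.mul (hl.inv₀ hl0.ne')).bddAbove_range
  have hmem : ∀ n, (potential (lam n) (a n), dirichlet (lam n) (a n)) ∈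
      Set.Icc 0 R₁ ×ˢ Set.Icc 0 R₂ := fun n => by
    refine ⟨⟨H.sum_pot_nonneg n, (H.sum_pot_le n).trans (hR₁ ⟨n, rfl⟩)⟩, H.dirichlet_nonneg n,
      le_trans ?_ (hR₂ ⟨n, rfl⟩)⟩
    have := H.sum_grad_le n
    simp only [dirichlet, inv_div]
    rw [div_le_iff₀ (H.lam_pos n)]
    refine this.trans (le_of_eq ?_)
    have := (H.lam_pos n).ne'
    field_simp
  obtain ⟨⟨P, Q⟩, -, ψ, hψ, hlim⟩ := (isCompact_Icc.prod isCompact_Icc).tendsto_subseq hmem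
  have hψ' := hψ.tendsto_atTop
  rw [Prod.tendsto_iff] at hlim
  exact (H.comp hψ').limitFinite_le_of_tendsto hl0 (hl.comp hψ') hlim.1 hlim.2

end ChainLimit


/-! ### The case `0 < l < ∞`: recovery sequence -/

/-- The `i`-th of the `M + 1` equidistant nodes in `[0,1]`, constant after the last one. -/
noncomputable def node (M i : ℕ) : ℝ := min 1 (i / M)

theorem node_mem (M i : ℕ) : node M i ∈ Set.Icc (0 : ℝ) 1 :=
  ⟨le_min zero_le_one (by positivity), min_le_left _ _⟩

theorem node_zero (M : ℕ) : node M 0 = 0 := by simp [node]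

theorem node_self {M : ℕ} (hM : 0 < M) : node M M = 1 := by
  have : (M : ℝ) ≠ 0 := by exact_mod_cast hM.ne'
  simp [node, this]

theorem node_of_le {M i : ℕ} (hM : 0 < M) (hi : i ≤ M) : node M i = i / M := by
  have : (0 : ℝ) < M := by exact_mod_cast hM
  refine min_eq_right ?_
  rw [div_le_one this]
  exact_mod_cast hi

/-- Spacing `1/(N - 1)` instead of `λ` puts the first and last bond exactly at `0` and `1`; the
distortion vanishes as `λ (N - 1) → 1`. -/
theorem tendsto_node {lam : ℕ → ℝ} (hlam : ∀ n, 0 < lam n) (hlam0 : Tendsto lam atTop (𝓝 0))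
    {x : ℝ} (hx : x ∈ Set.Ioo (0 : ℝ) 1) (k : ℕ) :
    Tendsto (fun n => node (numCells (lam n) - 1) (⌊x / lam n⌋₊ + k)) atTop (𝓝 x) := by
  have h1 : Tendsto (fun n => lam n * ⌊x / lam n⌋₊ + lam n * k) atTop (𝓝 x) := by
    simpa using (tendsto_mul_floor hlam hlam0 hx.1.le).add (hlam0.mul_const (k : ℝ))
  have h2 : Tendsto (fun n => lam n * numCells (lam n) - lam n) atTop (𝓝 1) := by
    simpa using (tendsto_mul_numCells hlam hlam0).sub hlam0
  have h3 := (tendsto_const_nhds (x := (1 : ℝ))).min (h1.div h2 one_ne_zero)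
  rw [div_one, min_eq_right hx.2.le] at h3
  refine h3.congr' ?_
  filter_upwards [eventually_le_numCells hlam hlam0 1] with n hn
  have := (hlam n).ne'
  simp only [node, Pi.div_apply]
  congr 1
  rw [Nat.cast_sub hn]
  push_cast
  rw [← mul_add, show lam n * numCells (lam n) - lam n = lam n * (numCells (lam n) - 1) by ring,
    mul_div_mul_left _ _ this]

/-- Cauchy–Schwarz on each interval of length `1/M`; the integrals of `g²` add up. -/
theorem sum_sq_sub_node_le {g : ℝ → ℝ} (hg : MemLp g 2 muI) (C : ℝ) {M : ℕ} (hM : 0 < M) :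
    ∑ i ∈ Finset.range M, ((C + ∫ t in (0 : ℝ)..node M (i + 1), g t) -
      (C + ∫ t in (0 : ℝ)..node M i, g t)) ^ 2 ≤ 1 / M * ∫ x, g x ^ 2 ∂muI := by
  have hgi : Integrable g muI := hg.integrable one_le_two
  have hg2 : Integrable (fun t => g t ^ 2) muI := hg.integrable_sq
  have hM' : (0 : ℝ) < M := by exact_mod_cast hM
  have hsum : ∑ i ∈ Finset.range M, ∫ t in node M i..node M (i + 1), g t ^ 2 =
      ∫ x, g x ^ 2 ∂muI := by
    rw [intervalIntegral.sum_integral_adjacent_intervals fun i _ =>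
      intervalIntegrable_of_integrable' hg2 (node_mem M i) (node_mem M (i + 1)),
      node_zero, node_self hM, integral_muI_eq]
  rw [← hsum, Finset.mul_sum]
  refine Finset.sum_le_sum fun i hi => ?_
  have hi := Finset.mem_range.1 hi
  have h0 : (0 : ℝ) ∈ Set.Icc (0 : ℝ) 1 := by simp
  have e1 : node M (i + 1) - node M i = 1 / M := by
    rw [node_of_le hM hi, node_of_le hM hi.le]
    push_cast
    ring
  have e2 : (C + ∫ t in (0 : ℝ)..node M (i + 1), g t) - (C + ∫ t in (0 : ℝ)..node M i, g t) =
      ∫ t in node M i..node M (i + 1), g t := by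
    rw [← intervalIntegral.integral_interval_sub_left
      (intervalIntegrable_of_integrable' hgi h0 (node_mem M (i + 1)))
      (intervalIntegrable_of_integrable' hgi h0 (node_mem M i))]
    ring
  rw [e2, ← e1]
  refine sq_intervalIntegral_le ?_ (intervalIntegrable_of_integrable' hgi (node_mem _ _)
    (node_mem _ _)) (intervalIntegrable_of_integrable' hg2 (node_mem _ _) (node_mem _ _))
  have : 0 < 1 / (M : ℝ) := by positivity
  linarith

theorem tendsto_sum_pot {lam : ℕ → ℝ} (hlam : ∀ n, 0 < lam n) {a : ℕ → ℕ → ℝ}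
    {B : ℝ} (hB : ∀ n i, |a n i| ≤ B) {z : ℝ → ℝ} (hlam0 : Tendsto lam atTop (𝓝 0))
    (h0 : ∀ᵐ x ∂muI, Tendsto (fun n => a n ⌊x / lam n⌋₊) atTop (𝓝 (z x)))
    (h1 : ∀ᵐ x ∂muI, Tendsto (fun n => a n (⌊x / lam n⌋₊ + 1)) atTop (𝓝 (z x))) :
    Tendsto (fun n => ∑ i ∈ Finset.range (numCells (lam n) - 1),
      lam n * ((a n i ^ 2 + a n (i + 1) ^ 2) / 2 - 1) ^ 2) atTop
      (𝓝 (∫ x, (z x ^ 2 - 1) ^ 2 ∂muI)) := by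
  set F : ℕ → ℕ → ℝ := fun n i => if i < numCells (lam n) - 1 then
    ((a n i ^ 2 + a n (i + 1) ^ 2) / 2 - 1) ^ 2 else 0 with hF
  have hint : ∀ n, ∫ x, F n ⌊x / lam n⌋₊ ∂muI = ∑ i ∈ Finset.range (numCells (lam n) - 1),
      lam n * ((a n i ^ 2 + a n (i + 1) ^ 2) / 2 - 1) ^ 2 := fun n => by
    rw [integral_comp_floor (hlam n) (N := numCells (lam n) - 1) ?_ (F n)
      fun i hi => by simp [hF, not_lt.2 hi]]
    · refine Finset.sum_congr rfl fun i hi => ?_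
      simp [hF, Finset.mem_range.1 hi]
    · refine le_trans ?_ (mul_numCells_le (hlam n))
      exact mul_le_mul_of_nonneg_left (by exact_mod_cast Nat.sub_le _ _) (hlam n).le
  simp only [← hint]
  refine tendsto_integral_of_dominated_convergence (fun _ => (B ^ 2 + 1) ^ 2)
    (fun n => (measurable_comp_floor (lam n) (F n)).aestronglyMeasurable) (integrable_const _)
    (fun n => Eventually.of_forall fun x => ?_) ?_
  · simp only [hF]
    have hsq : ∀ i, a n i ^ 2 ≤ B ^ 2 := fun i =>
      sq_le_sq' (abs_le.1 (hB n i)).1 (abs_le.1 (hB n i)).2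
    split_ifs
    · rw [Real.norm_eq_abs, abs_of_nonneg (sq_nonneg _)]
      have e1 := hsq ⌊x / lam n⌋₊
      have e2 := hsq (⌊x / lam n⌋₊ + 1)
      have e3 := sq_nonneg (a n ⌊x / lam n⌋₊)
      have e4 := sq_nonneg (a n (⌊x / lam n⌋₊ + 1))
      exact sq_le_sq' (by linarith) (by linarith)
    · rw [norm_zero]
      positivity
  · filter_upwards [h0, h1, ae_mem_Ioo] with x hx0 hx1 hxI
    have h2 := ((((hx0.pow 2).add (hx1.pow 2)).div_const 2).sub_const 1).pow 2
    rw [show (z x ^ 2 + z x ^ 2) / 2 - 1 = z x ^ 2 - 1 by ring] at h2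
    refine h2.congr' ?_
    filter_upwards [eventually_floor_add_lt hlam hlam0 hxI.1.le hxI.2 1] with n hn
    simp only [hF]
    rw [if_pos (by omega)]

/-- Sampling at the nodes makes the boundary condition exact once `N ≥ 2`. The potential converges
by dominated convergence, and the gradient term is bounded via Cauchy–Schwarz. -/
theorem exists_recovery_primitive {lam del : ℕ → ℝ} (hlam : ∀ n, 0 < lam n)
    (hlam0 : Tendsto lam atTop (𝓝 0)) (hdel : ∀ n, 0 < del n) (hdel0 : Tendsto del atTop (𝓝 0))
    {l : ℝ} (hl0 : 0 < l) (hl : Tendsto (fun n => lam n / Real.sqrt (2 * del n)) atTop (𝓝 l))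
    {z : L1I} {g : ℝ → ℝ} (hg : MemLp g 2 muI) {C : ℝ}
    (hz : ∀ᵐ x ∂muI, z x = C + ∫ t in (0 : ℝ)..x, g t)
    (hper : |C + ∫ t in (0 : ℝ)..0, g t| = |C + ∫ t in (0 : ℝ)..1, g t|) :
    ∃ y : ℕ → L1I, Tendsto y atTop (𝓝 z) ∧
      limsup (fun n => scaledHhf (lam n) (del n) (y n)) atTop ≤
        ENNReal.ofReal (1 / l * (∫ x, (z x ^ 2 - 1) ^ 2 ∂muI) + l * ∫ x, g x ^ 2 ∂muI) := by
  have hwc : ContinuousOn (fun x => C + ∫ t in (0 : ℝ)..x, g t) (Set.Icc 0 1) :=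
    continuousOn_const.add (continuousOn_primitive (hg.integrable one_le_two))
  obtain ⟨B, hB'⟩ := isCompact_Icc.exists_bound_of_continuousOn hwc
  set w : ℝ → ℝ := fun x => C + ∫ t in (0 : ℝ)..x, g t with hw
  set a : ℕ → ℕ → ℝ := fun n i => w (node (numCells (lam n) - 1) i) with ha
  have hB : ∀ n i, |a n i| ≤ B := fun n i => hB' _ (node_mem _ _)
  have hlim : ∀ k : ℕ, ∀ᵐ x ∂muI, Tendsto (fun n => a n (⌊x / lam n⌋₊ + k)) atTop (𝓝 (z x)) := by
    intro k
    filter_upwards [hz, ae_mem_Ioo] with x hx hxI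
    rw [hx]
    exact (hwc x (Set.Ioo_subset_Icc_self hxI)).tendsto.comp (tendsto_nhdsWithin_iff.2
      ⟨tendsto_node hlam hlam0 hxI k, Eventually.of_forall fun n => node_mem _ _⟩)
  obtain ⟨y, hy, hya⟩ := exists_tendsto_L1 hB (hlim 0)
  refine ⟨y, hy, ?_⟩
  set P : ℕ → ℝ := fun n => ∑ i ∈ Finset.range (numCells (lam n) - 1),
      lam n * ((a n i ^ 2 + a n (i + 1) ^ 2) / 2 - 1) ^ 2 with hP
  have hPlim : Tendsto P atTop (𝓝 (∫ x, (z x ^ 2 - 1) ^ 2 ∂muI)) :=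
    tendsto_sum_pot hlam hB hlam0 (hlim 0) (hlim 1)
  have hM : Tendsto (fun n => lam n * numCells (lam n) - lam n) atTop (𝓝 1) := by
    simpa using (tendsto_mul_numCells hlam hlam0).sub hlam0
  have he : Tendsto (fun n => (lam n / Real.sqrt (2 * del n))⁻¹ * P n +
      lam n / Real.sqrt (2 * del n) * (lam n * numCells (lam n) - lam n)⁻¹ *
        ∫ x, g x ^ 2 ∂muI) atTop
      (𝓝 (1 / l * (∫ x, (z x ^ 2 - 1) ^ 2 ∂muI) + l * ∫ x, g x ^ 2 ∂muI)) := by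
    have := ((hl.inv₀ hl0.ne').mul hPlim).add
      ((hl.mul (hM.inv₀ one_ne_zero)).mul_const (∫ x, g x ^ 2 ∂muI))
    simpa using this
  refine limsup_scaledHhf_le hlam hlam0 hdel hdel0 hB ?_
    (Eventually.of_forall fun n => (hya n).mono fun x hx _ => hx) he ?_
  · filter_upwards [eventually_le_numCells hlam hlam0 2] with n hn
    simp only [ha]
    rw [node_zero, node_self (by omega)]
    exact hper
  · filter_upwards [eventually_le_numCells hlam hlam0 2] with n hn
    have hlamn := hlam n
    have hh : 0 < Real.sqrt (2 * del n) := Real.sqrt_pos.2 (mul_pos two_pos (hdel n))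
    have hsum := sum_sq_sub_node_le hg C (M := numCells (lam n) - 1) (by omega)
    rw [quadEnergy_eq hlamn.ne', inv_div]
    refine add_le_add le_rfl ?_
    refine (mul_le_mul_of_nonneg_left hsum (by positivity)).trans (le_of_eq ?_)
    have hN : ((numCells (lam n) - 1 : ℕ) : ℝ) = numCells (lam n) - 1 := by
      rw [Nat.cast_sub (one_le_two.trans hn), Nat.cast_one]
    have hN' : (numCells (lam n) : ℝ) - 1 ≠ 0 := by
      have : (2 : ℝ) ≤ numCells (lam n) := by exact_mod_cast hn
      linarith
    rw [hN, show lam n * numCells (lam n) - lam n = lam n * (numCells (lam n) - 1) by ring]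
    field_simp

theorem gammaConverges_limitFinite {lam del : ℕ → ℝ} (hlam : ∀ n, 0 < lam n)
    (hlam0 : Tendsto lam atTop (𝓝 0)) (hdel : ∀ n, 0 < del n) (hdel0 : Tendsto del atTop (𝓝 0))
    {l : ℝ} (hl0 : 0 < l) (hl : Tendsto (fun n => lam n / Real.sqrt (2 * del n)) atTop (𝓝 l)) :
    GammaConverges (fun n => scaledHhf (lam n) (del n)) (limitFinite l) := by
  intro z
  refine ⟨fun y hy => le_liminf_of_chainLimit hlam hlam0 hdel hdel0 ?_ hy, ?_⟩
  · intro φ κ a c _ hφ H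
    exact H.limitFinite_le hl0 (hl.comp hφ)
  · by_cases hz : IsW12per z
    swap
    · rw [limitFinite, if_neg hz]
      exact ⟨fun _ => z, tendsto_const_nhds, le_top⟩
    rw [limitFinite, if_pos hz]
    obtain ⟨⟨hz2, g, hg, hzg⟩, w, hwc, hzw, hper⟩ := hz
    have hgi : Integrable g muI := hg.integrable one_le_two
    obtain ⟨C, hC⟩ := hzg.exists_ae_eq_primitive (hz2.integrable one_le_two) hgi
    have hWc : ContinuousOn (fun x => C + ∫ t in (0 : ℝ)..x, g t) (Set.Icc 0 1) :=
      continuousOn_const.add (continuousOn_primitive hgi)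
    -- The continuous representative is unique on `[0,1]`, so the end values of `w` are those of the
    -- primitive.
    have heq : Set.EqOn w (fun x => C + ∫ t in (0 : ℝ)..x, g t) (Set.Icc 0 1) := by
      refine Measure.eqOn_Icc_of_ae_eq volume zero_ne_one ?_ hwc hWc
      rw [← Measure.restrict_congr_set (μ := volume) (Ioo_ae_eq_Icc (a := (0 : ℝ)) (b := 1))]
      exact hzw.symm.trans hC
    rw [heq (by simp), heq (by simp)] at hper
    obtain ⟨y, hy, hle⟩ := exists_recovery_primitive hlam hlam0 hdel hdel0 hl0 hl hg hC hper
    refine ⟨y, hy, hle.trans (le_of_eq ?_)⟩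
    obtain ⟨B, hB⟩ := isCompact_Icc.exists_bound_of_continuousOn hWc
    have hpot : Integrable (fun x => (z x ^ 2 - 1) ^ 2) muI := by
      refine Integrable.of_bound
        ((((Lp.aestronglyMeasurable z).pow 2).sub aestronglyMeasurable_const).pow 2)
        ((B ^ 2 + 1) ^ 2) ?_
      filter_upwards [hC, ae_mem_Ioo] with x hx hxI
      have h1 : |z x| ≤ B := by
        rw [hx]
        exact hB x (Set.Ioo_subset_Icc_self hxI)
      have h2 : z x ^ 2 ≤ B ^ 2 := sq_le_sq' (abs_le.1 h1).1 (abs_le.1 h1).2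
      rw [Real.norm_eq_abs, abs_of_nonneg (sq_nonneg _)]
      exact sq_le_sq' (by nlinarith [sq_nonneg (z x)]) (by linarith)
    have e1 : ∫⁻ x, ENNReal.ofReal ((z x ^ 2 - 1) ^ 2) ∂muI =
        ENNReal.ofReal (∫ x, (z x ^ 2 - 1) ^ 2 ∂muI) :=
      (ofReal_integral_eq_lintegral_ofReal hpot (Eventually.of_forall fun _ => sq_nonneg _)).symm
    have e2 : ∫⁻ x, ENNReal.ofReal (weakDeriv z x ^ 2) ∂muI =
        ENNReal.ofReal (∫ x, g x ^ 2 ∂muI) := by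
      rw [lintegral_congr_ae (hzg.weakDeriv_ae_eq.mono fun x hx => by rw [hx]),
        lintegral_ofReal_sq hg]
    have p1 : 0 ≤ ∫ x, (z x ^ 2 - 1) ^ 2 ∂muI := integral_nonneg fun _ => sq_nonneg _
    have p2 : 0 ≤ ∫ x, g x ^ 2 ∂muI := integral_nonneg fun _ => sq_nonneg _
    rw [e1, e2, ← ENNReal.ofReal_mul (by positivity), ← ENNReal.ofReal_mul hl0.le,
      ← ENNReal.ofReal_add (by positivity) (by positivity)]

end SpinChain

theorem theorem4p1 (lam del : ℕ → ℝ)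
    (hlam : ∀ n, 0 < lam n) (hlam0 : Tendsto lam atTop (𝓝 0))
    (hdel : ∀ n, 0 < del n) (hdel0 : Tendsto del atTop (𝓝 0)) :
    (Tendsto (fun n => lam n / Real.sqrt (2 * del n)) atTop (𝓝 0) →
      SpinChain.GammaConverges (fun n => SpinChain.scaledHhf (lam n) (del n))
        SpinChain.limitZero) ∧
    (∀ l : ℝ, 0 < l → Tendsto (fun n => lam n / Real.sqrt (2 * del n)) atTop (𝓝 l) →
      SpinChain.GammaConverges (fun n => SpinChain.scaledHhf (lam n) (del n))
        (SpinChain.limitFinite l)) ∧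
    (Tendsto (fun n => lam n / Real.sqrt (2 * del n)) atTop atTop →
      SpinChain.GammaConverges (fun n => SpinChain.scaledHhf (lam n) (del n))
        SpinChain.limitTop) :=
  ⟨SpinChain.gammaConverges_limitZero hlam hlam0 hdel hdel0,
    fun _ hl0 hl => SpinChain.gammaConverges_limitFinite hlam hlam0 hdel hdel0 hl0 hl,
    SpinChain.gammaConverges_limitTop hlam hlam0 hdel hdel0⟩
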